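/- **Plant.** Let $n,m\ge 1$, $A\in\mathbb R^{n\times n}$, $B\in\mathbb R^{n\times 1}$, $C_X\in\mathbb R^{1\times n}$, $q>0$, $\bar a_1,\dots,\bar a_m\in\mathbb R$, and consider on $(x,t)\in[0,1]\times[0,\infty)$ $$\dot X=AX+Bu_x(0,t),\quad u_t=q\,u_{xx},\quad u(0,t)=C_XX(t),\quad u(1,t)=C_zZ(t),\quad \dot Z=A_zZ+B_zU(t),$$ where $A_z$ is the $m\times m$ companion matrix with ones on the superdiagonal and last row $(\bar a_1,\dots,\bar a_m)$, $B_z=(0,\dots,0,1)^T$, $C_z=(1,0,\dots,0)$. Let $K\in\mathbb R^{1\times n}$ be such that $A+BK$ is Hurwitz (such a $K$ exists if $(A,B)$ is controllable). **Kernels.** Put $$\Phi(x)=\big[C_X,\;K-\tfrac1qC_XBC_X\big]e^{Dx}\begin{bmatrix}I\\0\end{bmatrix},\quad \phi(x,y)=\tfrac1q\Phi(x-y)B,\quad D=\begin{pmatrix}0&A/q\\ I&-BC_X/q\end{pmatrix},$$ $$\Gamma(x)=-\big[C_X,\;K\big]e^{Ex}\begin{bmatrix}I\\0\end{bmatrix},\quad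 \psi(x,y)=\tfrac1q\Gamma(x-y)B,\quad E=\begin{pmatrix}0&(A+BK)/q\\ I&0\end{pmatrix},$$ so that $w(x)=u(x)-\int_0^x\phi(x,y)u(y)\,dy-\Phi(x)X$ has the inverse $u(x)=w(x)-\int_0^x\psi(x,y)w(y)\,dy-\Gamma(x)X$. Let $\chi_{k,j}$ be the coefficients in $\partial_x^k\int_0^x\psi(x,y)w(y)\,dy=\int_0^x\partial_x^k\psi(x,y)w(y)\,dy+\sum_{j=0}^{k-1}\chi_{k,j}(x)\,\partial_x^{k-j-1}w(x)$, obtained by successive differentiation, and for $x_0\in\{0,1\}$ put $\mathcal I_{k,x_0}=\partial_x^k-\sum_{j=0}^{k-1}\chi_{k,j}(x_0)\,\partial_x^{k-j-1}$. **Control law.** Define differential operators in $x$ with constant coefficients $$\mathcal B=\bar a_1+\sum_{k=1}^{m-1}\bar a_{k+1}q^k\mathcal I_{2k,1}+q^m\sum_{i=1}^{2m}(-1)^i\,\partial_y^{i-1}\phi(1,1)\,\mathcal I_{2m-i,1},$$ $$\mathcal C=-q^m\sum_{i=1}^{2m}(-1)^i\,\partial_y^{i-1}\phi(1,0)\,\mathcal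 I_{2m-i,0}-\Phi(1)\sum_{i=1}^mA^{i-1}B\,q^{m-i}\,\mathcal I_{2(m-i)+1,0}.$$ For gains $c_1,\dots,c_m>0$ put formally $y_0=0$, $\tau_0=0$, $y_i=\partial_t^{i-1}w(1,t)+\tau_{i-1}$, $\tau_i=\dot\tau_{i-1}+y_{i-1}+c_iy_i$, write $y_{m-1}+\dot\tau_{m-1}=\sum_{i=0}^{m-1}\alpha_i\,\partial_t^iw(1,t)$ and $y_m=\sum_{i=0}^{m-1}\beta_i\,\partial_t^iw(1,t)$, where $\alpha_i,\beta_i$ depend only on $c_1,\dots,c_{m-1}$, and let $\mathcal L=-\mathcal B-\sum_{i=0}^{m-1}q^i(\alpha_i+c_m\beta_i)\,\partial_x^{2i}$. The control law is $$U(t)=\mathcal Lu(1,t)-\big(\mathcal L\Phi(1)-\mathcal C\Phi(0)\big)X(t)-\mathcal Cu(0,t)-\Big(\mathcal L\!\int_0^x\!\phi(x,y)u(y,t)\,dy\Big)\Big|_{x=1}+\Big(\mathcal C\!\int_0^x\!\phi(x,y)u(y,t)\,dy\Big)\Big|_{x=0}.$$ **Solutions.** A closed-loop solution is a triple $(u,X,Z)$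 with $u\in C([0,\infty);H^{2m}(0,1))\cap C^1([0,\infty);L^2(0,1))$ and $X,Z$ differentiable on $[0,\infty)$ (one-sidedly at $0$) that satisfies the plant equations for all $t\ge0$ (the heat equation as an identity in $L^2(0,1)$) with $U(t)$ given by the control law. In particular $u(\cdot,0)\in H^{2m}(0,1)$. **Theorem.** For all $c_1,\dots,c_{m-1}>0$ there is $c^*>0$ such that for every $c_m>c^*$ there is $\lambda_{sf}>0$ with the following property: for all initial data $(u_0,X_0,Z_0)$ there is a constant $\Upsilon_{sf}>0$, depending (for the given plant and gains) only on $(u_0,X_0,Z_0)$, such that every closed-loop solution with $u(\cdot,0)=u_0$ on $[0,1]$, $X(0)=X_0$, $Z(0)=Z_0$ satisfies, for all $t\ge 0$, $$|U(t)|\le\Upsilon_{sf}\qquad\text{and}\qquad|U(t)|\le\Upsilon_{sf}\,e^{-\lambda_{sf}t}.$$ -/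

import Mathlib

open Set Filter Topology MeasureTheory
open scoped Matrix

noncomputable section

namespace Sandwich

/-! ### Plant data -/

/-- Coefficients of the ODE-PDE-ODE plant
`X' = A X + B u_x(0,t)`, `u_t = q u_xx`, `u(0,t) = C_X X`, `u(1,t) = C_z Z`, `Z' = A_z Z + B_z U`.
The column `B` and the row `C_X` are plain vectors; `a` is the last row of the companion matrix
`A_z` (so `a k` is the entry usually written with the index `k + 1`). -/
structure Plant (n m : ℕ) where
  A : Matrix (Fin n) (Fin n) ℝ
  B : Fin n → ℝ
  CX : Fin n → ℝ
  q : ℝ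
  a : Fin m → ℝ

variable {n m : ℕ}

/-- Companion matrix of the input ODE. -/
def Plant.Az (P : Plant n m) : Matrix (Fin m) (Fin m) ℝ := fun i j =>
  if i.val + 1 = m then P.a j else if j.val = i.val + 1 then 1 else 0

/-- `B_z = (0, …, 0, 1)ᵀ`. -/
def Bz (m : ℕ) : Fin m → ℝ := fun i => if i.val + 1 = m then 1 else 0

/-- `C_z = (1, 0, …, 0)`. -/
def Cz (m : ℕ) : Fin m → ℝ := fun i => if i.val = 0 then 1 else 0

/-- The matrix `A + B K` of the target ODE. -/
def Plant.AK (P : Plant n m) (K : Fin n → ℝ) : Matrix (Fin n) (Fin n) ℝ :=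
  P.A + Matrix.vecMulVec P.B K

/-- A real square matrix is Hurwitz if all its complex eigenvalues have negative real part. -/
def IsHurwitz (M : Matrix (Fin n) (Fin n) ℝ) : Prop :=
  ∀ z ∈ spectrum ℂ (M.map (algebraMap ℝ ℂ)), z.re < 0

/-! ### Backstepping kernels

The direct transformation is `w(x) = u(x) - ∫₀ˣ φ(x,y) u(y) dy - Φ(x) X`, the inverse one is
`u(x) = w(x) - ∫₀ˣ ψ(x,y) w(y) dy - Γ(x) X`. -/

/-- The block matrix with `Φ'' = Φ A / q - Φ' B C_X / q`, i.e. `(Φ, Φ')' = (Φ, Φ') D`. -/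
def Plant.D (P : Plant n m) : Matrix (Fin n ⊕ Fin n) (Fin n ⊕ Fin n) ℝ :=
  Matrix.fromBlocks 0 (P.q⁻¹ • P.A) 1 (-(P.q⁻¹ • Matrix.vecMulVec P.B P.CX))

/-- The block matrix with `Γ'' = Γ (A + B K) / q`, i.e. `(Γ, Γ')' = (Γ, Γ') E`. -/
def Plant.E (P : Plant n m) (K : Fin n → ℝ) : Matrix (Fin n ⊕ Fin n) (Fin n ⊕ Fin n) ℝ :=
  Matrix.fromBlocks 0 (P.q⁻¹ • P.AK K) 1 0

/-- `Φ(x) = [C_X, K - C_X B C_X / q] e^{D x} [I; 0]`. -/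
def Plant.Phi (P : Plant n m) (K : Fin n → ℝ) (x : ℝ) : Fin n → ℝ := fun j =>
  (Sum.elim P.CX (K - (P.q⁻¹ * (P.CX ⬝ᵥ P.B)) • P.CX) ᵥ* NormedSpace.exp (x • P.D)) (Sum.inl j)

/-- `φ(x,y) = Φ(x - y) B / q`. -/
def Plant.phi (P : Plant n m) (K : Fin n → ℝ) (x y : ℝ) : ℝ :=
  P.q⁻¹ * (P.Phi K (x - y) ⬝ᵥ P.B)

/-- `Γ(x) = -[C_X, K] e^{E x} [I; 0]`. -/
def Plant.Gam (P : Plant n m) (K : Fin n → ℝ) (x : ℝ) : Fin n → ℝ := fun j =>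
  -(Sum.elim P.CX K ᵥ* NormedSpace.exp (x • P.E K)) (Sum.inl j)

/-- `ψ(x,y) = Γ(x - y) B / q`. -/
def Plant.psi (P : Plant n m) (K : Fin n → ℝ) (x y : ℝ) : ℝ :=
  P.q⁻¹ * (P.Gam K (x - y) ⬝ᵥ P.B)

/-! ### The boundary operators `𝓑`, `𝓒` and the feedback law -/

/-- `∂ₓᵏ f` on `[0,1]`, one-sided at the end points. -/
def dx (k : ℕ) (f : ℝ → ℝ) : ℝ → ℝ := iteratedDerivWithin k f (Icc 0 1)

/-- The coefficients `χ_{k_j}(x)` in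
`∂ₓᵏ ∫₀ˣ ψ(x,y) w(y) dy = ∫₀ˣ ∂ₓᵏψ(x,y) w(y) dy + ∑_{j<k} χ_{k_j}(x) ∂ₓ^{k-j-1} w(x)`,
generated by differentiating this formula once more; `χ_{k_j} = 0` for `k ≤ j`. -/
def chi (ψ : ℝ → ℝ → ℝ) : ℕ → ℕ → ℝ → ℝ
  | 0, _ => fun _ => 0
  | k + 1, j => fun x =>
      (if j = k then iteratedDeriv k (fun x' => ψ x' x) x else chi ψ k j x)
        + (if j = 0 then 0 else deriv (chi ψ k (j - 1)) x)

/-- The part of `∂ₓᵏ u(x)` (with `u` written in terms of `w` by the inverse transformation)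
that consists of point values at `x` of derivatives of `w`, with coefficients frozen at `x₀`:
`∂ₓᵏ w(x) - ∑_{j<k} χ_{k_j}(x₀) ∂ₓ^{k-j-1} w(x)`. -/
def Plant.invD (P : Plant n m) (K : Fin n → ℝ) (k : ℕ) (x₀ : ℝ) (f : ℝ → ℝ) (x : ℝ) : ℝ :=
  dx k f x - ∑ j ∈ Finset.range k, chi (P.psi K) k j x₀ * dx (k - j - 1) f x

/-- `∂_y^k φ(x,y)`. -/
def Plant.dyPhi (P : Plant n m) (K : Fin n → ℝ) (k : ℕ) (x y : ℝ) : ℝ :=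
  iteratedDeriv k (fun y' => P.phi K x y') y

/-- The differential operator `𝓑`, acting on a function of `x ∈ [0,1]`. -/
def Plant.opB (P : Plant n m) (K : Fin n → ℝ) (f : ℝ → ℝ) (x : ℝ) : ℝ :=
  (∑ k : Fin m, P.a k * P.q ^ (k : ℕ) * P.invD K (2 * k) 1 f x)
    + P.q ^ m * ∑ i ∈ Finset.Icc 1 (2 * m),
        (-1) ^ i * P.dyPhi K (i - 1) 1 1 * P.invD K (2 * m - i) 1 f x

/-- The differential operator `𝓒`, acting on a function of `x ∈ [0,1]`. -/
def Plant.opC (P : Plant n m) (K : Fin n → ℝ) (f : ℝ → ℝ) (x : ℝ) : ℝ :=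
  -(P.q ^ m * ∑ i ∈ Finset.Icc 1 (2 * m),
        (-1) ^ i * P.dyPhi K (i - 1) 1 0 * P.invD K (2 * m - i) 0 f x)
    - ∑ i ∈ Finset.Icc 1 m,
        (P.Phi K 1 ⬝ᵥ (P.A ^ (i - 1) *ᵥ P.B)) * P.q ^ (m - i) *
          P.invD K (2 * (m - i) + 1) 0 f x

/-- The virtual controls `τ_i` as polynomials in `∂_t` applied to `w(1,t)`:
`τ_0 = 0`, `τ_1 = c_1 y_1`, `τ_i = ∂_t τ_{i-1} + y_{i-1} + c_i y_i`,
where `y_i = ∂_t^{i-1} w(1,t) + τ_{i-1}`. -/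
def tau (c : ℕ → ℝ) : ℕ → Polynomial ℝ
  | 0 => 0
  | 1 => Polynomial.C (c 1)
  | i + 2 => Polynomial.X * tau c (i + 1) + (Polynomial.X ^ i + tau c i)
      + Polynomial.C (c (i + 2)) * (Polynomial.X ^ (i + 1) + tau c (i + 1))

/-- The states `y_i = ∂_t^{i-1} w(1,t) + τ_{i-1}` as polynomials in `∂_t`, with `y_0 = 0`. -/
def yPoly (c : ℕ → ℝ) : ℕ → Polynomial ℝ
  | 0 => 0
  | i + 1 => Polynomial.X ^ i + tau c i

/-- `α_i`, from `y_{m-1} + ∂_t τ_{m-1} = ∑_{i<m} α_i ∂_t^i w(1,t)`. -/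
def alpha (m : ℕ) (c : ℕ → ℝ) (i : ℕ) : ℝ :=
  (yPoly c (m - 1) + Polynomial.X * tau c (m - 1)).coeff i

/-- `β_i`, from `y_m = ∑_{i<m} β_i ∂_t^i w(1,t)`. -/
def beta (m : ℕ) (c : ℕ → ℝ) (i : ℕ) : ℝ := (yPoly c m).coeff i

/-- `𝓛 = -𝓑 - ∑_{i<m} q^i (α_i + c_m β_i) ∂ₓ^{2i}`; `c` supplies `c_1, …, c_{m-1}`. -/
def Plant.opL (P : Plant n m) (K : Fin n → ℝ) (c : ℕ → ℝ) (cm : ℝ) (f : ℝ → ℝ) (x : ℝ) : ℝ :=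
  -P.opB K f x
    - ∑ i ∈ Finset.range m, P.q ^ i * (alpha m c i + cm * beta m c i) * dx (2 * i) f x

/-- `x ↦ ∫₀ˣ φ(x,y) f(y) dy`. -/
def Plant.volt (P : Plant n m) (K : Fin n → ℝ) (f : ℝ → ℝ) (x : ℝ) : ℝ :=
  ∫ y in (0 : ℝ)..x, P.phi K x y * f y

/-- The state-feedback law, evaluated at the state `(f, ξ) = (u(·,t), X(t))`:
`𝓛u(1) - (𝓛Φ(1) - 𝓒Φ(0)) X - 𝓒u(0) - 𝓛∫φu (1) + 𝓒∫φu (0)`. -/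
def Plant.feedback (P : Plant n m) (K : Fin n → ℝ) (c : ℕ → ℝ) (cm : ℝ)
    (f : ℝ → ℝ) (ξ : Fin n → ℝ) : ℝ :=
  P.opL K c cm f 1
    - (fun j => P.opL K c cm (fun x => P.Phi K x j) 1 - P.opC K (fun x => P.Phi K x j) 0) ⬝ᵥ ξ
    - P.opC K f 0
    - P.opL K c cm (P.volt K f) 1
    + P.opC K (P.volt K f) 0

/-! ### Solutions of the closed loop -/

/-- Lebesgue measure on `[0,1]`. -/
def unitMeasure : Measure ℝ := volume.restrict (Icc 0 1)

/-- `f ∈ H^k(0,1)` (continuous representative when `k ≥ 1`): `f` is `C^{k-1}` on `[0,1]`,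
`∂ₓ^{k-1} f` is absolutely continuous, and its a.e. derivative is square integrable. -/
def MemH : ℕ → (ℝ → ℝ) → Prop
  | 0, f => MemLp f 2 unitMeasure
  | k + 1, f => ContDiffOn ℝ k f (Icc 0 1) ∧ AbsolutelyContinuousOnInterval (dx k f) 0 1 ∧
      MemLp (dx (k + 1) f) 2 unitMeasure

/-- `(u, X, Z, U)` is a strong solution on `[0,∞)` of the plant under the feedback law:
`u ∈ C([0,∞); H^{2m}(0,1)) ∩ C¹([0,∞); L²(0,1))`, the ODEs and boundary conditions hold for all
`t ≥ 0`, and `U(t)` is the feedback law. -/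
structure Plant.IsClosedLoopSolution (P : Plant n m) (K : Fin n → ℝ) (c : ℕ → ℝ) (cm : ℝ)
    (u : ℝ → ℝ → ℝ) (X : ℝ → Fin n → ℝ) (Z : ℝ → Fin m → ℝ) (U : ℝ → ℝ) : Prop where
  memH : ∀ t, 0 ≤ t → MemH (2 * m) (fun x => u x t)
  continuous_H : ∀ t, 0 ≤ t → ∀ i ≤ 2 * m,
    Tendsto (fun s => eLpNorm (fun x => dx i (fun y => u y s) x - dx i (fun y => u y t) x)
      2 unitMeasure) (𝓝[Ici 0] t) (𝓝 0)
  heat : ∀ t, 0 ≤ t →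
    Tendsto (fun s => eLpNorm
      (fun x => (s - t)⁻¹ * (u x s - u x t) - P.q * dx 2 (fun y => u y t) x)
      2 unitMeasure) (𝓝[Ici 0 \ {t}] t) (𝓝 0)
  odeX : ∀ t, 0 ≤ t →
    HasDerivWithinAt X (P.A *ᵥ X t + dx 1 (fun y => u y t) 0 • P.B) (Ici 0) t
  odeZ : ∀ t, 0 ≤ t → HasDerivWithinAt Z (P.Az *ᵥ Z t + U t • Bz m) (Ici 0) t
  left : ∀ t, 0 ≤ t → u 0 t = P.CX ⬝ᵥ X t
  right : ∀ t, 0 ≤ t → u 1 t = Cz m ⬝ᵥ Z t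
  control : ∀ t, 0 ≤ t → U t = P.feedback K c cm (fun x => u x t) (X t)

end Sandwich

end

/-!
The backstepping transformation turns the closed loop into a target system for `(w, X)`: `w` solves
the heat equation with `w(0,t) = 0`, the state satisfies `X' = (A + B K) X + B w_x(0,t)`, and the
feedback is chosen such that `∂_t^m w(1,t)` equals `-∑_{i<m} (α_i + c_m β_i) ∂_t^i w(1,t)` up to a
remainder that is nonlocal but of order zero: it is a bounded functional of `w(·,t)` and `X(t)`.

By the maximum principle with exponentially decaying barriers, a bound
`|w(1,t)| ≤ S e^{-λt}` yields bounds of the same form for `w`, for `w_x(0,t)`, hence for `X` and for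
the remainder, with a gain that does not depend on `c_m`. In the coordinates `y_1, …, y_m` the
derivatives `∂_t^i w(1,t)` form a chain with a quadratic Lyapunov function, in which the remainder
enters only the last equation. There it is damped by `c_m`, so for large `c_m` the loop of estimates
closes and `∂_t^i w(1,t)` decays for all `i ≤ m`. Barriers at both ends transfer this decay to all
traces `∂_x^k w(0,t)` and `∂_x^k w(1,t)` with `k < 2m`. Written in terms of `w`, the integrals in
the control law cancel, and `U(t)` is a linear combination of these traces.
-/

noncomputable section

namespace Sandwich

variable {n m : ℕ}

/-! ### Kernels -/

/-- The `k`-th derivative of the row vector `x ↦ r e^{x M}`. -/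
def expRow {ι : Type*} [Fintype ι] [DecidableEq ι] (r : ι → ℝ) (M : Matrix ι ι ℝ) (k : ℕ) (x : ℝ) :
    ι → ℝ :=
  (r ᵥ* M ^ k) ᵥ* NormedSpace.exp (x • M)

section ExpRow

variable {ι : Type*} [Fintype ι] [DecidableEq ι]

section
attribute [local instance] Matrix.linftyOpNormedRing Matrix.linftyOpNormedAlgebra

lemma hasDerivAt_matrix_exp_smul (M : Matrix ι ι ℝ) (x : ℝ) :
    HasDerivAt (fun x : ℝ => NormedSpace.exp (x • M)) (M * NormedSpace.exp (x • M)) x :=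
  hasDerivAt_exp_smul_const' M x

end

lemma hasDerivAt_expRow (r : ι → ℝ) (M : Matrix ι ι ℝ) (k : ℕ) (x : ℝ) :
    HasDerivAt (expRow r M k) (expRow r M (k + 1) x) x := by
  have hExp := hasDerivAt_matrix_exp_smul M x
  have hrow : expRow r M (k + 1) x = (r ᵥ* M ^ k) ᵥ* (M * NormedSpace.exp (x • M)) := by
    rw [expRow, pow_succ, ← Matrix.vecMul_vecMul, Matrix.vecMul_vecMul]
  rw [hrow]
  exact hasDerivAt_pi.2 fun i => HasDerivAt.fun_sum fun a _ =>
    (hasDerivAt_pi.1 (hasDerivAt_pi.1 hExp a) i).const_mul _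

lemma expRow_succ (r : ι → ℝ) (M : Matrix ι ι ℝ) (k : ℕ) (x : ℝ) :
    expRow r M (k + 1) x = expRow r M k x ᵥ* M := by
  have hcomm : Commute M (NormedSpace.exp (x • M)) :=
    ((Commute.refl M).smul_right x).exp_right
  rw [expRow, expRow, pow_succ, ← Matrix.vecMul_vecMul, Matrix.vecMul_vecMul, hcomm.eq,
    ← Matrix.vecMul_vecMul]

lemma expRow_apply_zero (r : ι → ℝ) (M : Matrix ι ι ℝ) (k : ℕ) : expRow r M k 0 = r ᵥ* M ^ k := by
  simp [expRow]

lemma expRow_fromBlocks_succ_inl (r : ι ⊕ ι → ℝ) (M N : Matrix ι ι ℝ) (k : ℕ) (x : ℝ) :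
    expRow r (Matrix.fromBlocks 0 M 1 N) (k + 1) x ∘ Sum.inl
      = expRow r (Matrix.fromBlocks 0 M 1 N) k x ∘ Sum.inr := by
  simp [expRow_succ, Matrix.vecMul_fromBlocks]

lemma expRow_fromBlocks_add_two_inl (r : ι ⊕ ι → ℝ) (M N : Matrix ι ι ℝ) (k : ℕ) (x : ℝ) :
    expRow r (Matrix.fromBlocks 0 M 1 N) (k + 2) x ∘ Sum.inl
      = (expRow r (Matrix.fromBlocks 0 M 1 N) k x ∘ Sum.inl) ᵥ* M
        + (expRow r (Matrix.fromBlocks 0 M 1 N) (k + 1) x ∘ Sum.inl) ᵥ* N := by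
  rw [expRow_fromBlocks_succ_inl, expRow_fromBlocks_succ_inl, expRow_succ,
    Matrix.vecMul_fromBlocks, Sum.elim_comp_inr]

end ExpRow

lemma hasDerivWithinAt_dotProduct_const {ι : Type*} [Fintype ι] {v : ℝ → ι → ℝ} {v' : ι → ℝ}
    {x : ℝ} {s : Set ℝ} (h : HasDerivWithinAt v v' s x) (b : ι → ℝ) :
    HasDerivWithinAt (fun x => v x ⬝ᵥ b) (v' ⬝ᵥ b) s x :=
  HasDerivWithinAt.fun_sum fun i _ => (hasDerivWithinAt_pi.1 h i).mul_const _

lemma hasDerivAt_dotProduct_const {ι : Type*} [Fintype ι] {v : ℝ → ι → ℝ} {v' : ι → ℝ}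
    {x : ℝ} (h : HasDerivAt v v' x) (b : ι → ℝ) :
    HasDerivAt (fun x => v x ⬝ᵥ b) (v' ⬝ᵥ b) x :=
  hasDerivWithinAt_univ.1 (hasDerivWithinAt_dotProduct_const h.hasDerivWithinAt b)

section Plant

variable (P : Plant n m) (K : Fin n → ℝ)

/-- The `k`-th derivative of `Φ`. -/
def Plant.PhiD (k : ℕ) (x : ℝ) : Fin n → ℝ :=
  expRow (Sum.elim P.CX (K - (P.q⁻¹ * (P.CX ⬝ᵥ P.B)) • P.CX)) P.D k x ∘ Sum.inl

/-- The `k`-th derivative of `Γ`. -/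
def Plant.GamD (k : ℕ) (x : ℝ) : Fin n → ℝ :=
  -(expRow (Sum.elim P.CX K) (P.E K) k x ∘ Sum.inl)

/-- The `k`-th derivative of the convolution kernel `s ↦ q⁻¹ Φ(s) B` of `φ(x, y)`. -/
def Plant.phiD (k : ℕ) (x : ℝ) : ℝ := P.q⁻¹ * (P.PhiD K k x ⬝ᵥ P.B)

/-- The `k`-th derivative of the convolution kernel `s ↦ q⁻¹ Γ(s) B` of `ψ(x, y)`. -/
def Plant.psiD (k : ℕ) (x : ℝ) : ℝ := P.q⁻¹ * (P.GamD K k x ⬝ᵥ P.B)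

lemma Plant.PhiD_zero : P.PhiD K 0 = P.Phi K := by
  funext x j; simp [PhiD, Phi, expRow]

lemma Plant.GamD_zero : P.GamD K 0 = P.Gam K := by
  funext x j; simp [GamD, Gam, expRow]

lemma Plant.phi_eq (x y : ℝ) : P.phi K x y = P.phiD K 0 (x - y) := by
  simp [phi, phiD, PhiD_zero]

lemma Plant.psi_eq (x y : ℝ) : P.psi K x y = P.psiD K 0 (x - y) := by
  simp [psi, psiD, GamD_zero]

lemma Plant.hasDerivAt_PhiD (k : ℕ) (x : ℝ) :
    HasDerivAt (P.PhiD K k) (P.PhiD K (k + 1) x) x :=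
  hasDerivAt_pi.2 fun j => hasDerivAt_pi.1 (hasDerivAt_expRow _ P.D k x) (Sum.inl j)

lemma Plant.hasDerivAt_GamD (k : ℕ) (x : ℝ) :
    HasDerivAt (P.GamD K k) (P.GamD K (k + 1) x) x :=
  hasDerivAt_pi.2 fun j => (hasDerivAt_pi.1 (hasDerivAt_expRow _ (P.E K) k x) (Sum.inl j)).neg

lemma Plant.hasDerivAt_phiD (k : ℕ) (x : ℝ) :
    HasDerivAt (P.phiD K k) (P.phiD K (k + 1) x) x :=
  (hasDerivAt_dotProduct_const (P.hasDerivAt_PhiD K k x) P.B).const_mul _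

lemma Plant.hasDerivAt_psiD (k : ℕ) (x : ℝ) :
    HasDerivAt (P.psiD K k) (P.psiD K (k + 1) x) x :=
  (hasDerivAt_dotProduct_const (P.hasDerivAt_GamD K k x) P.B).const_mul _

@[fun_prop]
lemma Plant.continuous_PhiD (k : ℕ) : Continuous (P.PhiD K k) :=
  continuous_iff_continuousAt.2 fun x => (P.hasDerivAt_PhiD K k x).continuousAt

@[fun_prop]
lemma Plant.continuous_GamD (k : ℕ) : Continuous (P.GamD K k) :=
  continuous_iff_continuousAt.2 fun x => (P.hasDerivAt_GamD K k x).continuousAt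

@[fun_prop]
lemma Plant.continuous_phiD (k : ℕ) : Continuous (P.phiD K k) :=
  continuous_iff_continuousAt.2 fun x => (P.hasDerivAt_phiD K k x).continuousAt

@[fun_prop]
lemma Plant.continuous_psiD (k : ℕ) : Continuous (P.psiD K k) :=
  continuous_iff_continuousAt.2 fun x => (P.hasDerivAt_psiD K k x).continuousAt

lemma Plant.PhiD_add_two (k : ℕ) (x : ℝ) :
    P.PhiD K (k + 2) x
      = P.q⁻¹ • (P.PhiD K k x ᵥ* P.A) - P.phiD K (k + 1) x • P.CX := by
  have h : P.PhiD K (k + 2) x = P.PhiD K k x ᵥ* (P.q⁻¹ • P.A)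
      + P.PhiD K (k + 1) x ᵥ* (-(P.q⁻¹ • Matrix.vecMulVec P.B P.CX)) :=
    expRow_fromBlocks_add_two_inl _ _ _ _ _
  rw [h, Matrix.vecMul_neg, Matrix.vecMul_smul, Matrix.vecMul_smul, Matrix.vecMul_vecMulVec,
    smul_smul, phiD, sub_eq_add_neg]

lemma Plant.GamD_add_two (k : ℕ) (x : ℝ) :
    P.GamD K (k + 2) x = P.q⁻¹ • (P.GamD K k x ᵥ* P.A) + P.psiD K k x • K := by
  have h : P.GamD K (k + 2) x = P.GamD K k x ᵥ* (P.q⁻¹ • P.AK K) := by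
    simp only [GamD, E, expRow_fromBlocks_add_two_inl, Matrix.vecMul_zero, add_zero,
      Matrix.neg_vecMul]
  rw [h, AK, Matrix.vecMul_smul, Matrix.vecMul_add, Matrix.vecMul_vecMulVec, smul_add, smul_smul,
    psiD]

lemma Plant.PhiD_zero_zero : P.PhiD K 0 0 = P.CX := by
  simp [PhiD, expRow_apply_zero]

lemma Plant.PhiD_one_zero : P.PhiD K 1 0 = K - (P.q⁻¹ * (P.CX ⬝ᵥ P.B)) • P.CX := by
  simp [PhiD, D, expRow_apply_zero, Matrix.vecMul_fromBlocks]

lemma Plant.GamD_zero_zero : P.GamD K 0 0 = -P.CX := by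
  simp [GamD, expRow_apply_zero]

lemma Plant.GamD_one_zero : P.GamD K 1 0 = -K := by
  simp [GamD, E, expRow_apply_zero, Matrix.vecMul_fromBlocks]

lemma iteratedDeriv_eq_of_hasDerivAt {f : ℕ → ℝ → ℝ}
    (h : ∀ k x, HasDerivAt (f k) (f (k + 1) x) x) (k : ℕ) : iteratedDeriv k (f 0) = f k := by
  induction k with
  | zero => simp
  | succ k ih => rw [iteratedDeriv_succ, ih]; exact funext fun x => (h k x).deriv

lemma Plant.dyPhi_eq (k : ℕ) (x y : ℝ) :
    P.dyPhi K k x y = (-1) ^ k * P.phiD K k (x - y) := by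
  have hderiv : ∀ k y, HasDerivAt (fun y => (-1) ^ k * P.phiD K k (x - y))
      ((-1) ^ (k + 1) * P.phiD K (k + 1) (x - y)) y := fun k y =>
    (((P.hasDerivAt_phiD K k (x - y)).comp y ((hasDerivAt_id y).const_sub x)).const_mul
      ((-1 : ℝ) ^ k)).congr_deriv (by rw [pow_succ]; ring)
  simpa only [pow_zero, one_mul, dyPhi, phi_eq]
    using congrFun (iteratedDeriv_eq_of_hasDerivAt hderiv k) y

lemma Plant.iteratedDeriv_psi_diag (k : ℕ) (x : ℝ) :
    iteratedDeriv k (fun x' => P.psi K x' x) x = P.psiD K k 0 := by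
  have hderiv : ∀ k y, HasDerivAt (fun y => P.psiD K k (y - x)) (P.psiD K (k + 1) (y - x)) y :=
    fun k y => (P.hasDerivAt_psiD K k (y - x)).comp_sub_const y x
  simpa only [psi_eq, sub_self] using congrFun (iteratedDeriv_eq_of_hasDerivAt hderiv k) x

lemma Plant.chi_eq (k j : ℕ) :
    chi (P.psi K) k j = fun _ => if j < k then P.psiD K j 0 else 0 := by
  induction k generalizing j with
  | zero => simp [chi]
  | succ k ih =>
    funext x
    simp only [chi, iteratedDeriv_psi_diag, ih, deriv_const]
    grind

end Plant

/-! ### Parametric integrals and Volterra convolutions -/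

lemma continuous_uncurry_left {F : ℝ → ℝ → ℝ} (hF : Continuous (Function.uncurry F)) (x : ℝ) :
    Continuous (F x) :=
  hF.comp (continuous_const.prodMk continuous_id)

lemma continuous_uncurry_right {F : ℝ → ℝ → ℝ} (hF : Continuous (Function.uncurry F)) (t : ℝ) :
    Continuous fun x => F x t :=
  hF.comp (continuous_id.prodMk continuous_const)

lemma continuous_uncurry_swap {F : ℝ → ℝ → ℝ} (hF : Continuous (Function.uncurry F)) :
    Continuous (Function.uncurry fun t x => F x t) :=
  hF.comp (continuous_snd.prodMk continuous_fst)

lemma integrableOn_uncurry_of_continuous {F : ℝ → ℝ → ℝ} (hF : Continuous (Function.uncurry F))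
    (a b c d : ℝ) : IntegrableOn (Function.uncurry F) (uIoc a b ×ˢ uIoc c d) :=
  (hF.continuousOn.integrableOn_compact (isCompact_uIcc.prod isCompact_uIcc)).mono_set
    (prod_mono uIoc_subset_uIcc uIoc_subset_uIcc)

lemma intervalIntegral_swap_of_continuous {F : ℝ → ℝ → ℝ} (hF : Continuous (Function.uncurry F))
    (a b c d : ℝ) :
    ∫ x in a..b, ∫ y in c..d, F x y = ∫ y in c..d, ∫ x in a..b, F x y :=
  intervalIntegral_intervalIntegral_swap (integrableOn_uncurry_of_continuous hF a b c d)

lemma intervalIntegral_indicator_ge {f : ℝ → ℝ} {a b y : ℝ} (hy : y ∈ Icc a b) :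
    ∫ r in a..b, (Ici y).indicator f r = ∫ r in y..b, f r := by
  have hinter : Icc a b ∩ Ici y = Icc y b := by
    ext r
    exact ⟨fun h => ⟨h.2, h.1.2⟩, fun h => ⟨⟨hy.1.trans h.1, h.2⟩, h.1⟩⟩
  rw [intervalIntegral.integral_of_le (hy.1.trans hy.2), intervalIntegral.integral_of_le hy.2,
    ← integral_Icc_eq_integral_Ioc, ← integral_Icc_eq_integral_Ioc,
    setIntegral_indicator measurableSet_Ici, hinter]

lemma intervalIntegral_triangle {F : ℝ → ℝ → ℝ} (hF : Continuous (Function.uncurry F)) {a b : ℝ}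
    (hab : a ≤ b) :
    ∫ y in a..b, ∫ r in y..b, F y r = ∫ r in a..b, ∫ y in a..r, F y r := by
  have hintegrable : IntegrableOn ({p : ℝ × ℝ | p.1 ≤ p.2}.indicator (Function.uncurry F))
      (uIoc a b ×ˢ uIoc a b) :=
    (integrableOn_uncurry_of_continuous hF a b a b).indicator
      (measurableSet_le measurable_fst measurable_snd)
  have hswap := intervalIntegral_intervalIntegral_swap (F := fun y r =>
    {p : ℝ × ℝ | p.1 ≤ p.2}.indicator (Function.uncurry F) (y, r)) hintegrable
  have houter : ∫ y in a..b, ∫ r in y..b, F y r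
      = ∫ y in a..b, ∫ r in a..b, {r | y ≤ r}.indicator (F y) r :=
    intervalIntegral.integral_congr fun y hy =>
      (intervalIntegral_indicator_ge (uIcc_of_le hab ▸ hy)).symm
  have hinner : ∫ r in a..b, ∫ y in a..r, F y r
      = ∫ r in a..b, ∫ y in a..b, {y | y ≤ r}.indicator (fun y => F y r) y :=
    intervalIntegral.integral_congr fun r hr =>
      (intervalIntegral.integral_indicator (uIcc_of_le hab ▸ hr)).symm
  rw [houter, hinner]
  exact hswap

lemma hasDerivWithinAt_integral_right {f : ℝ → ℝ} (hf : Continuous f) (a x : ℝ) (s : Set ℝ) :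
    HasDerivWithinAt (fun x => ∫ y in a..x, f y) (f x) s x :=
  (hf.integral_hasStrictDerivAt a x).hasDerivAt.hasDerivWithinAt

lemma integral_eq_sub_of_hasDerivWithinAt {f f' : ℝ → ℝ} (hf' : Continuous f') {s : Set ℝ}
    (hs : s.OrdConnected) (hf : ∀ x ∈ s, HasDerivWithinAt f (f' x) s x) {a b : ℝ} (ha : a ∈ s)
    (hb : b ∈ s) : ∫ y in a..b, f' y = f b - f a := by
  have hsub : uIcc a b ⊆ s := hs.uIcc_subset ha hb
  refine intervalIntegral.integral_eq_sub_of_hasDeriv_right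
    (fun x hx => (hf x (hsub hx)).continuousWithinAt.mono hsub) (fun x hx => ?_)
    (hf'.intervalIntegrable _ _)
  have hxs : s ∈ 𝓝 x := mem_of_superset (Icc_mem_nhds hx.1 hx.2) hsub
  exact ((hf x (mem_of_mem_nhds hxs)).hasDerivAt hxs).hasDerivWithinAt

lemma hasDerivWithinAt_intervalIntegral {F F' : ℝ → ℝ → ℝ} {a b : ℝ} {s : Set ℝ}
    (hs : s.OrdConnected) (hF : ∀ t, Continuous fun y => F y t)
    (hF' : Continuous (Function.uncurry F'))
    (hderiv : ∀ y ∈ uIcc a b, ∀ t ∈ s, HasDerivWithinAt (F y) (F' y t) s t) {t : ℝ} (ht : t ∈ s) :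
    HasDerivWithinAt (fun t => ∫ y in a..b, F y t) (∫ y in a..b, F' y t) s t := by
  have hcont : Continuous fun τ => ∫ y in a..b, F' y τ :=
    intervalIntegral.continuous_parametric_intervalIntegral_of_continuous
      (continuous_uncurry_swap hF') continuous_const
  have hprimitive : ∀ r ∈ s, ∫ y in a..b, F y r
      = (∫ y in a..b, F y t) + ∫ τ in t..r, ∫ y in a..b, F' y τ := by
    intro r hr
    have hinner : ∫ y in a..b, ∫ τ in t..r, F' y τ = ∫ y in a..b, (F y r - F y t) :=
      intervalIntegral.integral_congr fun y hy => integral_eq_sub_of_hasDerivWithinAt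
        (continuous_uncurry_left hF' y) hs (hderiv y hy) ht hr
    rw [← intervalIntegral_swap_of_continuous hF', hinner, intervalIntegral.integral_sub
      ((hF r).intervalIntegrable _ _) ((hF t).intervalIntegrable _ _)]
    ring
  exact ((hasDerivWithinAt_integral_right hcont t t s).const_add _).congr hprimitive
    (hprimitive t ht)

/-- The Volterra convolution `x ↦ ∫₀ˣ k(x - y) f(y) dy`. -/
def conv (k f : ℝ → ℝ) (x : ℝ) : ℝ := ∫ y in (0 : ℝ)..x, k (x - y) * f y

lemma conv_apply_zero (k f : ℝ → ℝ) : conv k f 0 = 0 := by simp [conv]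

lemma conv_congr_right {k f g : ℝ → ℝ} {x : ℝ} (hx : 0 ≤ x) (h : ∀ y ∈ Icc 0 x, f y = g y) :
    conv k f x = conv k g x := by
  refine intervalIntegral.integral_congr fun y hy => ?_
  rw [uIcc_of_le hx] at hy
  simp only [h y hy]

lemma conv_add {k f g : ℝ → ℝ} (hk : Continuous k) (hf : Continuous f) (hg : Continuous g)
    (x : ℝ) : conv k (fun y => f y + g y) x = conv k f x + conv k g x := by
  simp only [conv, mul_add]
  exact intervalIntegral.integral_add (Continuous.intervalIntegrable (by fun_prop) _ _)
    (Continuous.intervalIntegrable (by fun_prop) _ _)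

lemma conv_sub {k f g : ℝ → ℝ} (hk : Continuous k) (hf : Continuous f) (hg : Continuous g)
    (x : ℝ) : conv k (fun y => f y - g y) x = conv k f x - conv k g x := by
  simp only [conv, mul_sub]
  exact intervalIntegral.integral_sub (Continuous.intervalIntegrable (by fun_prop) _ _)
    (Continuous.intervalIntegrable (by fun_prop) _ _)

lemma conv_const_mul (k f : ℝ → ℝ) (c x : ℝ) :
    conv k (fun y => c * f y) x = c * conv k f x := by
  simp only [conv, mul_left_comm _ c, intervalIntegral.integral_const_mul]

lemma conv_mul_const (k f : ℝ → ℝ) (c x : ℝ) :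
    conv k (fun y => f y * c) x = conv k f x * c := by
  simp only [conv, ← mul_assoc, intervalIntegral.integral_mul_const]

lemma abs_conv_le {k f : ℝ → ℝ} {x C N : ℝ} (hx : x ∈ Icc (0 : ℝ) 1)
    (hk : ∀ y ∈ Icc (0 : ℝ) 1, |k y| ≤ C) (hf : ∀ y ∈ Icc (0 : ℝ) 1, |f y| ≤ N) :
    |conv k f x| ≤ C * N := by
  have hC : 0 ≤ C := (abs_nonneg _).trans (hk 0 (by simp))
  have hN : 0 ≤ N := (abs_nonneg _).trans (hf 0 (by simp))
  have hbound : ∀ y ∈ uIoc 0 x, ‖k (x - y) * f y‖ ≤ C * N := by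
    intro y hy
    rw [uIoc_of_le hx.1] at hy
    rw [Real.norm_eq_abs, abs_mul]
    exact mul_le_mul (hk _ ⟨by linarith [hy.2], by linarith [hy.1, hx.2]⟩)
      (hf _ ⟨hy.1.le, hy.2.trans hx.2⟩) (abs_nonneg _) hC
  calc |conv k f x| ≤ C * N * |x - 0| := intervalIntegral.norm_integral_le_of_norm_le_const hbound
    _ ≤ C * N := mul_le_of_le_one_right (by positivity) (by simpa [abs_of_nonneg hx.1] using hx.2)

lemma continuous_uncurry_conv {k : ℝ → ℝ} {f : ℝ → ℝ → ℝ} (hk : Continuous k)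
    (hf : Continuous (Function.uncurry f)) :
    Continuous (Function.uncurry fun x t => conv k (fun y => f y t) x) := by
  refine intervalIntegral.continuous_parametric_intervalIntegral_of_continuous
    (f := fun (z : ℝ × ℝ) y => k (z.1 - y) * f y z.2) ?_ continuous_fst
  have hf' : Continuous fun p : (ℝ × ℝ) × ℝ => f p.2 p.1.2 :=
    hf.comp (continuous_snd.prodMk (continuous_snd.comp continuous_fst))
  exact (hk.comp (by fun_prop)).mul hf'

@[fun_prop]
lemma continuous_conv {k f : ℝ → ℝ} (hk : Continuous k) (hf : Continuous f) :
    Continuous (conv k f) :=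
  continuous_uncurry_right (continuous_uncurry_conv (f := fun y _ => f y) hk
    (hf.comp continuous_fst)) 0

lemma conv_eq_integral {k k' f : ℝ → ℝ} (hk : ∀ x, HasDerivAt k (k' x) x) (hk' : Continuous k')
    (hf : Continuous f) {x : ℝ} (hx : 0 ≤ x) :
    conv k f x = ∫ r in (0 : ℝ)..x, (k 0 * f r + conv k' f r) := by
  have hF : Continuous (Function.uncurry fun y r => k' (r - y) * f y) := by
    unfold Function.uncurry; fun_prop
  have hexpand : ∀ y, k (x - y) * f y = k 0 * f y + ∫ r in y..x, k' (r - y) * f y := by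
    intro y
    have hFTC := integral_eq_sub_of_hasDerivWithinAt (f := fun r => k (r - y) * f y)
      (continuous_uncurry_left hF y) ordConnected_univ
      (fun r _ => (((hk (r - y)).comp_sub_const r y).mul_const (f y)).hasDerivWithinAt)
      (mem_univ y) (mem_univ x)
    rw [hFTC]; simp
  have hcont : Continuous fun y => ∫ r in y..x, k' (r - y) * f y := by
    simp only [intervalIntegral.integral_symm x]
    exact (intervalIntegral.continuous_parametric_intervalIntegral_of_continuous hF
      continuous_id).neg
  simp only [conv, hexpand]
  rw [intervalIntegral.integral_add ((hf.const_mul _).intervalIntegrable _ _)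
      (hcont.intervalIntegrable _ _), intervalIntegral_triangle hF hx]
  exact (intervalIntegral.integral_add ((hf.const_mul _).intervalIntegrable _ _)
    ((continuous_conv hk' hf).intervalIntegrable _ _)).symm

lemma hasDerivWithinAt_conv {k k' f : ℝ → ℝ} (hk : ∀ x, HasDerivAt k (k' x) x)
    (hk' : Continuous k') (hf : Continuous f) {s : Set ℝ} (hs : s ⊆ Ici 0) {x : ℝ} (hx : 0 ≤ x) :
    HasDerivWithinAt (conv k f) (k 0 * f x + conv k' f x) s x :=
  (hasDerivWithinAt_integral_right ((hf.const_mul _).add (continuous_conv hk' hf)) 0 x s).congr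
    (fun _ hr => conv_eq_integral hk hk' hf (hs hr)) (conv_eq_integral hk hk' hf hx)

lemma conv_deriv {k k' f f' : ℝ → ℝ} (hk : ∀ x, HasDerivAt k (k' x) x) (hk' : Continuous k')
    (hf' : Continuous f') (hfc : Continuous f) {b : ℝ}
    (hf : ∀ x ∈ Icc 0 b, HasDerivWithinAt f (f' x) (Icc 0 b) x) {x : ℝ} (hx : x ∈ Icc 0 b) :
    conv k f' x = k 0 * f x - k x * f 0 + conv k' f x := by
  have hkc : Continuous k := continuous_iff_continuousAt.2 fun x => (hk x).continuousAt
  have hproduct : ∀ y ∈ Icc 0 b, HasDerivWithinAt (fun y => k (x - y) * f y)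
      (k (x - y) * f' y - k' (x - y) * f y) (Icc 0 b) y := fun y hy =>
    (((hk (x - y)).comp_const_sub x y).hasDerivWithinAt.mul (hf y hy)).congr_deriv (by ring)
  have hFTC := integral_eq_sub_of_hasDerivWithinAt (by fun_prop) ordConnected_Icc hproduct
    ⟨le_rfl, hx.1.trans hx.2⟩ hx
  rw [intervalIntegral.integral_sub (Continuous.intervalIntegrable (by fun_prop) _ _)
    (Continuous.intervalIntegrable (by fun_prop) _ _)] at hFTC
  simp only [sub_self, sub_zero] at hFTC
  unfold conv
  linarith

lemma conv_assoc {a b f : ℝ → ℝ} (ha : Continuous a) (hb : Continuous b) (hf : Continuous f)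
    {x : ℝ} (hx : 0 ≤ x) : conv a (conv b f) x = conv (conv a b) f x := by
  have hF : Continuous (Function.uncurry fun z y => a (x - y) * (b (y - z) * f z)) := by
    unfold Function.uncurry; fun_prop
  have hshift : ∀ z, ∫ y in z..x, a (x - y) * (b (y - z) * f z) = conv a b (x - z) * f z := by
    intro z
    have hsubst := intervalIntegral.integral_comp_sub_right (a := z) (b := x)
      (fun y => a (x - z - y) * b y * f z) z
    simp only [sub_sub_sub_cancel_right, sub_self, mul_assoc] at hsubst
    rw [hsubst, conv, ← intervalIntegral.integral_mul_const]
    simp only [mul_assoc]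
  calc conv a (conv b f) x
      = ∫ y in (0 : ℝ)..x, ∫ z in (0 : ℝ)..y, a (x - y) * (b (y - z) * f z) := by
        simp only [conv, intervalIntegral.integral_const_mul]
    _ = ∫ z in (0 : ℝ)..x, ∫ y in z..x, a (x - y) * (b (y - z) * f z) :=
        (intervalIntegral_triangle hF hx).symm
    _ = conv (conv a b) f x := by simp only [hshift]; rfl

lemma hasDerivWithinAt_conv_param {k : ℝ → ℝ} {F F' : ℝ → ℝ → ℝ} {x : ℝ} (hx : 0 ≤ x)
    {s : Set ℝ} (hs : s.OrdConnected) (hk : Continuous k) (hF : ∀ t, Continuous fun y => F y t)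
    (hF' : Continuous (Function.uncurry F'))
    (hderiv : ∀ y ∈ Icc 0 x, ∀ t ∈ s, HasDerivWithinAt (F y) (F' y t) s t) {t : ℝ} (ht : t ∈ s) :
    HasDerivWithinAt (fun t => conv k (fun y => F y t) x) (conv k (fun y => F' y t) x) s t :=
  hasDerivWithinAt_intervalIntegral (F' := fun y t => k (x - y) * F' y t) hs
    (fun t => (hk.comp (continuous_const.sub continuous_id)).mul (hF t))
    ((hk.comp (continuous_const.sub continuous_fst)).mul hF')
    (fun y hy t ht => (hderiv y (uIcc_of_le hx ▸ hy) t ht).const_mul _) ht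

/-! ### The heat equation -/

/-- `g 0, …, g N` are the `x`-derivatives of a function on `[0,1] × [0,∞)` that satisfies the heat
equation `g_t = q g_xx` in the integrated form `d/dt ∫₀ˣ g = q (g_x(x) - g_x(0))`. -/
structure HeatJet (q : ℝ) (N : ℕ) (g : ℕ → ℝ → ℝ → ℝ) : Prop where
  cont : ∀ i ≤ N, Continuous (Function.uncurry (g i))
  space : ∀ i < N, ∀ t, 0 ≤ t → ∀ x ∈ Icc (0 : ℝ) 1,
    HasDerivWithinAt (fun x => g i x t) (g (i + 1) x t) (Icc 0 1) x
  flux : ∀ x ∈ Icc (0 : ℝ) 1, ∀ t, 0 ≤ t →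
    HasDerivWithinAt (fun t => ∫ y in (0 : ℝ)..x, g 0 y t) (q * (g 1 x t - g 1 0 t)) (Ici 0) t

namespace HeatJet

variable {q : ℝ} {N : ℕ} {g : ℕ → ℝ → ℝ → ℝ}

lemma neg (hg : HeatJet q N g) : HeatJet q N fun i x t => -g i x t where
  cont i hi := (hg.cont i hi).neg
  space i hi t ht x hx := (hg.space i hi t ht x hx).neg
  flux x hx t ht := by
    simp only [intervalIntegral.integral_neg]
    exact (hg.flux x hx t ht).neg.congr_deriv (by ring)

lemma hasDerivWithinAt_integral_space (hg : HeatJet q N g) {i : ℕ} (hi : i + 1 ≤ N)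
    {t : ℝ} (ht : 0 ≤ t) {x : ℝ} (hx : x ∈ Icc (0 : ℝ) 1) :
    HasDerivWithinAt (fun x => ∫ τ in (0 : ℝ)..t, g i x τ) (∫ τ in (0 : ℝ)..t, g (i + 1) x τ)
      (Icc 0 1) x :=
  hasDerivWithinAt_intervalIntegral (F := fun τ x => g i x τ) (F' := fun τ x => g (i + 1) x τ)
    ordConnected_Icc (fun x => continuous_uncurry_left (hg.cont i (by lia)) x)
    (continuous_uncurry_swap (hg.cont (i + 1) hi))
    (fun τ hτ => hg.space i hi τ (uIcc_of_le ht ▸ hτ).1) hx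

lemma hasDerivWithinAt_integral_one (hg : HeatJet q N g) (hq : 0 < q) (hN : 1 ≤ N)
    {t : ℝ} (ht : 0 ≤ t) {x : ℝ} (hx : x ∈ Icc (0 : ℝ) 1) :
    HasDerivWithinAt (fun x => ∫ τ in (0 : ℝ)..t, g 1 x τ) (q⁻¹ * (g 0 x t - g 0 x 0))
      (Icc 0 1) x := by
  have hflux : ∀ x ∈ Icc (0 : ℝ) 1, ∫ τ in (0 : ℝ)..t, g 1 x τ = (∫ τ in (0 : ℝ)..t, g 1 0 τ)
      + q⁻¹ * ((∫ y in (0 : ℝ)..x, g 0 y t) - ∫ y in (0 : ℝ)..x, g 0 y 0) := by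
    intro x hx
    have hc := continuous_uncurry_left (hg.cont 1 hN)
    rw [← integral_eq_sub_of_hasDerivWithinAt (((hc x).sub (hc 0)).const_mul q) ordConnected_Ici
        (hg.flux x hx) self_mem_Ici ht, intervalIntegral.integral_const_mul,
      Pi.sub_def, intervalIntegral.integral_sub ((hc x).intervalIntegrable _ _)
        ((hc 0).intervalIntegrable _ _)]
    field_simp
    ring
  have hc := fun s => continuous_uncurry_right (hg.cont 0 N.zero_le) s
  exact ((((hasDerivWithinAt_integral_right (hc t) 0 x _).sub
    (hasDerivWithinAt_integral_right (hc 0) 0 x _)).const_mul _).const_add _).congr hflux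
    (hflux x hx)

lemma hasDerivWithinAt_integral (hg : HeatJet q N g) (hq : 0 < q) {i : ℕ} (hi : i + 1 ≤ N)
    {t : ℝ} (ht : 0 ≤ t) {x : ℝ} (hx : x ∈ Icc (0 : ℝ) 1) :
    HasDerivWithinAt (fun x => ∫ τ in (0 : ℝ)..t, g (i + 1) x τ) (q⁻¹ * (g i x t - g i x 0))
      (Icc 0 1) x := by
  induction i generalizing x with
  | zero => exact hg.hasDerivWithinAt_integral_one hq hi ht hx
  | succ i ih =>
    have hintegral : ∀ x ∈ Icc (0 : ℝ) 1,
        ∫ τ in (0 : ℝ)..t, g (i + 2) x τ = q⁻¹ * (g i x t - g i x 0) := fun x hx =>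
      (uniqueDiffOn_Icc zero_lt_one x hx).eq_deriv _
        (hg.hasDerivWithinAt_integral_space hi ht hx) (ih (by lia) hx)
    exact (((hg.space i (by lia) t ht x hx).sub
      (hg.space i (by lia) 0 le_rfl x hx)).const_mul _).congr hintegral (hintegral x hx)

lemma sub_eq_integral (hg : HeatJet q N g) (hq : 0 < q) {i : ℕ} (hi : i + 2 ≤ N)
    {t : ℝ} (ht : 0 ≤ t) {x : ℝ} (hx : x ∈ Icc (0 : ℝ) 1) :
    g i x t - g i x 0 = q * ∫ τ in (0 : ℝ)..t, g (i + 2) x τ := by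
  rw [(uniqueDiffOn_Icc zero_lt_one x hx).eq_deriv _
    (hg.hasDerivWithinAt_integral_space hi ht hx)
    (hg.hasDerivWithinAt_integral hq (by lia) ht hx)]
  field_simp

lemma time (hg : HeatJet q N g) (hq : 0 < q) {i : ℕ} (hi : i + 2 ≤ N)
    {t : ℝ} (ht : 0 ≤ t) {x : ℝ} (hx : x ∈ Icc (0 : ℝ) 1) :
    HasDerivWithinAt (g i x) (q * g (i + 2) x t) (Ici 0) t := by
  have hprimitive : ∀ t ∈ Ici 0, g i x t = g i x 0 + q * ∫ τ in (0 : ℝ)..t, g (i + 2) x τ :=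
    fun t ht => by rw [← hg.sub_eq_integral hq hi ht hx]; ring
  exact (((hasDerivWithinAt_integral_right (continuous_uncurry_left (hg.cont _ hi) x) 0 t
    _).const_mul q).const_add _).congr hprimitive (hprimitive t ht)

end HeatJet

/-! ### A maximum principle -/

lemma deriv_deriv_nonpos_of_isLocalMax {f f' : ℝ → ℝ} {f'' x : ℝ} (hmax : IsLocalMax f x)
    (hf : ∀ᶠ y in 𝓝 x, HasDerivAt f (f' y) y) (hf' : HasDerivAt f' f'' x) : f'' ≤ 0 := by
  by_contra! hpos
  have hderiv : deriv f =ᶠ[𝓝 x] f' := hf.mono fun y hy => hy.deriv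
  have hderiv₂ : deriv (deriv f) x = f'' := hderiv.deriv_eq.trans hf'.deriv
  have hmin := isLocalMin_of_deriv_deriv_pos (hderiv₂ ▸ hpos) hmax.deriv_eq_zero
    hf.self_of_nhds.continuousAt
  have hconst : f =ᶠ[𝓝 x] fun _ => f x := hmax.and hmin |>.mono fun y hy => le_antisymm hy.1 hy.2
  have hzero : deriv f =ᶠ[𝓝 x] fun _ => 0 := by
    filter_upwards [hconst.eventuallyEq_nhds] with y hy
    rw [hy.deriv_eq, deriv_const]
  rw [hzero.deriv_eq, deriv_const] at hderiv₂
  exact hpos.ne hderiv₂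

lemma deriv_nonneg_of_isMaxOn_Icc_right {f : ℝ → ℝ} {f' a b : ℝ} (hab : a < b)
    (hf : HasDerivWithinAt f f' (Icc a b) b) (hmax : IsMaxOn f (Icc a b) b) : 0 ≤ f' := by
  have htangent : a - b ∈ posTangentConeAt (Icc a b) b :=
    sub_mem_posTangentConeAt_of_segment_subset
      ((convex_Icc a b).segment_subset (right_mem_Icc.2 hab.le) (left_mem_Icc.2 hab.le))
  have hslope := hmax.localize.hasFDerivWithinAt_nonpos hf htangent
  simp only [ContinuousLinearMap.toSpanSingleton_apply, smul_eq_mul] at hslope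
  exact nonneg_of_mul_nonpos_right hslope (sub_neg.2 hab)

/-- `f` is continuous on `[a,b] × [0,S]` with derivatives `∂_t f = ft`, `∂ₓ f = fx` and
`∂ₓ² f = fxx`, all of them one-sided at the boundary. -/
structure HasParabolicDerivs (a b S : ℝ) (f ft fx fxx : ℝ → ℝ → ℝ) : Prop where
  cont : ContinuousOn (Function.uncurry f) (Icc a b ×ˢ Icc 0 S)
  time : ∀ x ∈ Icc a b, ∀ t ∈ Icc 0 S, HasDerivWithinAt (f x) (ft x t) (Icc 0 S) t
  space : ∀ x ∈ Icc a b, ∀ t ∈ Icc 0 S, HasDerivWithinAt (fun x => f x t) (fx x t) (Icc a b) x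
  space₂ : ∀ x ∈ Icc a b, ∀ t ∈ Icc 0 S, HasDerivWithinAt (fun x => fx x t) (fxx x t) (Icc a b) x

namespace HasParabolicDerivs

variable {a b q S k : ℝ} {f ft fx fxx : ℝ → ℝ → ℝ}

lemma le_of_strict_subsolution (hf : HasParabolicDerivs a b S f ft fx fxx) (hq : 0 ≤ q)
    (hsub : ∀ x ∈ Icc a b, ∀ t ∈ Icc 0 S, ft x t < q * fxx x t)
    (ha : ∀ t ∈ Icc 0 S, f a t ≤ k) (hb : ∀ t ∈ Icc 0 S, f b t ≤ k)
    (hinit : ∀ x ∈ Icc a b, f x 0 ≤ k) {x t : ℝ} (hx : x ∈ Icc a b) (ht : t ∈ Icc 0 S) :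
    f x t ≤ k := by
  obtain ⟨⟨y, s⟩, ⟨hy, hs⟩, hmax⟩ := (isCompact_Icc.prod isCompact_Icc).exists_isMaxOn
    ⟨(x, t), mk_mem_prod hx ht⟩ hf.cont
  simp only at hy hs
  refine (hmax (mk_mem_prod hx ht)).trans (?_ : f y s ≤ k)
  by_contra! hlt
  have hay : a < y := hy.1.lt_of_ne (by rintro rfl; exact (ha s hs).not_gt hlt)
  have hyb : y < b := hy.2.lt_of_ne (by rintro rfl; exact (hb s hs).not_gt hlt)
  have hs0 : 0 < s := hs.1.lt_of_ne (by rintro rfl; exact (hinit y hy).not_gt hlt)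
  have hspace : fxx y s ≤ 0 := by
    have hnhds : Icc a b ∈ 𝓝 y := Icc_mem_nhds hay hyb
    refine deriv_deriv_nonpos_of_isLocalMax (f := fun x => f x s) (f' := fun x => fx x s)
      (mem_of_superset hnhds fun z hz => hmax (mk_mem_prod hz hs)) ?_
      ((hf.space₂ y hy s hs).hasDerivAt hnhds)
    filter_upwards [Ioo_mem_nhds hay hyb] with z hz
    exact (hf.space z (Ioo_subset_Icc_self hz) s hs).hasDerivAt (Icc_mem_nhds hz.1 hz.2)
  have htime : 0 ≤ ft y s :=
    deriv_nonneg_of_isMaxOn_Icc_right hs0 ((hf.time y hy s hs).mono (Icc_subset_Icc_right hs.2))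
      fun τ hτ => hmax (mk_mem_prod hy ⟨hτ.1, hτ.2.trans hs.2⟩)
  exact (hsub y hy s hs).not_ge ((mul_nonpos_of_nonneg_of_nonpos hq hspace).trans htime)

lemma sub_const_mul_time (hf : HasParabolicDerivs a b S f ft fx fxx) (δ : ℝ) :
    HasParabolicDerivs a b S (fun x t => f x t - δ * t) (fun x t => ft x t - δ) fx fxx where
  cont := hf.cont.sub (by fun_prop)
  time x hx t ht :=
    ((hf.time x hx t ht).sub ((hasDerivWithinAt_id t _).const_mul δ)).congr_deriv (by ring)
  space x hx t ht := (hf.space x hx t ht).sub_const _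
  space₂ := hf.space₂

lemma le_of_subsolution (hf : HasParabolicDerivs a b S f ft fx fxx) (hq : 0 ≤ q)
    (hsub : ∀ x ∈ Icc a b, ∀ t ∈ Icc 0 S, ft x t ≤ q * fxx x t)
    (ha : ∀ t ∈ Icc 0 S, f a t ≤ k) (hb : ∀ t ∈ Icc 0 S, f b t ≤ k)
    (hinit : ∀ x ∈ Icc a b, f x 0 ≤ k) {x t : ℝ} (hx : x ∈ Icc a b) (ht : t ∈ Icc 0 S) :
    f x t ≤ k := by
  have hlim : Tendsto (fun δ : ℝ => k + δ * t) (𝓝[>] 0) (𝓝 k) :=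
    tendsto_nhdsWithin_of_tendsto_nhds (Continuous.tendsto' (by fun_prop) _ _ (by ring))
  refine ge_of_tendsto hlim ?_
  filter_upwards [self_mem_nhdsWithin] with δ (hδ : 0 < δ)
  have hle : ∀ y, ∀ s ∈ Icc 0 S, f y s ≤ k → f y s - δ * s ≤ k := fun y s hs h => by
    nlinarith [hs.1]
  refine sub_le_iff_le_add.1 ((hf.sub_const_mul_time δ).le_of_strict_subsolution hq
    (fun y hy s hs => ?_) (fun s hs => hle a s hs (ha s hs)) (fun s hs => hle b s hs (hb s hs))
    (fun y hy => hle y 0 ⟨le_rfl, ht.1.trans ht.2⟩ (hinit y hy)) hx ht)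
  linarith [hsub y hy s hs]

end HasParabolicDerivs

/-- The Steklov average of `r` over the time interval `[t, t + h]`. -/
def steklov (h : ℝ) (r : ℝ → ℝ → ℝ) (x t : ℝ) : ℝ := h⁻¹ * ∫ τ in t..(t + h), r x τ

section Steklov

variable {r : ℝ → ℝ → ℝ}

lemma steklov_eq (hr : Continuous (Function.uncurry r)) (h x t : ℝ) :
    steklov h r x t =
      h⁻¹ * ((∫ τ in (0 : ℝ)..(t + h), r x τ) - ∫ τ in (0 : ℝ)..t, r x τ) := by
  have hrx := continuous_uncurry_left hr x
  rw [steklov, intervalIntegral.integral_interval_sub_left (hrx.intervalIntegrable _ _)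
    (hrx.intervalIntegrable _ _)]

lemma continuous_uncurry_steklov (hr : Continuous (Function.uncurry r)) (h : ℝ) :
    Continuous (Function.uncurry (steklov h r)) := by
  have hr' : Continuous (Function.uncurry fun (z : ℝ × ℝ) τ => r z.1 τ) :=
    hr.comp ((continuous_fst.comp continuous_fst).prodMk continuous_snd)
  have hprimitive : ∀ s : ℝ × ℝ → ℝ, Continuous s →
      Continuous fun z : ℝ × ℝ => ∫ τ in (0 : ℝ)..s z, r z.1 τ := fun s hs =>
    intervalIntegral.continuous_parametric_intervalIntegral_of_continuous hr' hs
  exact (((hprimitive (fun z => z.2 + h) (by fun_prop)).sub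
    (hprimitive Prod.snd continuous_snd)).const_mul h⁻¹).congr
    fun z => (steklov_eq hr h z.1 z.2).symm

lemma steklov_le (hr : Continuous (Function.uncurry r)) {h c x t : ℝ} (hh : 0 < h)
    (hc : ∀ τ ∈ Icc t (t + h), r x τ ≤ c) : steklov h r x t ≤ c := by
  have hmono := intervalIntegral.integral_mono_on (le_add_of_nonneg_right hh.le)
    ((continuous_uncurry_left hr x).intervalIntegrable (μ := volume) _ _)
    (continuous_const.intervalIntegrable _ _) hc
  rw [intervalIntegral.integral_const, add_sub_cancel_left, smul_eq_mul] at hmono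
  rwa [steklov, inv_mul_le_iff₀ hh]

lemma tendsto_steklov (hr : Continuous (Function.uncurry r)) (x t : ℝ) :
    Tendsto (fun h => steklov h r x t) (𝓝[>] 0) (𝓝 (r x t)) := by
  have hderiv : HasDerivAt (fun s => ∫ τ in t..s, r x τ) (r x t) t :=
    (hasDerivWithinAt_integral_right (continuous_uncurry_left hr x) t t univ).hasDerivAt univ_mem
  simpa only [steklov, intervalIntegral.integral_same, sub_zero, smul_eq_mul] using
    hderiv.tendsto_slope_zero_right

lemma hasDerivWithinAt_steklov (hr : Continuous (Function.uncurry r)) (h x t : ℝ) (s : Set ℝ) :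
    HasDerivWithinAt (steklov h r x) (h⁻¹ * (r x (t + h) - r x t)) s t := by
  have hprimitive : ∀ t, HasDerivAt (fun t => ∫ τ in (0 : ℝ)..t, r x τ) (r x t) t := fun t =>
    (hasDerivWithinAt_integral_right (continuous_uncurry_left hr x) 0 t univ).hasDerivAt univ_mem
  exact (((hprimitive (t + h)).comp_add_const t h).sub (hprimitive t)).const_mul h⁻¹
    |>.hasDerivWithinAt.congr (fun s _ => steklov_eq hr h x s) (steklov_eq hr h x t)

end Steklov

/-- `r` is a subsolution of the heat equation `r_t = q r_xx` on `[a,b] × [0,T]`, integrated in time: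
`∫₀ᵗ r` has the `x`-derivatives `R₁` and `R₂`, and the increments of `r` in time are bounded by
those of `q R₂`. -/
structure IsWeakSubsolution (q a b T : ℝ) (r R₁ R₂ : ℝ → ℝ → ℝ) : Prop where
  cont : Continuous (Function.uncurry r)
  space : ∀ x ∈ Icc a b, ∀ t ∈ Icc 0 T,
    HasDerivWithinAt (fun x => ∫ τ in (0 : ℝ)..t, r x τ) (R₁ x t) (Icc a b) x
  space₂ : ∀ x ∈ Icc a b, ∀ t ∈ Icc 0 T, HasDerivWithinAt (fun x => R₁ x t) (R₂ x t) (Icc a b) x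
  sub_le : ∀ x ∈ Icc a b, ∀ s t, 0 ≤ s → s ≤ t → t ≤ T → r x t - r x s ≤ q * (R₂ x t - R₂ x s)

namespace IsWeakSubsolution

variable {q a b T : ℝ} {r R₁ R₂ : ℝ → ℝ → ℝ}

lemma hasParabolicDerivs_steklov (hr : IsWeakSubsolution q a b T r R₁ R₂) {h : ℝ} (hh : 0 ≤ h) :
    HasParabolicDerivs a b (T - h) (steklov h r) (fun x t => h⁻¹ * (r x (t + h) - r x t))
      (fun x t => h⁻¹ * (R₁ x (t + h) - R₁ x t)) (fun x t => h⁻¹ * (R₂ x (t + h) - R₂ x t)) := by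
  have hmem : ∀ t ∈ Icc 0 (T - h), t ∈ Icc 0 T ∧ t + h ∈ Icc 0 T := fun t ht =>
    ⟨⟨ht.1, by linarith [ht.2]⟩, by linarith [ht.1], by linarith [ht.2]⟩
  exact
    { cont := (continuous_uncurry_steklov hr.cont h).continuousOn
      time := fun x _ t _ => hasDerivWithinAt_steklov hr.cont h x t _
      space := fun x hx t ht => (((hr.space x hx (t + h) (hmem t ht).2).sub
        (hr.space x hx t (hmem t ht).1)).const_mul h⁻¹).congr
          (fun y _ => steklov_eq hr.cont h y t) (steklov_eq hr.cont h x t)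
      space₂ := fun x hx t ht => ((hr.space₂ x hx (t + h) (hmem t ht).2).sub
        (hr.space₂ x hx t (hmem t ht).1)).const_mul h⁻¹ }

lemma eventually_forall_le (hr : Continuous (Function.uncurry r))
    (hinit : ∀ x ∈ Icc a b, r x 0 ≤ 0) {ε : ℝ} (hε : 0 < ε) :
    ∀ᶠ h in 𝓝[>] (0 : ℝ), ∀ x ∈ Icc a b, ∀ t ∈ Icc 0 h, r x t ≤ ε := by
  have hnhds : ∀ᶠ t in 𝓝 (0 : ℝ), ∀ x ∈ Icc a b, r x t < ε :=
    isCompact_Icc.eventually_forall_of_forall_eventually fun x hx =>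
      (isOpen_lt (continuous_uncurry_swap hr) continuous_const).mem_nhds
        ((hinit x hx).trans_lt hε)
  obtain ⟨u, hu, hsub⟩ := mem_nhdsGE_iff_exists_Icc_subset.1 (mem_nhdsWithin_of_mem_nhds hnhds)
  filter_upwards [Ioc_mem_nhdsGT hu] with h hh x hx t ht
  exact (hsub ⟨ht.1, ht.2.trans hh.2⟩ x hx).le

lemma nonpos_of_lt (hr : IsWeakSubsolution q a b T r R₁ R₂) (hq : 0 ≤ q)
    (ha : ∀ t ∈ Icc 0 T, r a t ≤ 0) (hb : ∀ t ∈ Icc 0 T, r b t ≤ 0)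
    (hinit : ∀ x ∈ Icc a b, r x 0 ≤ 0) {x t : ℝ} (hx : x ∈ Icc a b) (ht : t ∈ Ico 0 T) :
    r x t ≤ 0 := by
  refine le_of_forall_pos_le_add fun ε hε => ?_
  rw [zero_add]
  refine le_of_tendsto (tendsto_steklov hr.cont x t) ?_
  filter_upwards [eventually_forall_le hr.cont hinit hε, Ioc_mem_nhdsGT (sub_pos.2 ht.2)]
    with h hsmall hh
  have hlateral : ∀ y, (∀ t ∈ Icc 0 T, r y t ≤ 0) → ∀ s ∈ Icc 0 (T - h), steklov h r y s ≤ ε :=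
    fun y hy s hs => steklov_le hr.cont hh.1 fun τ hτ =>
      (hy τ ⟨hs.1.trans hτ.1, by linarith [hτ.2, hs.2]⟩).trans hε.le
  refine (hr.hasParabolicDerivs_steklov hh.1.le).le_of_subsolution hq (fun y hy s hs => ?_)
    (hlateral a ha) (hlateral b hb)
    (fun y hy => steklov_le hr.cont hh.1 (by simpa only [zero_add] using hsmall y hy))
    hx ⟨ht.1, by linarith [hh.2]⟩
  rw [mul_left_comm]
  exact mul_le_mul_of_nonneg_left (hr.sub_le y hy s (s + h) hs.1 (by linarith [hh.1])
    (by linarith [hs.2])) (inv_nonneg.2 hh.1.le)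

lemma nonpos (hr : IsWeakSubsolution q a b T r R₁ R₂) (hq : 0 ≤ q)
    (ha : ∀ t ∈ Icc 0 T, r a t ≤ 0) (hb : ∀ t ∈ Icc 0 T, r b t ≤ 0)
    (hinit : ∀ x ∈ Icc a b, r x 0 ≤ 0) {x t : ℝ} (hx : x ∈ Icc a b) (ht : t ∈ Icc 0 T) :
    r x t ≤ 0 := by
  rcases (ht.1.trans ht.2).eq_or_lt with rfl | hT
  · rw [le_antisymm ht.2 ht.1]
    exact hinit x hx
  · have hclosed : IsClosed {t | r x t ≤ 0} :=
      isClosed_le (continuous_uncurry_left hr.cont x) continuous_const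
    have hclosure := hclosed.closure_subset_iff.2 fun t ht => hr.nonpos_of_lt hq ha hb hinit hx ht
    exact hclosure (closure_Ico hT.ne ▸ ht)

end IsWeakSubsolution

lemma hasDerivAt_exp_neg_mul (lam t : ℝ) :
    HasDerivAt (fun t => Real.exp (-lam * t)) (-lam * Real.exp (-lam * t)) t :=
  ((hasDerivAt_const_mul (-lam)).exp).congr_deriv (mul_comm _ _)

lemma exp_neg_mul_le_exp_neg_mul {lam s t : ℝ} (hlam : 0 ≤ lam) (hst : s ≤ t) :
    Real.exp (-lam * t) ≤ Real.exp (-lam * s) :=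
  Real.exp_le_exp.2 (mul_le_mul_of_nonpos_left hst (neg_nonpos.2 hlam))

lemma integral_exp_neg_mul {lam : ℝ} (hlam : lam ≠ 0) (s t : ℝ) :
    ∫ τ in s..t, Real.exp (-lam * τ) = lam⁻¹ * (Real.exp (-lam * s) - Real.exp (-lam * t)) := by
  rw [intervalIntegral.integral_comp_mul_left (fun x => Real.exp x) (neg_ne_zero.2 hlam),
    integral_exp, smul_eq_mul, inv_neg]
  ring

lemma norm_sub_le_of_norm_deriv_le_exp {E : Type*} [NormedAddCommGroup E] [NormedSpace ℝ E]
    {f f' : ℝ → E} {K lam s t : ℝ} (hlam : lam ≠ 0) (hst : s ≤ t)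
    (hf : ∀ τ ∈ Icc s t, HasDerivWithinAt f (f' τ) (Ici s) τ)
    (hf' : ∀ τ ∈ Icc s t, ‖f' τ‖ ≤ K * Real.exp (-lam * τ)) :
    ‖f t - f s‖ ≤ K * lam⁻¹ * (Real.exp (-lam * s) - Real.exp (-lam * t)) := by
  refine image_norm_le_of_norm_deriv_right_le_deriv_boundary (f := fun τ => f τ - f s)
    (B := fun τ => K * lam⁻¹ * (Real.exp (-lam * s) - Real.exp (-lam * τ)))
    (fun τ hτ => ((hf τ hτ).continuousWithinAt.mono Icc_subset_Ici_self).sub_const _)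
    (fun τ hτ => ((hf τ (Ico_subset_Icc_self hτ)).mono (Ici_subset_Ici.2 hτ.1)).sub_const _)
    (by simp) (fun τ => ?_) (fun τ hτ => hf' τ (Ico_subset_Icc_self hτ)) (right_mem_Icc.2 hst)
  refine (((hasDerivAt_exp_neg_mul lam τ).const_sub _).const_mul (K * lam⁻¹)).congr_deriv ?_
  field_simp

lemma abs_deriv_le_of_abs_sub_le {f : ℝ → ℝ} {f' a C : ℝ} (ha : a ∈ Icc (0 : ℝ) 1)
    (hf : HasDerivWithinAt f f' (Icc 0 1) a)
    (h : ∀ x ∈ Icc (0 : ℝ) 1, |f x - f a| ≤ C * |x - a|) : |f'| ≤ C := by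
  have hne : (𝓝[Icc 0 1 \ {a}] a).NeBot :=
    accPt_principal_iff_nhdsWithin.1
      (uniqueDiffWithinAt_iff_accPt.1 (uniqueDiffOn_Icc (zero_lt_one (α := ℝ)) a ha))
  refine le_of_tendsto (hasDerivWithinAt_iff_tendsto_slope.1 hf).abs ?_
  filter_upwards [self_mem_nhdsWithin] with x hx
  rw [slope_def_field, abs_div, div_le_iff₀ (abs_pos.2 (sub_ne_zero.2 hx.2))]
  exact h x hx.1

/-- The comparison function `h(t) + M e^{-λt} (b₀ + b₁ x - x²)`: it is a supersolution of the heat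
equation as long as `h` does not decrease too fast. -/
def barrier (lam M b₀ b₁ : ℝ) (h : ℝ → ℝ) (x t : ℝ) : ℝ :=
  h t + M * Real.exp (-lam * t) * (b₀ + b₁ * x - x ^ 2)

section Barrier

variable {lam M b₀ b₁ : ℝ} {h : ℝ → ℝ}

lemma continuous_uncurry_barrier (hh : Continuous h) :
    Continuous (Function.uncurry (barrier lam M b₀ b₁ h)) := by
  unfold barrier Function.uncurry
  fun_prop

lemma integral_barrier (hh : Continuous h) (x t : ℝ) :
    ∫ τ in (0 : ℝ)..t, barrier lam M b₀ b₁ h x τ = (∫ τ in (0 : ℝ)..t, h τ)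
      + M * (∫ τ in (0 : ℝ)..t, Real.exp (-lam * τ)) * (b₀ + b₁ * x - x ^ 2) := by
  simp only [barrier]
  rw [intervalIntegral.integral_add (hh.intervalIntegrable _ _)
    (Continuous.intervalIntegrable (by fun_prop) _ _), intervalIntegral.integral_mul_const,
    intervalIntegral.integral_const_mul]

lemma hasDerivAt_integral_barrier (hh : Continuous h) (x t : ℝ) :
    HasDerivAt (fun x => ∫ τ in (0 : ℝ)..t, barrier lam M b₀ b₁ h x τ)
      (M * (∫ τ in (0 : ℝ)..t, Real.exp (-lam * τ)) * (b₁ - 2 * x)) x := by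
  have hquadratic : HasDerivAt (fun x : ℝ => b₀ + b₁ * x - x ^ 2) (b₁ - 2 * x) x :=
    (((hasDerivAt_const_mul b₁).const_add b₀).sub (hasDerivAt_pow 2 x)).congr_deriv (by simp)
  simp only [integral_barrier hh]
  exact (hquadratic.const_mul _).const_add _

end Barrier

namespace HeatJet

variable {q lam M T : ℝ} {N i : ℕ} {g : ℕ → ℝ → ℝ → ℝ}

lemma isWeakSubsolution_sub_barrier {b₀ b₁ : ℝ} {h : ℝ → ℝ} (hg : HeatJet q N g) (hq : 0 < q)
    (hlam : 0 < lam) (hM : 0 ≤ M) (hi : i + 1 ≤ N) (hh : Continuous h)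
    (hb : ∀ x ∈ Icc (0 : ℝ) 1, b₀ + b₁ * x - x ^ 2 ≤ 1)
    (hdecrease : ∀ s t, 0 ≤ s → s ≤ t → t ≤ T →
      h s - h t ≤ M * (2 * q * lam⁻¹ - 1) * (Real.exp (-lam * s) - Real.exp (-lam * t))) :
    IsWeakSubsolution q 0 1 T (fun x t => g i x t - barrier lam M b₀ b₁ h x t)
      (fun x t => (∫ τ in (0 : ℝ)..t, g (i + 1) x τ)
        - M * (∫ τ in (0 : ℝ)..t, Real.exp (-lam * τ)) * (b₁ - 2 * x))
      (fun x t => q⁻¹ * (g i x t - g i x 0)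
        + 2 * M * ∫ τ in (0 : ℝ)..t, Real.exp (-lam * τ)) where
  cont := (hg.cont i (by lia)).sub (continuous_uncurry_barrier hh)
  space x hx t ht := by
    have hsplit : ∀ y, ∫ τ in (0 : ℝ)..t, (g i y τ - barrier lam M b₀ b₁ h y τ) =
        (∫ τ in (0 : ℝ)..t, g i y τ) - ∫ τ in (0 : ℝ)..t, barrier lam M b₀ b₁ h y τ := fun y =>
      intervalIntegral.integral_sub
        ((continuous_uncurry_left (hg.cont i (by lia)) y).intervalIntegrable _ _)
        ((continuous_uncurry_left (continuous_uncurry_barrier hh) y).intervalIntegrable _ _)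
    exact ((hg.hasDerivWithinAt_integral_space hi ht.1 hx).sub
      (hasDerivAt_integral_barrier hh x t).hasDerivWithinAt).congr
      (fun y _ => hsplit y) (hsplit x)
  space₂ x hx t ht := by
    have hlinear : HasDerivAt (fun x : ℝ => b₁ - 2 * x) (-2) x :=
      (hasDerivAt_const_mul 2).const_sub b₁
    exact ((hg.hasDerivWithinAt_integral hq hi ht.1 hx).sub
      (hlinear.hasDerivWithinAt.const_mul _)).congr_deriv (by ring)
  sub_le x hx s t hs hst htT := by
    have hexp := exp_neg_mul_le_exp_neg_mul hlam.le hst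
    have hslack : 0 ≤ M * (Real.exp (-lam * s) - Real.exp (-lam * t))
        * (1 - (b₀ + b₁ * x - x ^ 2)) :=
      mul_nonneg (mul_nonneg hM (sub_nonneg.2 hexp)) (sub_nonneg.2 (hb x hx))
    have hincrement : q * (q⁻¹ * (g i x t - g i x 0)
        + 2 * M * (lam⁻¹ * (Real.exp (-lam * 0) - Real.exp (-lam * t)))
        - (q⁻¹ * (g i x s - g i x 0)
          + 2 * M * (lam⁻¹ * (Real.exp (-lam * 0) - Real.exp (-lam * s)))))
        = g i x t - g i x s + M * (2 * q * lam⁻¹) *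
          (Real.exp (-lam * s) - Real.exp (-lam * t)) := by
      field_simp
      ring
    simp only [barrier, integral_exp_neg_mul hlam.ne', hincrement]
    nlinarith [hdecrease s t hs hst htT]

lemma le_barrier {b₀ b₁ : ℝ} {h : ℝ → ℝ} (hg : HeatJet q N g) (hq : 0 < q) (hlam : 0 < lam)
    (hM : 0 ≤ M) (hi : i + 1 ≤ N) (hh : Continuous h)
    (hb : ∀ x ∈ Icc (0 : ℝ) 1, b₀ + b₁ * x - x ^ 2 ≤ 1)
    (hdecrease : ∀ s t, 0 ≤ s → s ≤ t → t ≤ T →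
      h s - h t ≤ M * (2 * q * lam⁻¹ - 1) * (Real.exp (-lam * s) - Real.exp (-lam * t)))
    (h0 : ∀ t ∈ Icc 0 T, g i 0 t ≤ barrier lam M b₀ b₁ h 0 t)
    (h1 : ∀ t ∈ Icc 0 T, g i 1 t ≤ barrier lam M b₀ b₁ h 1 t)
    (hinit : ∀ x ∈ Icc (0 : ℝ) 1, g i x 0 ≤ barrier lam M b₀ b₁ h x 0)
    {x t : ℝ} (hx : x ∈ Icc (0 : ℝ) 1) (ht : t ∈ Icc 0 T) :
    g i x t ≤ barrier lam M b₀ b₁ h x t :=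
  sub_nonpos.1 <| (hg.isWeakSubsolution_sub_barrier hq hlam hM hi hh hb hdecrease).nonpos hq.le
    (fun t ht => sub_nonpos.2 (h0 t ht)) (fun t ht => sub_nonpos.2 (h1 t ht))
    (fun x hx => sub_nonpos.2 (hinit x hx)) hx ht

lemma le_of_boundary (hg : HeatJet q N g) (hq : 0 < q) (hlam : 0 < lam) (hlq : lam ≤ q)
    (hM : 0 ≤ M) (hi : i + 1 ≤ N) (h0 : ∀ t ∈ Icc 0 T, g i 0 t ≤ 0)
    (h1 : ∀ t ∈ Icc 0 T, g i 1 t ≤ M * Real.exp (-lam * t))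
    (hinit : ∀ x ∈ Icc (0 : ℝ) 1, g i x 0 ≤ M * x)
    {x t : ℝ} (hx : x ∈ Icc (0 : ℝ) 1) (ht : t ∈ Icc 0 T) :
    g i x t ≤ M * Real.exp (-lam * t) * (2 * x - x ^ 2) := by
  have hratio : 1 ≤ 2 * q * lam⁻¹ := by
    rw [← div_eq_mul_inv, one_le_div hlam]
    linarith
  have hbarrier := hg.le_barrier (h := fun _ => 0) (b₀ := 0) (b₁ := 2) (T := T) hq hlam hM hi
    continuous_const (fun x _ => by nlinarith [sq_nonneg (x - 1)])
    (fun s t _ hst _ => by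
      rw [sub_self]
      exact mul_nonneg (mul_nonneg hM (sub_nonneg.2 hratio))
        (sub_nonneg.2 (exp_neg_mul_le_exp_neg_mul hlam.le hst)))
    (fun t ht => by simpa [barrier] using h0 t ht)
    (fun t ht => (h1 t ht).trans_eq (by rw [barrier]; ring))
    (fun x hx => (hinit x hx).trans (by
      simp only [barrier, mul_zero, Real.exp_zero]
      nlinarith [mul_nonneg hM (mul_nonneg hx.1 (sub_nonneg.2 hx.2))])) hx ht
  simpa [barrier] using hbarrier

lemma abs_le_of_boundary (hg : HeatJet q N g) (hq : 0 < q) (hlam : 0 < lam) (hlq : lam ≤ q)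
    (hM : 0 ≤ M) (hi : i + 1 ≤ N) (h0 : ∀ t ∈ Icc 0 T, g i 0 t = 0)
    (h1 : ∀ t ∈ Icc 0 T, |g i 1 t| ≤ M * Real.exp (-lam * t))
    (hinit : ∀ x ∈ Icc (0 : ℝ) 1, |g i x 0| ≤ M * x)
    {x t : ℝ} (hx : x ∈ Icc (0 : ℝ) 1) (ht : t ∈ Icc 0 T) :
    |g i x t| ≤ M * Real.exp (-lam * t) * (2 * x - x ^ 2) :=
  abs_le'.2
    ⟨hg.le_of_boundary hq hlam hlq hM hi (fun t ht => (h0 t ht).le)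
      (fun t ht => (le_abs_self _).trans (h1 t ht))
      (fun x hx => (le_abs_self _).trans (hinit x hx)) hx ht,
    hg.neg.le_of_boundary hq hlam hlq hM hi (fun t ht => (neg_eq_zero.2 (h0 t ht)).le)
      (fun t ht => (neg_le_abs _).trans (h1 t ht))
      (fun x hx => (neg_le_abs _).trans (hinit x hx)) hx ht⟩

lemma abs_deriv_zero_le (hg : HeatJet q N g) (hq : 0 < q) (hlam : 0 < lam) (hlq : lam ≤ q)
    (hM : 0 ≤ M) (hi : i + 1 ≤ N) (h0 : ∀ t ∈ Icc 0 T, g i 0 t = 0)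
    (h1 : ∀ t ∈ Icc 0 T, |g i 1 t| ≤ M * Real.exp (-lam * t))
    (hinit : ∀ x ∈ Icc (0 : ℝ) 1, |g i x 0| ≤ M * x) {t : ℝ} (ht : t ∈ Icc 0 T) :
    |g (i + 1) 0 t| ≤ 2 * M * Real.exp (-lam * t) := by
  refine abs_deriv_le_of_abs_sub_le (by simp) (hg.space i hi t ht.1 0 (by simp)) fun x hx => ?_
  rw [h0 t ht, sub_zero, sub_zero, abs_of_nonneg hx.1]
  refine (hg.abs_le_of_boundary hq hlam hlq hM hi h0 h1 hinit hx ht).trans ?_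
  have hexp : 0 ≤ M * Real.exp (-lam * t) := by positivity
  nlinarith [mul_nonneg hexp (sq_nonneg x)]

lemma le_right_add (hg : HeatJet q N g) (hq : 0 < q) (hlam : 0 < lam) (hM : 0 ≤ M)
    (hi : i + 1 ≤ N) (h0 : ∀ t ∈ Icc 0 T, g i 0 t ≤ g i 1 t + M * Real.exp (-lam * t))
    (hdecrease : ∀ s t, 0 ≤ s → s ≤ t → t ≤ T → g i 1 s - g i 1 t
      ≤ M * (2 * q * lam⁻¹ - 1) * (Real.exp (-lam * s) - Real.exp (-lam * t)))
    (hinit : ∀ x ∈ Icc (0 : ℝ) 1, g i x 0 ≤ g i 1 0 + M * (1 - x))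
    {x t : ℝ} (hx : x ∈ Icc (0 : ℝ) 1) (ht : t ∈ Icc 0 T) :
    g i x t ≤ g i 1 t + M * Real.exp (-lam * t) * (1 - x ^ 2) := by
  have hbarrier := hg.le_barrier (h := g i 1) (b₀ := 1) (b₁ := 0) (T := T) hq hlam hM hi
    (continuous_uncurry_left (hg.cont i (by lia)) 1) (fun x _ => by nlinarith [sq_nonneg x])
    hdecrease (fun t ht => by simpa [barrier] using h0 t ht) (fun t _ => by simp [barrier])
    (fun x hx => (hinit x hx).trans (by
      simp only [barrier, mul_zero, Real.exp_zero]
      nlinarith [mul_nonneg hM (mul_nonneg hx.1 (sub_nonneg.2 hx.2))])) hx ht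
  simpa [barrier] using hbarrier

lemma abs_sub_right_le (hg : HeatJet q N g) (hq : 0 < q) (hlam : 0 < lam) (hM : 0 ≤ M)
    (hi : i + 1 ≤ N) (h0 : ∀ t ∈ Icc 0 T, g i 0 t = 0)
    (h1 : ∀ t ∈ Icc 0 T, |g i 1 t| ≤ M * Real.exp (-lam * t))
    (hincrement : ∀ s t, 0 ≤ s → s ≤ t → t ≤ T → |g i 1 t - g i 1 s|
      ≤ M * (2 * q * lam⁻¹ - 1) * (Real.exp (-lam * s) - Real.exp (-lam * t)))
    (hinit : ∀ x ∈ Icc (0 : ℝ) 1, |g i x 0 - g i 1 0| ≤ M * (1 - x))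
    {x t : ℝ} (hx : x ∈ Icc (0 : ℝ) 1) (ht : t ∈ Icc 0 T) :
    |g i x t - g i 1 t| ≤ M * Real.exp (-lam * t) * (1 - x ^ 2) := by
  have hupper := hg.le_right_add hq hlam hM hi
    (fun t ht => by linarith [h0 t ht, (abs_le.1 (h1 t ht)).1])
    (fun s t hs hst htT => by linarith [(abs_le.1 (hincrement s t hs hst htT)).1])
    (fun x hx => by linarith [(abs_le.1 (hinit x hx)).2]) hx ht
  have hlower := hg.neg.le_right_add hq hlam hM hi
    (fun t ht => by linarith [h0 t ht, (abs_le.1 (h1 t ht)).2])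
    (fun s t hs hst htT => by linarith [(abs_le.1 (hincrement s t hs hst htT)).2])
    (fun x hx => by linarith [(abs_le.1 (hinit x hx)).1]) hx ht
  exact abs_le.2 ⟨by linarith, by linarith⟩

lemma abs_deriv_one_le (hg : HeatJet q N g) (hq : 0 < q) (hlam : 0 < lam) (hlq : lam ≤ q)
    (hM : 0 ≤ M) (hi : i + 1 ≤ N) (h0 : ∀ t ∈ Icc 0 T, g i 0 t = 0)
    (h1 : ∀ t ∈ Icc 0 T, |g i 1 t| ≤ M * Real.exp (-lam * t))
    {η : ℝ → ℝ} (hη : ∀ t, 0 ≤ t → HasDerivWithinAt (g i 1) (η t) (Ici 0) t)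
    (hη_le : ∀ t ∈ Icc 0 T, |η t| ≤ q * M * Real.exp (-lam * t))
    (hinit : ∀ x ∈ Icc (0 : ℝ) 1, |g i x 0 - g i 1 0| ≤ M * (1 - x)) {t : ℝ} (ht : t ∈ Icc 0 T) :
    |g (i + 1) 1 t| ≤ 2 * M * Real.exp (-lam * t) := by
  have hratio : 1 ≤ q * lam⁻¹ := by rwa [← div_eq_mul_inv, one_le_div hlam]
  have hincrement : ∀ s t, 0 ≤ s → s ≤ t → t ≤ T → |g i 1 t - g i 1 s|
      ≤ M * (2 * q * lam⁻¹ - 1) * (Real.exp (-lam * s) - Real.exp (-lam * t)) := by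
    intro s t hs hst htT
    refine (norm_sub_le_of_norm_deriv_le_exp hlam.ne' hst
      (fun τ hτ => (hη τ (hs.trans hτ.1)).mono (Ici_subset_Ici.2 hs))
      (fun τ hτ => hη_le τ ⟨hs.trans hτ.1, hτ.2.trans htT⟩)).trans ?_
    refine mul_le_mul_of_nonneg_right ?_ (sub_nonneg.2 (exp_neg_mul_le_exp_neg_mul hlam.le hst))
    nlinarith
  refine abs_deriv_le_of_abs_sub_le (by simp) (hg.space i hi t ht.1 1 (by simp)) fun x hx => ?_
  refine (hg.abs_sub_right_le hq hlam hM hi h0 h1 hincrement hinit hx ht).trans ?_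
  have hexp : 0 ≤ M * Real.exp (-lam * t) := by positivity
  rw [abs_of_nonpos (sub_nonpos.2 hx.2)]
  nlinarith [mul_nonneg hexp (mul_self_nonneg (1 - x))]

end HeatJet

/-! ### Exponential estimates for ordinary differential equations -/

lemma le_of_deriv_le_neg_mul_add_exp {V V' : ℝ → ℝ} {a lam b T : ℝ} (ha : lam < a) (hb : 0 ≤ b)
    (hV : ∀ t, 0 ≤ t → HasDerivWithinAt V (V' t) (Ici 0) t) (hV0 : 0 ≤ V 0)
    (hV' : ∀ t ∈ Icc 0 T, V' t ≤ -a * V t + b * Real.exp (-lam * t)) {t : ℝ} (ht : t ∈ Icc 0 T) :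
    V t ≤ (V 0 + b / (a - lam)) * Real.exp (-lam * t) := by
  have hweighted : ∀ τ, 0 ≤ τ → HasDerivWithinAt (fun τ => Real.exp (lam * τ) * V τ)
      (Real.exp (lam * τ) * (lam * V τ + V' τ)) (Ici 0) τ := fun τ hτ =>
    ((hasDerivAt_const_mul lam).exp.hasDerivWithinAt.mul (hV τ hτ)).congr_deriv (by ring)
  have hgronwall := le_gronwallBound_of_liminf_deriv_right_le (K := -(a - lam)) (ε := b) (b := T)
    (fun τ hτ => (hweighted τ hτ.1).continuousWithinAt.mono Icc_subset_Ici_self)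
    (fun τ hτ r hr =>
      ((hweighted τ hτ.1).mono (Ici_subset_Ici.2 hτ.1)).liminf_right_slope_le hr)
    le_rfl (fun τ hτ => by
      calc Real.exp (lam * τ) * (lam * V τ + V' τ)
          ≤ Real.exp (lam * τ) * (lam * V τ + (-a * V τ + b * Real.exp (-lam * τ))) := by
            gcongr
            exact hV' τ (Ico_subset_Icc_self hτ)
        _ = -(a - lam) * (Real.exp (lam * τ) * V τ)
            + b * (Real.exp (lam * τ) * Real.exp (-lam * τ)) := by ring
        _ = _ := by rw [← Real.exp_add]; simp) t ht
  have hrate : 0 < a - lam := sub_pos.2 ha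
  have hdecay : Real.exp (-(a - lam) * t) ≤ 1 :=
    Real.exp_le_one_iff.2 (mul_nonpos_of_nonpos_of_nonneg (by linarith) ht.1)
  have hbound : Real.exp (lam * t) * V t ≤ V 0 + b / (a - lam) := by
    refine hgronwall.trans ?_
    rw [gronwallBound_of_K_ne_0 (neg_ne_zero.2 hrate.ne'), sub_zero, mul_zero, Real.exp_zero,
      one_mul, div_neg]
    nlinarith [mul_nonneg (div_nonneg hb hrate.le) (Real.exp_pos (-(a - lam) * t)).le]
  rw [neg_mul, Real.exp_neg, ← div_eq_mul_inv, le_div_iff₀ (Real.exp_pos _), mul_comm]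
  exact hbound

lemma hasDerivAt_cexp_neg_mul (z : ℂ) (t : ℝ) :
    HasDerivAt (fun t : ℝ => Complex.exp (-z * t)) (Complex.exp (-z * t) * -z) t := by
  simpa using (Complex.ofRealCLM.hasDerivAt.const_mul (-z)).cexp

lemma norm_cexp_neg_mul (z : ℂ) (t : ℝ) :
    ‖Complex.exp (-z * t)‖ = Real.exp (-z.re * t) := by
  simp [Complex.norm_exp]

lemma nonneg_of_norm_le_mul_exp {E : Type*} [SeminormedAddGroup E] {lam N T : ℝ} {g : ℝ → E}
    (hg : ∀ t ∈ Icc 0 T, ‖g t‖ ≤ N * Real.exp (-lam * t)) (hT : 0 ≤ T) : 0 ≤ N :=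
  (norm_nonneg _).trans (by simpa using hg 0 ⟨le_rfl, hT⟩)

section InputToState

variable {E : Type*} [NormedAddCommGroup E] [NormedSpace ℂ E] {lam mu N T : ℝ}

lemma norm_cexp_neg_mul_smul_le {z : ℂ} (hz : z.re < -lam) {f g : ℝ → E}
    (hf : ∀ t, 0 ≤ t → HasDerivWithinAt f (z • f t + g t) (Ici 0) t)
    (hg : ∀ t ∈ Icc 0 T, ‖g t‖ ≤ N * Real.exp (-lam * t)) {t : ℝ} (ht : t ∈ Icc 0 T) :
    ‖Complex.exp (-z * t) • f t‖
      ≤ ‖f 0‖ + N * (-z.re - lam)⁻¹ * Real.exp ((-z.re - lam) * t) := by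
  have hN : 0 ≤ N := nonneg_of_norm_le_mul_exp hg (ht.1.trans ht.2)
  have hgap : 0 < -z.re - lam := by linarith
  set F : ℝ → E := fun τ => Complex.exp (-z * τ) • f τ with hF
  have hF' : ∀ τ ∈ Icc 0 t,
      HasDerivWithinAt F (Complex.exp (-z * τ) • g τ) (Ici 0) τ := fun τ hτ =>
    ((hasDerivAt_cexp_neg_mul z τ).hasDerivWithinAt.smul (hf τ hτ.1)).congr_deriv (by module)
  have hF'_le : ∀ τ ∈ Icc 0 t,
      ‖Complex.exp (-z * τ) • g τ‖ ≤ N * Real.exp (-(-(-z.re - lam)) * τ) := fun τ hτ => by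
    calc ‖Complex.exp (-z * τ) • g τ‖ = Real.exp (-z.re * τ) * ‖g τ‖ := by
          rw [norm_smul, norm_cexp_neg_mul]
      _ ≤ Real.exp (-z.re * τ) * (N * Real.exp (-lam * τ)) := by
          gcongr
          exact hg τ ⟨hτ.1, hτ.2.trans ht.2⟩
      _ = N * Real.exp (-(-(-z.re - lam)) * τ) := by
          rw [mul_left_comm, ← Real.exp_add]
          congr 2
          ring
  have hsub := norm_sub_le_of_norm_deriv_le_exp (neg_ne_zero.2 hgap.ne') ht.1 hF' hF'_le
  have hF0 : ‖F 0‖ = ‖f 0‖ := by simp [hF]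
  have hpos : 0 ≤ N * (-z.re - lam)⁻¹ := mul_nonneg hN (inv_nonneg.2 hgap.le)
  rw [neg_neg, mul_zero, Real.exp_zero, inv_neg] at hsub
  linarith [norm_sub_norm_le (F t) (F 0)]

lemma norm_le_of_hasDerivWithinAt_smul_add {z : ℂ} (hz : z.re ≤ -mu) (hlam : lam < mu)
    {f g : ℝ → E} (hf : ∀ t, 0 ≤ t → HasDerivWithinAt f (z • f t + g t) (Ici 0) t)
    (hg : ∀ t ∈ Icc 0 T, ‖g t‖ ≤ N * Real.exp (-lam * t)) {t : ℝ} (ht : t ∈ Icc 0 T) :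
    ‖f t‖ ≤ (‖f 0‖ + (mu - lam)⁻¹ * N) * Real.exp (-lam * t) := by
  have hN : 0 ≤ N := nonneg_of_norm_le_mul_exp hg (ht.1.trans ht.2)
  have hinv : (-z.re - lam)⁻¹ ≤ (mu - lam)⁻¹ := inv_anti₀ (sub_pos.2 hlam) (by linarith)
  have hsplit : Real.exp ((-z.re - lam) * t) * Real.exp (z.re * t) = Real.exp (-lam * t) := by
    rw [← Real.exp_add]
    congr 1
    ring
  have hle : Real.exp (z.re * t) ≤ Real.exp (-lam * t) :=
    Real.exp_le_exp.2 (mul_le_mul_of_nonneg_right (by linarith) ht.1)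
  calc ‖f t‖ = ‖Complex.exp (-z * t) • f t‖ * Real.exp (z.re * t) := by
        rw [norm_smul, norm_cexp_neg_mul, mul_right_comm, ← Real.exp_add]
        simp
    _ ≤ (‖f 0‖ + N * (-z.re - lam)⁻¹ * Real.exp ((-z.re - lam) * t))
          * Real.exp (z.re * t) := by
        gcongr
        exact norm_cexp_neg_mul_smul_le (by linarith) hf hg ht
    _ = ‖f 0‖ * Real.exp (z.re * t) + (-z.re - lam)⁻¹ * N * Real.exp (-lam * t) := by
        rw [← hsplit]
        ring
    _ ≤ ‖f 0‖ * Real.exp (-lam * t) + (mu - lam)⁻¹ * N * Real.exp (-lam * t) := by gcongr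
    _ = _ := by ring

lemma commute_sub_algebraMap_prod {R A : Type*} [CommRing R] [Ring A] [Algebra R A] (M : A) (z : R)
    (l : List R) :
    Commute (M - algebraMap R A z) (l.map fun z => M - algebraMap R A z).prod := by
  refine Commute.list_prod_right _ _ fun B hB => ?_
  obtain ⟨w, -, rfl⟩ := List.mem_map.1 hB
  exact ((Commute.refl M).sub_right (Algebra.commutes w M).symm).sub_left
    (Algebra.commutes z _)

/-- `f' = M f + g` with `|g| ≤ N e^{-λt}` on `[0,T]` forces `|f| ≤ C (|f(0)| + N) e^{-λt}` on
`[0,T]`, for every trajectory with values in the kernel of `p`. -/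
def IsExpStableOn (M p : E →L[ℂ] E) (lam C : ℝ) : Prop :=
  ∀ (f g : ℝ → E) (N T : ℝ),
    (∀ t, 0 ≤ t → HasDerivWithinAt f (M (f t) + g t) (Ici 0) t) →
    (∀ t, 0 ≤ t → p (f t) = 0) →
    (∀ t ∈ Icc 0 T, ‖g t‖ ≤ N * Real.exp (-lam * t)) →
    ∀ t ∈ Icc 0 T, ‖f t‖ ≤ C * (‖f 0‖ + N) * Real.exp (-lam * t)

lemma hasDerivWithinAt_sub_algebraMap_apply {M : E →L[ℂ] E} {f g : ℝ → E} {t : ℝ} {s : Set ℝ}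
    (z : ℂ) (hf : HasDerivWithinAt f (M (f t) + g t) s t) :
    HasDerivWithinAt (fun t => (M - algebraMap ℂ (E →L[ℂ] E) z) (f t))
      (M ((M - algebraMap ℂ (E →L[ℂ] E) z) (f t))
        + (M - algebraMap ℂ (E →L[ℂ] E) z) (g t)) s t := by
  refine (((M - algebraMap ℂ (E →L[ℂ] E) z).restrictScalars
    ℝ).hasFDerivAt.comp_hasDerivWithinAt t hf).congr_deriv ?_
  simp [Algebra.algebraMap_eq_smul_one]
  abel

-- The trajectory `(M - z) f` is annihilated by `p`, and `f' = z f + ((M - z) f + g)`.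
lemma IsExpStableOn.sub_algebraMap_mul {M p : E →L[ℂ] E} {C : ℝ} {z : ℂ} (hC : 0 ≤ C)
    (h : IsExpStableOn M p lam C) (hp : Commute (M - algebraMap ℂ (E →L[ℂ] E) z) p)
    (hz : z.re ≤ -mu) (hlam : lam < mu) :
    IsExpStableOn M ((M - algebraMap ℂ (E →L[ℂ] E) z) * p) lam
      (1 + (mu - lam)⁻¹ * (C * ‖M - algebraMap ℂ (E →L[ℂ] E) z‖ + 1)) := by
  intro f g N T hf hpf hg t ht
  set A := M - algebraMap ℂ (E →L[ℂ] E) z with hA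
  have hN : 0 ≤ N := nonneg_of_norm_le_mul_exp hg (ht.1.trans ht.2)
  have hAf : ∀ t ∈ Icc 0 T, ‖A (f t)‖ ≤ C * (‖A (f 0)‖ + ‖A‖ * N) * Real.exp (-lam * t) :=
    h (fun t => A (f t)) (fun t => A (g t)) (‖A‖ * N) T
      (fun t ht => hasDerivWithinAt_sub_algebraMap_apply z (hf t ht))
      (fun t ht => by simpa [hp.eq] using hpf t ht)
      (fun t ht => (A.le_opNorm_of_le (hg t ht)).trans_eq (mul_assoc _ _ _).symm)
  have hinput : ∀ t ∈ Icc 0 T, ‖A (f t) + g t‖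
      ≤ (C * ‖A‖ * (‖f 0‖ + N) + N) * Real.exp (-lam * t) := fun t ht => by
    calc ‖A (f t) + g t‖
        ≤ C * (‖A‖ * ‖f 0‖ + ‖A‖ * N) * Real.exp (-lam * t) + N * Real.exp (-lam * t) := by
          refine (norm_add_le _ _).trans (add_le_add ((hAf t ht).trans ?_) (hg t ht))
          gcongr
          exact A.le_opNorm _
      _ = _ := by ring
  refine (norm_le_of_hasDerivWithinAt_smul_add hz hlam
    (fun t ht => (hf t ht).congr_deriv ?_) hinput ht).trans ?_
  · simp only [hA, sub_apply, ContinuousLinearMap.algebraMap_apply]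
    abel
  · have hgap : 0 ≤ (mu - lam)⁻¹ := inv_nonneg.2 (by linarith)
    gcongr
    nlinarith [mul_nonneg hgap (norm_nonneg (f 0))]

lemma exists_isExpStableOn_prod (M : E →L[ℂ] E) (hlam : lam < mu) (l : List ℂ)
    (hl : ∀ z ∈ l, z.re ≤ -mu) :
    ∃ C, 0 ≤ C ∧ IsExpStableOn M (l.map fun z => M - algebraMap ℂ (E →L[ℂ] E) z).prod lam C := by
  induction l with
  | nil =>
    refine ⟨0, le_rfl, fun f g N T _ hf _ t ht => ?_⟩
    have hft : f t = 0 := by simpa using hf t ht.1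
    simp [hft]
  | cons z l ih =>
    obtain ⟨C, hC, hstable⟩ := ih fun w hw => hl w (List.mem_cons_of_mem _ hw)
    have hgap : 0 ≤ (mu - lam)⁻¹ := inv_nonneg.2 (sub_nonneg.2 hlam.le)
    rw [List.map_cons, List.prod_cons]
    exact ⟨_, add_nonneg zero_le_one (mul_nonneg hgap (by positivity)),
      hstable.sub_algebraMap_mul hC (commute_sub_algebraMap_prod M z l)
        (hl z List.mem_cons_self) hlam⟩

end InputToState

lemma exists_pos_forall_re_le (s : Multiset ℂ) (hs : ∀ z ∈ s, z.re < 0) :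
    ∃ mu : ℝ, 0 < mu ∧ ∀ z ∈ s, z.re ≤ -mu := by
  induction s using Multiset.induction_on with
  | empty => exact ⟨1, one_pos, by simp⟩
  | cons z s ih =>
    obtain ⟨mu, hmu, h⟩ := ih fun w hw => hs w (Multiset.mem_cons_of_mem hw)
    have hz := hs z (Multiset.mem_cons_self z s)
    refine ⟨min mu (-z.re), lt_min hmu (by linarith), fun w hw => ?_⟩
    rcases Multiset.mem_cons.1 hw with rfl | hw
    · linarith [min_le_right mu (-w.re)]
    · linarith [h w hw, min_le_left mu (-z.re)]

lemma prod_sub_roots_charpoly_eq_zero {𝕜 ι A : Type*} [Field 𝕜] [IsAlgClosed 𝕜] [Fintype ι]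
    [DecidableEq ι] [Ring A] [Algebra 𝕜 A] (M : Matrix ι ι 𝕜) (F : Matrix ι ι 𝕜 →ₐ[𝕜] A) :
    (M.charpoly.roots.toList.map fun z => F M - algebraMap 𝕜 A z).prod = 0 := by
  have hsplit : M.charpoly
      = (M.charpoly.roots.toList.map fun z => Polynomial.X - Polynomial.C z).prod := by
    rw [← Multiset.prod_coe, ← Multiset.map_coe, Multiset.coe_toList]
    exact (IsAlgClosed.splits M.charpoly).eq_prod_roots_of_monic (Matrix.charpoly_monic M)
  have hcayley := congrArg (F.comp (Polynomial.aeval M)) hsplit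
  rw [map_list_prod, List.map_map, AlgHom.comp_apply, Matrix.aeval_self_charpoly, map_zero]
    at hcayley
  rw [hcayley]
  congr 1
  exact List.map_congr_left fun z _ => by simp

lemma norm_ofReal_comp {ι : Type*} [Fintype ι] (v : ι → ℝ) : ‖fun j => (v j : ℂ)‖ = ‖v‖ := by
  simp [Pi.norm_def]

lemma exists_bound_of_isHurwitz {M : Matrix (Fin n) (Fin n) ℝ} (hM : IsHurwitz M) :
    ∃ mu : ℝ, 0 < mu ∧ ∀ lam, lam < mu → ∃ C : ℝ, 0 ≤ C ∧
      ∀ (X g : ℝ → Fin n → ℝ) (N T : ℝ),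
        (∀ t, 0 ≤ t → HasDerivWithinAt X (M *ᵥ X t + g t) (Ici 0) t) →
        (∀ t ∈ Icc 0 T, ‖g t‖ ≤ N * Real.exp (-lam * t)) →
        ∀ t ∈ Icc 0 T, ‖X t‖ ≤ C * (‖X 0‖ + N) * Real.exp (-lam * t) := by
  set Mc := M.map (algebraMap ℝ ℂ) with hMc
  obtain ⟨mu, hmu, hre⟩ := exists_pos_forall_re_le Mc.charpoly.roots fun z hz =>
    hM z (Matrix.mem_spectrum_of_isRoot_charpoly
      ((Polynomial.mem_roots (Matrix.charpoly_monic _).ne_zero).1 hz))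
  let toCLM : Matrix (Fin n) (Fin n) ℂ →ₐ[ℂ] ((Fin n → ℂ) →L[ℂ] (Fin n → ℂ)) :=
    (Module.End.toContinuousLinearMap (Fin n → ℂ)).toAlgHom.comp
      (Matrix.toLinAlgEquiv' (R := ℂ) (n := Fin n)).toAlgHom
  have htoCLM : ∀ v, toCLM Mc v = Mc *ᵥ v := fun _ => rfl
  refine ⟨mu, hmu, fun lam hlam => ?_⟩
  obtain ⟨C, hC, hstable⟩ := exists_isExpStableOn_prod (toCLM Mc) hlam Mc.charpoly.roots.toList
    fun z hz => hre z (Multiset.mem_toList.1 hz)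
  refine ⟨C, hC, fun X g N T hX hg => ?_⟩
  rw [prod_sub_roots_charpoly_eq_zero Mc toCLM] at hstable
  have hode : ∀ t, 0 ≤ t → HasDerivWithinAt (fun t j => (X t j : ℂ))
      (toCLM Mc (fun j => (X t j : ℂ)) + fun j => (g t j : ℂ)) (Ici 0) t := fun t ht => by
    refine hasDerivWithinAt_pi.2 fun j => ?_
    refine (Complex.ofRealCLM.hasFDerivAt.comp_hasDerivWithinAt t
      (hasDerivWithinAt_pi.1 (hX t ht) j)).congr_deriv ?_
    rw [htoCLM]
    simp [hMc, Matrix.mulVec, dotProduct]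
  simpa only [norm_ofReal_comp] using hstable _ _ N T hode (fun _ _ => rfl)
    (fun t ht => (norm_ofReal_comp _).trans_le (hg t ht))

section Chain

variable {k : ℕ} {c : ℕ → ℝ} {cm lam N T : ℝ}

-- The skew coupling `y_{i+1} - y_{i-1}` telescopes in `∑ y_i y_i'`.
lemma sum_chain_eq {y : ℕ → ℝ} (hy0 : y 0 = 0) :
    ∑ i ∈ Finset.range k, 2 * y (i + 1) * (y (i + 2) - y i - c (i + 1) * y (i + 1))
      = 2 * (y k * y (k + 1)) - ∑ i ∈ Finset.range k, 2 * c (i + 1) * y (i + 1) ^ 2 := by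
  have htelescope := Finset.sum_range_sub (fun i => y i * y (i + 1)) k
  rw [hy0, zero_mul, sub_zero] at htelescope
  rw [← htelescope, Finset.mul_sum, ← Finset.sum_sub_distrib]
  exact Finset.sum_congr rfl fun i _ => by ring

lemma chain_dissipation {y : ℕ → ℝ} (G : ℝ) (hcm0 : 0 < cm) (hcm : 3 * lam ≤ cm)
    (hc : ∀ i < k, 3 * lam ≤ 2 * c (i + 1)) (hy0 : y 0 = 0) :
    (∑ i ∈ Finset.range k, 2 * y (i + 1) * (y (i + 2) - y i - c (i + 1) * y (i + 1)))
        + 2 * y (k + 1) * (-y k - cm * y (k + 1) + G)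
      ≤ -(3 * lam) * ∑ i ∈ Finset.range (k + 1), y (i + 1) ^ 2 + G ^ 2 / cm := by
  have hdamp : ∑ i ∈ Finset.range k, 3 * lam * y (i + 1) ^ 2
      ≤ ∑ i ∈ Finset.range k, 2 * c (i + 1) * y (i + 1) ^ 2 :=
    Finset.sum_le_sum fun i hi =>
      mul_le_mul_of_nonneg_right (hc i (Finset.mem_range.1 hi)) (sq_nonneg _)
  have hlast : 3 * lam * y (k + 1) ^ 2 ≤ cm * y (k + 1) ^ 2 :=
    mul_le_mul_of_nonneg_right hcm (sq_nonneg _)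
  have hyoung : 2 * y (k + 1) * G ≤ cm * y (k + 1) ^ 2 + G ^ 2 / cm := by
    have hsq : 0 ≤ (cm * y (k + 1) - G) ^ 2 / cm := by positivity
    have hexpand : (cm * y (k + 1) - G) ^ 2 / cm
        = cm * y (k + 1) ^ 2 + G ^ 2 / cm - 2 * y (k + 1) * G := by
      field_simp
      ring
    linarith
  rw [← Finset.mul_sum] at hdamp
  rw [sum_chain_eq hy0, Finset.sum_range_succ]
  linarith

lemma sum_sq_le_of_chain {y : ℕ → ℝ → ℝ} {G : ℝ → ℝ} (hlam : 0 < lam) (hcm : 3 * lam ≤ cm)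
    (hc : ∀ i < k, 3 * lam ≤ 2 * c (i + 1)) (hy0 : ∀ t, y 0 t = 0)
    (hy : ∀ i < k, ∀ t, 0 ≤ t → HasDerivWithinAt (y (i + 1))
      (y (i + 2) t - y i t - c (i + 1) * y (i + 1) t) (Ici 0) t)
    (hyk : ∀ t, 0 ≤ t → HasDerivWithinAt (y (k + 1))
      (-y k t - cm * y (k + 1) t + G t) (Ici 0) t)
    (hG : ∀ t ∈ Icc 0 T, |G t| ≤ N * Real.exp (-lam * t)) {t : ℝ} (ht : t ∈ Icc 0 T) :
    ∑ i ∈ Finset.range (k + 1), y (i + 1) t ^ 2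
      ≤ (∑ i ∈ Finset.range (k + 1), y (i + 1) 0 ^ 2 + N ^ 2 / (lam * cm))
        * Real.exp (-lam * t) ^ 2 := by
  have hcm0 : 0 < cm := by linarith
  have hexp : ∀ t, Real.exp (-lam * t) ^ 2 = Real.exp (-(2 * lam) * t) := fun t => by
    rw [← Real.exp_nat_mul]
    congr 1
    push_cast
    ring
  have hderiv : ∀ t, 0 ≤ t →
      HasDerivWithinAt (fun t => ∑ i ∈ Finset.range (k + 1), y (i + 1) t ^ 2)
        ((∑ i ∈ Finset.range k, 2 * y (i + 1) t * (y (i + 2) t - y i t - c (i + 1) * y (i + 1) t))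
          + 2 * y (k + 1) t * (-y k t - cm * y (k + 1) t + G t)) (Ici 0) t := fun t ht => by
    simp only [Finset.sum_range_succ]
    refine HasDerivWithinAt.add (HasDerivWithinAt.fun_sum fun i hi => ?_) ?_
    · exact ((hy i (Finset.mem_range.1 hi) t ht).pow 2).congr_deriv (by simp)
    · exact ((hyk t ht).pow 2).congr_deriv (by simp)
  have hdiss : ∀ t ∈ Icc 0 T,
      (∑ i ∈ Finset.range k, 2 * y (i + 1) t * (y (i + 2) t - y i t - c (i + 1) * y (i + 1) t))
          + 2 * y (k + 1) t * (-y k t - cm * y (k + 1) t + G t)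
        ≤ -(3 * lam) * (∑ i ∈ Finset.range (k + 1), y (i + 1) t ^ 2)
          + N ^ 2 / cm * Real.exp (-(2 * lam) * t) := fun t ht => by
    refine (chain_dissipation (y := (y · t)) (G t) hcm0 hcm hc (hy0 t)).trans ?_
    rw [div_mul_eq_mul_div, ← hexp, ← mul_pow]
    have hGsq := sq_le_sq.2 ((hG t ht).trans (le_abs_self _))
    gcongr _ + ?_ / _
  convert le_of_deriv_le_neg_mul_add_exp (by linarith) (by positivity) hderiv
    (Finset.sum_nonneg fun i _ => sq_nonneg _) hdiss ht using 2
  · rw [div_div]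
    congr 2
    ring
  · exact hexp t

end Chain

/-! ### Strong solutions as jets -/

instance : IsProbabilityMeasure unitMeasure :=
  ⟨by simp [unitMeasure]⟩

lemma intervalIntegrable_of_memLp {f : ℝ → ℝ} (hf : MemLp f 2 unitMeasure) {a b : ℝ}
    (ha : a ∈ Icc (0 : ℝ) 1) (hb : b ∈ Icc (0 : ℝ) 1) : IntervalIntegrable f volume a b := by
  have hintegrable : IntegrableOn f (Icc 0 1) := hf.integrable one_le_two
  exact intervalIntegrable_iff.2 <| hintegrable.mono_set fun _ hz =>
    uIcc_subset_Icc ha hb (uIoc_subset_uIcc hz)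

lemma abs_integral_le_eLpNorm {f : ℝ → ℝ} (hf : MemLp f 2 unitMeasure) {a b : ℝ}
    (ha : a ∈ Icc (0 : ℝ) 1) (hb : b ∈ Icc (0 : ℝ) 1) :
    |∫ y in a..b, f y| ≤ (eLpNorm f 2 unitMeasure).toReal := by
  have hintegrable : Integrable f unitMeasure := hf.integrable one_le_two
  have hsub : uIoc a b ⊆ Icc 0 1 := fun _ hy => uIcc_subset_Icc ha hb (uIoc_subset_uIcc hy)
  calc |∫ y in a..b, f y| = ‖∫ y in a..b, f y‖ := (Real.norm_eq_abs _).symm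
    _ ≤ ∫ y in uIoc a b, ‖f y‖ := intervalIntegral.norm_integral_le_integral_norm_uIoc
    _ ≤ ∫ y in Icc 0 1, ‖f y‖ :=
        setIntegral_mono_set hintegrable.norm (Eventually.of_forall fun _ => norm_nonneg _)
          (LE.le.eventuallyLE hsub)
    _ = (eLpNorm f 1 unitMeasure).toReal := by
        rw [eLpNorm_one_eq_lintegral_enorm]
        exact integral_norm_eq_lintegral_enorm hintegrable.1
    _ ≤ (eLpNorm f 2 unitMeasure).toReal := ENNReal.toReal_mono hf.2.ne
        (eLpNorm_le_eLpNorm_of_exponent_le one_le_two hf.1)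

lemma memLp_of_continuousOn {f : ℝ → ℝ} (hf : ContinuousOn f (Icc 0 1)) :
    MemLp f 2 unitMeasure := by
  obtain ⟨C, hC⟩ := isCompact_Icc.exists_bound_of_continuousOn hf
  exact MemLp.of_bound (hf.aestronglyMeasurable measurableSet_Icc) C
    ((ae_restrict_iff' measurableSet_Icc).2 (Eventually.of_forall hC))

lemma abs_le_eLpNorm_add_eLpNorm {h h' : ℝ → ℝ} (hc : ContinuousOn h (Icc 0 1))
    (hh' : MemLp h' 2 unitMeasure)
    (hintegrable : ∀ x ∈ Icc (0 : ℝ) 1, ∀ y ∈ Icc (0 : ℝ) 1, ∫ z in y..x, h' z = h x - h y)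
    {x : ℝ} (hx : x ∈ Icc (0 : ℝ) 1) :
    |h x| ≤ (eLpNorm h 2 unitMeasure).toReal + (eLpNorm h' 2 unitMeasure).toReal := by
  have hpointwise : ∀ y ∈ Icc (0 : ℝ) 1, |h x| - (eLpNorm h' 2 unitMeasure).toReal ≤ ‖h y‖ := by
    intro y hy
    have hosc := abs_integral_le_eLpNorm hh' hy hx
    rw [hintegrable x hx y hy] at hosc
    rw [Real.norm_eq_abs]
    linarith [abs_sub_abs_le_abs_sub (h x) (h y)]
  have hmean := intervalIntegral.integral_mono_on (μ := volume) zero_le_one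
    (continuous_const.intervalIntegrable _ _)
    ((hc.norm.mono (by rw [uIcc_of_le zero_le_one])).intervalIntegrable) hpointwise
  have hnorm := (le_abs_self _).trans (abs_integral_le_eLpNorm (memLp_of_continuousOn hc).norm
    unitInterval.zero_mem unitInterval.one_mem)
  rw [eLpNorm_norm] at hnorm
  simp only [intervalIntegral.integral_const, sub_zero, smul_eq_mul, one_mul] at hmean
  linarith

lemma hasDerivWithinAt_dx {k i : ℕ} {f : ℝ → ℝ} (hf : ContDiffOn ℝ k f (Icc 0 1)) (hi : i < k)
    {x : ℝ} (hx : x ∈ Icc (0 : ℝ) 1) :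
    HasDerivWithinAt (dx i f) (dx (i + 1) f x) (Icc 0 1) x := by
  unfold dx
  rw [iteratedDerivWithin_succ]
  exact (hf.differentiableOn_iteratedDerivWithin (m := i) (by exact_mod_cast hi)
    (uniqueDiffOn_Icc zero_lt_one) x hx).hasDerivWithinAt

lemma continuousOn_dx {k i : ℕ} {f : ℝ → ℝ} (hf : ContDiffOn ℝ k f (Icc 0 1)) (hi : i ≤ k) :
    ContinuousOn (dx i f) (Icc 0 1) :=
  hf.continuousOn_iteratedDerivWithin (by exact_mod_cast hi) (uniqueDiffOn_Icc zero_lt_one)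

namespace MemH

variable {k i : ℕ} {f g : ℝ → ℝ} {x : ℝ}

lemma memLp_dx (hf : MemH (k + 1) f) (hi : i ≤ k + 1) : MemLp (dx i f) 2 unitMeasure := by
  rcases hi.lt_or_eq with hi | rfl
  · exact memLp_of_continuousOn (continuousOn_dx hf.1 (by lia))
  · exact hf.2.2

lemma integral_dx (hf : MemH (k + 1) f) (hi : i ≤ k) {y : ℝ} (hx : x ∈ Icc (0 : ℝ) 1)
    (hy : y ∈ Icc (0 : ℝ) 1) : ∫ z in y..x, dx (i + 1) f z = dx i f x - dx i f y := by
  have hsub : uIcc y x ⊆ Icc 0 1 := uIcc_subset_Icc hy hx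
  rcases hi.lt_or_eq with hi | rfl
  · refine intervalIntegral.integral_eq_sub_of_hasDeriv_right
      ((continuousOn_dx hf.1 hi.le).mono hsub) (fun z hz => ?_)
      (((continuousOn_dx hf.1 hi).mono hsub).intervalIntegrable)
    have hz1 : z ∈ Ioo (0 : ℝ) 1 :=
      ⟨(le_min hy.1 hx.1).trans_lt hz.1, hz.2.trans_le (max_le hy.2 hx.2)⟩
    exact ((hasDerivWithinAt_dx hf.1 hi (Ioo_subset_Icc_self hz1)).hasDerivAt
      (Icc_mem_nhds hz1.1 hz1.2)).hasDerivWithinAt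
  · have hac := hf.2.1.mono (c := y) (d := x) (by rwa [uIcc_of_le zero_le_one])
    rw [← hac.integral_deriv_eq_sub]
    refine intervalIntegral.integral_congr_ae ?_
    filter_upwards [(countable_singleton (0 : ℝ)).ae_notMem volume,
      (countable_singleton (1 : ℝ)).ae_notMem volume] with z hz0 hz1 hzx
    have hz := hsub (uIoc_subset_uIcc hzx)
    rw [dx, iteratedDerivWithin_succ, derivWithin_of_mem_nhds
      (Icc_mem_nhds (lt_of_le_of_ne hz.1 (Ne.symm hz0)) (lt_of_le_of_ne hz.2 hz1))]
    rfl

lemma abs_dx_sub_le (hf : MemH (k + 1) f) (hg : MemH (k + 1) g) (hi : i ≤ k)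
    (hx : x ∈ Icc (0 : ℝ) 1) :
    |dx i f x - dx i g x| ≤ (eLpNorm (fun x => dx i f x - dx i g x) 2 unitMeasure).toReal
      + (eLpNorm (fun x => dx (i + 1) f x - dx (i + 1) g x) 2 unitMeasure).toReal := by
  have hf' := hf.memLp_dx (show i + 1 ≤ k + 1 by lia)
  have hg' := hg.memLp_dx (show i + 1 ≤ k + 1 by lia)
  refine abs_le_eLpNorm_add_eLpNorm ((continuousOn_dx hf.1 hi).sub (continuousOn_dx hg.1 hi))
    (hf'.sub hg') (fun x hx y hy => ?_) hx
  simp only [Pi.sub_apply]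
  rw [intervalIntegral.integral_sub (intervalIntegrable_of_memLp hf' hy hx)
    (intervalIntegrable_of_memLp hg' hy hx), hf.integral_dx hi hx hy, hg.integral_dx hi hx hy]
  ring

end MemH

lemma continuous_uncurry_of_abs_sub_le {F B : ℝ → ℝ → ℝ} (hF : ∀ t, Continuous fun x => F x t)
    (hFB : ∀ t₀ x t, |F x t - F x t₀| ≤ B t₀ t) (hB : ∀ t₀, Tendsto (B t₀) (𝓝 t₀) (𝓝 0)) :
    Continuous (Function.uncurry F) := by
  refine continuous_iff_continuousAt.2 fun ⟨x₀, t₀⟩ => ?_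
  have htime : Tendsto (fun z : ℝ × ℝ => F z.1 z.2 - F z.1 t₀) (𝓝 (x₀, t₀)) (𝓝 0) :=
    squeeze_zero_norm (fun z => hFB t₀ z.1 z.2) ((hB t₀).comp continuous_snd.continuousAt)
  have hspace : Tendsto (fun z : ℝ × ℝ => F z.1 t₀) (𝓝 (x₀, t₀)) (𝓝 (F x₀ t₀)) :=
    ((hF t₀).comp continuous_fst).tendsto (x₀, t₀)
  have hsum := htime.add hspace
  simp only [sub_add_cancel, zero_add] at hsum
  exact hsum

/-- The `x`-derivatives of a function on `[0,1] × [0,∞)`, extended to the plane by constants along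
the coordinate axes, so that continuity statements need no domain restriction. -/
def uJet (u : ℝ → ℝ → ℝ) (i : ℕ) (x t : ℝ) : ℝ :=
  dx i (fun y => u y (max t 0)) (projIcc 0 1 zero_le_one x)

lemma uJet_of_mem (u : ℝ → ℝ → ℝ) (i : ℕ) {x t : ℝ} (hx : x ∈ Icc (0 : ℝ) 1) (ht : 0 ≤ t) :
    uJet u i x t = dx i (fun y => u y t) x := by
  rw [uJet, projIcc_of_mem zero_le_one hx, max_eq_left ht]

lemma uJet_zero (u : ℝ → ℝ → ℝ) {x t : ℝ} (hx : x ∈ Icc (0 : ℝ) 1) (ht : 0 ≤ t) :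
    uJet u 0 x t = u x t := by
  rw [uJet_of_mem u 0 hx ht, dx, iteratedDerivWithin_zero]

section Regularity

variable {k : ℕ} {u : ℝ → ℝ → ℝ}

lemma continuous_uJet {i : ℕ} (hu : ∀ t, 0 ≤ t → MemH (k + 1) fun x => u x t)
    (hc : ∀ t, 0 ≤ t → ∀ i ≤ k + 1,
      Tendsto (fun s => eLpNorm (fun x => dx i (fun y => u y s) x - dx i (fun y => u y t) x)
        2 unitMeasure) (𝓝[Ici 0] t) (𝓝 0)) (hi : i ≤ k) :
    Continuous (Function.uncurry (uJet u i)) := by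
  refine continuous_uncurry_of_abs_sub_le
    (fun t => (continuousOn_dx (hu _ (le_max_right _ _)).1 hi).comp_continuous
      (continuous_subtype_val.comp continuous_projIcc) fun x => Subtype.prop _)
    (fun t₀ x t => (hu _ (le_max_right _ _)).abs_dx_sub_le (hu _ (le_max_right _ _)) hi
      (Subtype.prop _)) fun t₀ => ?_
  have hmax : Tendsto (fun t : ℝ => max t 0) (𝓝 t₀) (𝓝[Ici 0] (max t₀ 0)) :=
    tendsto_nhdsWithin_iff.2 ⟨Continuous.tendsto (by fun_prop) t₀,
      Eventually.of_forall fun t => mem_Ici.2 (le_max_right _ _)⟩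
  have hnorm : ∀ j ≤ k + 1, Tendsto (fun t => (eLpNorm (fun x => dx j (fun y => u y (max t 0)) x
      - dx j (fun y => u y (max t₀ 0)) x) 2 unitMeasure).toReal) (𝓝 t₀) (𝓝 0) := fun j hj =>
    (ENNReal.tendsto_toReal ENNReal.zero_ne_top).comp ((hc _ (le_max_right _ _) j hj).comp hmax)
  simpa using (hnorm i (by lia)).add (hnorm (i + 1) (by lia))

lemma hasDerivWithinAt_integral_of_heat {q : ℝ} (hk : 1 ≤ k)
    (hu : ∀ t, 0 ≤ t → MemH (k + 1) fun x => u x t)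
    (hheat : ∀ t, 0 ≤ t → Tendsto (fun s => eLpNorm
      (fun x => (s - t)⁻¹ * (u x s - u x t) - q * dx 2 (fun y => u y t) x)
      2 unitMeasure) (𝓝[Ici 0 \ {t}] t) (𝓝 0))
    {x t : ℝ} (hx : x ∈ Icc (0 : ℝ) 1) (ht : 0 ≤ t) :
    HasDerivWithinAt (fun t => ∫ y in (0 : ℝ)..x, u y t)
      (q * (dx 1 (fun y => u y t) x - dx 1 (fun y => u y t) 0)) (Ici 0) t := by
  have hu0 : ∀ s, 0 ≤ s → MemLp (fun y => u y s) 2 unitMeasure := fun s hs =>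
    memLp_of_continuousOn (hu s hs).1.continuousOn
  have hu2 : MemLp (dx 2 fun y => u y t) 2 unitMeasure := (hu t ht).memLp_dx (by lia)
  have hintegrable : ∀ {f : ℝ → ℝ}, MemLp f 2 unitMeasure →
      IntervalIntegrable f volume 0 x := fun hf =>
    intervalIntegrable_of_memLp hf unitInterval.zero_mem hx
  rw [hasDerivWithinAt_iff_tendsto_slope, ← tendsto_sub_nhds_zero_iff]
  refine squeeze_zero_norm' ?_
    ((ENNReal.tendsto_toReal ENNReal.zero_ne_top).comp (hheat t ht))
  filter_upwards [self_mem_nhdsWithin] with s hs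
  have hquot : MemLp (fun y => (s - t)⁻¹ * (u y s - u y t)) 2 unitMeasure :=
    ((hu0 s hs.1).sub (hu0 t ht)).const_mul _
  have hres : MemLp (fun y => (s - t)⁻¹ * (u y s - u y t) - q * dx 2 (fun y => u y t) y)
      2 unitMeasure := hquot.sub (hu2.const_mul q)
  have hle := abs_integral_le_eLpNorm hres unitInterval.zero_mem hx
  rw [intervalIntegral.integral_sub (hintegrable hquot) (hintegrable (hu2.const_mul q)),
    intervalIntegral.integral_const_mul, intervalIntegral.integral_const_mul,
    intervalIntegral.integral_sub (hintegrable (hu0 s hs.1)) (hintegrable (hu0 t ht)),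
    (hu t ht).integral_dx (i := 1) hk hx unitInterval.zero_mem] at hle
  simpa [slope_def_module] using hle

end Regularity

lemma Plant.IsClosedLoopSolution.heatJet {P : Plant n m} {K : Fin n → ℝ} {c : ℕ → ℝ} {cm : ℝ}
    {u : ℝ → ℝ → ℝ} {X : ℝ → Fin n → ℝ} {Z : ℝ → Fin m → ℝ} {U : ℝ → ℝ} (hm : 1 ≤ m)
    (h : P.IsClosedLoopSolution K c cm u X Z U) : HeatJet P.q (2 * m - 1) (uJet u) := by
  obtain ⟨k, hk⟩ : ∃ k, 2 * m = k + 1 := ⟨2 * m - 1, by lia⟩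
  have hmem := h.memH
  have hcont := h.continuous_H
  rw [hk] at hmem hcont
  rw [show 2 * m - 1 = k by lia]
  refine ⟨fun i hi => continuous_uJet hmem hcont hi, fun i hi t ht x hx => ?_,
    fun x hx t ht => ?_⟩
  · rw [uJet_of_mem u _ hx ht]
    exact (hasDerivWithinAt_dx (hmem t ht).1 hi hx).congr (fun y hy => uJet_of_mem u i hy ht)
      (uJet_of_mem u i hx ht)
  · have hintegral : ∀ s, 0 ≤ s →
        ∫ y in (0 : ℝ)..x, uJet u 0 y s = ∫ y in (0 : ℝ)..x, u y s := fun s hs =>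
      intervalIntegral.integral_congr fun y hy =>
        uJet_zero u (uIcc_subset_Icc unitInterval.zero_mem hx hy) hs
    rw [uJet_of_mem u _ hx ht, uJet_of_mem u _ unitInterval.zero_mem ht]
    exact (hasDerivWithinAt_integral_of_heat (by lia) hmem h.heat hx ht).congr hintegral
      (hintegral t ht)

/-! ### The backstepping transformation -/

lemma conv_comm (k f : ℝ → ℝ) (x : ℝ) : conv k f x = conv f k x := by
  have hsubst := intervalIntegral.integral_comp_sub_left (a := 0) (b := x)
    (fun y => k y * f (x - y)) x
  simp only [sub_self, sub_zero, sub_sub_cancel] at hsubst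
  rw [conv, conv, hsubst]
  exact intervalIntegral.integral_congr fun y _ => mul_comm _ _

lemma conv_congr_left {k k' f : ℝ → ℝ} {x : ℝ} (hx : 0 ≤ x) (h : ∀ y ∈ Icc 0 x, k y = k' y) :
    conv k f x = conv k' f x := by
  rw [conv_comm, conv_comm k', conv_congr_right hx h]

lemma one_conv (f : ℝ → ℝ) (x : ℝ) : conv (fun _ => 1) f x = ∫ y in (0 : ℝ)..x, f y := by
  simp only [conv, one_mul]

lemma integral_conv {k f : ℝ → ℝ} (hk : Continuous k) (hf : Continuous f) {x : ℝ} (hx : 0 ≤ x) :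
    ∫ y in (0 : ℝ)..x, conv k f y = conv k (fun y => ∫ z in (0 : ℝ)..y, f z) x := by
  simp only [← one_conv]
  rw [conv_assoc hk continuous_const hf hx, funext (conv_comm k fun _ => 1),
    ← conv_assoc continuous_const hk hf hx]

lemma hasDerivWithinAt_conv_right {k f f' : ℝ → ℝ} (hk : Continuous k)
    (hf : ∀ x, HasDerivAt f (f' x) x) (hf' : Continuous f') {s : Set ℝ} (hs : s ⊆ Ici 0) {x : ℝ}
    (hx : 0 ≤ x) : HasDerivWithinAt (conv k f) (f 0 * k x + conv k f' x) s x := by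
  rw [conv_comm k f', funext (conv_comm k f)]
  exact hasDerivWithinAt_conv hf hf' hk hs hx

section ConvVec

variable {ι : Type*} {k : ℝ → ℝ} {v w : ℝ → ι → ℝ}

/-- The coordinatewise convolution `∫₀ˣ k(x - y) v(y) dy` of a scalar kernel with a row vector. -/
def convVec (k : ℝ → ℝ) (v : ℝ → ι → ℝ) (x : ℝ) : ι → ℝ := fun i => conv k (fun y => v y i) x

lemma convVec_apply_zero (k : ℝ → ℝ) (v : ℝ → ι → ℝ) : convVec k v 0 = 0 :=
  funext fun _ => conv_apply_zero _ _

lemma convVec_sub (hk : Continuous k) (hv : Continuous v) (hw : Continuous w) (x : ℝ) :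
    convVec k (fun y => v y - w y) x = convVec k v x - convVec k w x :=
  funext fun i => conv_sub hk ((continuous_apply i).comp hv) ((continuous_apply i).comp hw) x

lemma hasDerivWithinAt_convVec {v' : ℝ → ι → ℝ} (hk : Continuous k)
    (hv : ∀ x, HasDerivAt v (v' x) x) (hv' : Continuous v') {s : Set ℝ} (hs : s ⊆ Ici 0) {x : ℝ}
    (hx : 0 ≤ x) : HasDerivWithinAt (convVec k v) (k x • v 0 + convVec k v' x) s x := by
  refine hasDerivWithinAt_pi.2 fun i => ?_
  refine (hasDerivWithinAt_conv_right hk (fun x => hasDerivAt_pi.1 (hv x) i)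
    ((continuous_apply i).comp hv') hs hx).congr_deriv ?_
  rw [mul_comm (v 0 i)]
  rfl

variable [Fintype ι]

lemma conv_dotProduct (hk : Continuous k) (hv : Continuous v) (b : ι → ℝ) (x : ℝ) :
    conv k (fun y => v y ⬝ᵥ b) x = convVec k v x ⬝ᵥ b := by
  simp only [convVec, conv, dotProduct, Finset.mul_sum]
  rw [intervalIntegral.integral_finsetSum fun i _ =>
    Continuous.intervalIntegrable (by fun_prop) _ _]
  refine Finset.sum_congr rfl fun i _ => ?_
  rw [← intervalIntegral.integral_mul_const]
  exact intervalIntegral.integral_congr fun y _ => (mul_assoc _ _ _).symm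

lemma convVec_vecMul (hk : Continuous k) (hv : Continuous v) (M : Matrix ι ι ℝ) (x : ℝ) :
    convVec k (fun y => v y ᵥ* M) x = convVec k v x ᵥ* M :=
  funext fun _ => conv_dotProduct hk hv _ x

end ConvVec

/-- The `x`-derivatives of `g 0 - ∫₀ˣ κ(x - y) g 0 dy - G(x) X`, where `κ i` and `G i` are the
derivatives of `κ 0` and `G 0`, and `g i` those of `g 0`. -/
def transJet (κ : ℕ → ℝ → ℝ) (G : ℕ → ℝ → Fin n → ℝ) (g : ℕ → ℝ → ℝ → ℝ) (X : ℝ → Fin n → ℝ)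
    (i : ℕ) (x t : ℝ) : ℝ :=
  g i x t - (conv (κ i) (fun y => g 0 y t) x + ∑ j ∈ Finset.range i, κ j 0 * g (i - 1 - j) x t)
    - G i x ⬝ᵥ X t

section TransJet

variable {κ : ℕ → ℝ → ℝ} {G : ℕ → ℝ → Fin n → ℝ} {g : ℕ → ℝ → ℝ → ℝ} {X : ℝ → Fin n → ℝ} {N : ℕ}

lemma transJet_zero (κ : ℕ → ℝ → ℝ) (G : ℕ → ℝ → Fin n → ℝ) (g : ℕ → ℝ → ℝ → ℝ)
    (X : ℝ → Fin n → ℝ) (x t : ℝ) :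
    transJet κ G g X 0 x t = g 0 x t - conv (κ 0) (fun y => g 0 y t) x - G 0 x ⬝ᵥ X t := by
  rw [transJet, Finset.sum_range_zero, add_zero]

lemma continuous_transJet (hκ : ∀ i, Continuous (κ i)) (hG : ∀ i, Continuous (G i))
    (hg : ∀ i ≤ N, Continuous (Function.uncurry (g i))) (hX : Continuous X) {i : ℕ} (hi : i ≤ N) :
    Continuous (Function.uncurry (transJet κ G g X i)) := by
  have hconv := continuous_uncurry_conv (hκ i) (hg 0 (by lia))
  have hlocal : Continuous fun z : ℝ × ℝ => ∑ j ∈ Finset.range i, κ j 0 * g (i - 1 - j) z.1 z.2 :=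
    continuous_finsetSum _ fun j _ => continuous_const.mul (hg (i - 1 - j) (by lia))
  have hX' : Continuous fun z : ℝ × ℝ => G i z.1 ⬝ᵥ X z.2 :=
    ((hG i).comp continuous_fst).dotProduct (hX.comp continuous_snd)
  exact ((hg i hi).sub (hconv.add hlocal)).sub hX'

lemma hasDerivWithinAt_transJet (hκ : ∀ i x, HasDerivAt (κ i) (κ (i + 1) x) x)
    (hG : ∀ i x, HasDerivAt (G i) (G (i + 1) x) x) {t : ℝ}
    (hgc : Continuous fun x => g 0 x t) {i : ℕ}
    (hg : ∀ j ≤ i, ∀ x ∈ Icc (0 : ℝ) 1,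
      HasDerivWithinAt (fun x => g j x t) (g (j + 1) x t) (Icc 0 1) x)
    {x : ℝ} (hx : x ∈ Icc (0 : ℝ) 1) :
    HasDerivWithinAt (fun x => transJet κ G g X i x t) (transJet κ G g X (i + 1) x t)
      (Icc 0 1) x := by
  have hκc : Continuous (κ (i + 1)) :=
    continuous_iff_continuousAt.2 fun x => (hκ (i + 1) x).continuousAt
  have hconv := hasDerivWithinAt_conv (hκ i) hκc hgc (s := Icc 0 1) Icc_subset_Ici_self hx.1
  have hlocal : HasDerivWithinAt (fun x => ∑ j ∈ Finset.range i, κ j 0 * g (i - 1 - j) x t)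
      (∑ j ∈ Finset.range i, κ j 0 * g (i - j) x t) (Icc 0 1) x := by
    refine HasDerivWithinAt.fun_sum fun j hj => ?_
    have hji := Finset.mem_range.1 hj
    have hderiv := (hg (i - 1 - j) (by lia) x hx).const_mul (κ j 0)
    rwa [show i - 1 - j + 1 = i - j by lia] at hderiv
  have hX := (hasDerivAt_dotProduct_const (hG i x) (X t)).hasDerivWithinAt (s := Icc 0 1)
  refine (((hg i le_rfl x hx).sub (hconv.add hlocal)).sub hX).congr_deriv ?_
  rw [transJet, Finset.sum_range_succ]
  simp only [Nat.add_sub_cancel, Nat.sub_self]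
  ring

end TransJet

/-- The part of the closed loop that does not involve the control: the jet `g` of `u` and the
state `X`. -/
structure Plant.IsReduced (P : Plant n m) (N : ℕ) (g : ℕ → ℝ → ℝ → ℝ) (X : ℝ → Fin n → ℝ) :
    Prop where
  one_le : 1 ≤ N
  jet : HeatJet P.q N g
  contX : Continuous X
  odeX : ∀ t, 0 ≤ t → HasDerivWithinAt X (P.A *ᵥ X t + g 1 0 t • P.B) (Ici 0) t
  left : ∀ t, 0 ≤ t → g 0 0 t = P.CX ⬝ᵥ X t

lemma HeatJet.hasDerivWithinAt_integral_conv {q : ℝ} {N : ℕ} {g : ℕ → ℝ → ℝ → ℝ} {k : ℝ → ℝ}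
    (hg : HeatJet q N g) (hN : 1 ≤ N) (hk : Continuous k) {x : ℝ} (hx : x ∈ Icc (0 : ℝ) 1) {t : ℝ}
    (ht : 0 ≤ t) :
    HasDerivWithinAt (fun s => ∫ y in (0 : ℝ)..x, conv k (fun y => g 0 y s) y)
      (conv k (fun y => q * (g 1 y t - g 1 0 t)) x) (Ici 0) t := by
  have hg0 := continuous_uncurry_right (hg.cont 0 (by lia))
  have hg1 := hg.cont 1 hN
  simp only [fun s => integral_conv hk (hg0 s) hx.1]
  exact hasDerivWithinAt_conv_param (F' := fun y s => q * (g 1 y s - g 1 0 s)) hx.1 ordConnected_Ici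
    hk (fun s =>
      intervalIntegral.continuous_primitive (fun _ _ => (hg0 s).intervalIntegrable _ _) 0)
    (continuous_const.mul (hg1.sub (hg1.comp (continuous_const.prodMk continuous_snd))))
    (fun y hy s hs => hg.flux y ⟨hy.1, hy.2.trans hx.2⟩ s hs) ht

namespace Plant

variable (P : Plant n m) (K : Fin n → ℝ)

/-- The jet of `w = u - ∫φu - ΦX`. -/
def wJet (g : ℕ → ℝ → ℝ → ℝ) (X : ℝ → Fin n → ℝ) : ℕ → ℝ → ℝ → ℝ :=
  transJet (P.phiD K) (P.PhiD K) g X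

lemma PhiD_dotProduct_B (hq : P.q ≠ 0) (k : ℕ) (x : ℝ) :
    P.PhiD K k x ⬝ᵥ P.B = P.q * P.phiD K k x := by
  rw [phiD, mul_inv_cancel_left₀ hq]

lemma integral_PhiD_dotProduct (hq : P.q ≠ 0) (ξ : Fin n → ℝ) (x : ℝ) :
    ∫ y in (0 : ℝ)..x, P.PhiD K 0 y ⬝ᵥ (P.A *ᵥ ξ)
      = P.q * ((P.phiD K 0 x - P.phiD K 0 0) * (P.CX ⬝ᵥ ξ)
        + (P.PhiD K 1 x ⬝ᵥ ξ - P.PhiD K 1 0 ⬝ᵥ ξ)) := by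
  have hprim : ∀ y, HasDerivAt
      (fun y => P.q * (P.phiD K 0 y * (P.CX ⬝ᵥ ξ) + P.PhiD K 1 y ⬝ᵥ ξ))
      (P.PhiD K 0 y ⬝ᵥ (P.A *ᵥ ξ)) y := by
    intro y
    refine ((((P.hasDerivAt_phiD K 0 y).mul_const (P.CX ⬝ᵥ ξ)).add
      (hasDerivAt_dotProduct_const (P.hasDerivAt_PhiD K 1 y) ξ)).const_mul P.q).congr_deriv ?_
    rw [PhiD_add_two, sub_dotProduct, smul_dotProduct, smul_dotProduct, Matrix.dotProduct_mulVec,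
      smul_eq_mul, smul_eq_mul]
    field_simp
    ring
  rw [intervalIntegral.integral_eq_sub_of_hasDerivAt (fun y _ => hprim y)
    (Continuous.intervalIntegrable ((P.continuous_PhiD K 0).dotProduct continuous_const) _ _)]
  ring

variable {P} {N : ℕ} {g : ℕ → ℝ → ℝ → ℝ} {X : ℝ → Fin n → ℝ}

namespace IsReduced

lemma wJet_zero_left (h : P.IsReduced N g X) {t : ℝ} (ht : 0 ≤ t) : P.wJet K g X 0 0 t = 0 := by
  rw [wJet, transJet_zero, conv_apply_zero, PhiD_zero_zero, h.left t ht, sub_zero, sub_self]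

lemma wJet_one_left (h : P.IsReduced N g X) {t : ℝ} (ht : 0 ≤ t) :
    P.wJet K g X 1 0 t = g 1 0 t - K ⬝ᵥ X t := by
  simp only [wJet, transJet, conv_apply_zero, PhiD_one_zero, phiD, PhiD_zero_zero,
    Finset.sum_range_one, h.left t ht, sub_dotProduct, smul_dotProduct, smul_eq_mul, Nat.sub_self]
  ring

lemma odeX_wJet (h : P.IsReduced N g X) {t : ℝ} (ht : 0 ≤ t) :
    HasDerivWithinAt X (P.AK K *ᵥ X t + P.wJet K g X 1 0 t • P.B) (Ici 0) t := by
  refine (h.odeX t ht).congr_deriv ?_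
  ext i
  simp only [h.wJet_one_left K ht, AK, Matrix.add_mulVec, Matrix.vecMulVec_mulVec, Pi.add_apply,
    Pi.smul_apply, smul_eq_mul, MulOpposite.smul_eq_mul_unop, MulOpposite.unop_op]
  ring

lemma hasDerivWithinAt_integral_PhiD_dotProduct (h : P.IsReduced N g X) (x : ℝ) {t : ℝ}
    (ht : 0 ≤ t) :
    HasDerivWithinAt (fun s => ∫ y in (0 : ℝ)..x, P.PhiD K 0 y ⬝ᵥ X s)
      (∫ y in (0 : ℝ)..x, P.PhiD K 0 y ⬝ᵥ (P.A *ᵥ X t + g 1 0 t • P.B)) (Ici 0) t := by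
  have hg1 : Continuous fun s => g 1 0 s := continuous_uncurry_left (h.jet.cont 1 h.one_le) 0
  have hX' : Continuous fun s => P.A *ᵥ X s + g 1 0 s • P.B :=
    (continuous_const.matrix_mulVec h.contX).add (hg1.smul continuous_const)
  refine hasDerivWithinAt_intervalIntegral (F := fun y s => P.PhiD K 0 y ⬝ᵥ X s)
    (F' := fun y s => P.PhiD K 0 y ⬝ᵥ (P.A *ᵥ X s + g 1 0 s • P.B)) ordConnected_Ici
    (fun s => (P.continuous_PhiD K 0).dotProduct continuous_const)
    (((P.continuous_PhiD K 0).comp continuous_fst).dotProduct (hX'.comp continuous_snd))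
    (fun y _ s hs => ?_) ht
  simpa only [dotProduct_comm] using hasDerivWithinAt_dotProduct_const (h.odeX s hs) (P.PhiD K 0 y)

lemma integral_wJet_zero (h : P.IsReduced N g X) (x t : ℝ) :
    ∫ y in (0 : ℝ)..x, P.wJet K g X 0 y t
      = (∫ y in (0 : ℝ)..x, g 0 y t) - (∫ y in (0 : ℝ)..x, conv (P.phiD K 0) (fun y => g 0 y t) y)
        - ∫ y in (0 : ℝ)..x, P.PhiD K 0 y ⬝ᵥ X t := by
  have hu := continuous_uncurry_right (h.jet.cont 0 (by lia)) t
  have hconv := continuous_conv (P.continuous_phiD K 0) hu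
  have hdiff : Continuous fun y => g 0 y t - conv (P.phiD K 0) (fun y => g 0 y t) y :=
    hu.sub hconv
  have hΦ : Continuous fun y => P.PhiD K 0 y ⬝ᵥ X t :=
    (P.continuous_PhiD K 0).dotProduct continuous_const
  rw [← intervalIntegral.integral_sub (hu.intervalIntegrable _ _) (hconv.intervalIntegrable _ _),
    ← intervalIntegral.integral_sub (hdiff.intervalIntegrable _ _)
      (hΦ.intervalIntegrable _ _)]
  simp only [wJet, transJet_zero]

lemma flux_wJet (h : P.IsReduced N g X) (hq : P.q ≠ 0) {x : ℝ} (hx : x ∈ Icc (0 : ℝ) 1) {t : ℝ}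
    (ht : 0 ≤ t) :
    HasDerivWithinAt (fun s => ∫ y in (0 : ℝ)..x, P.wJet K g X 0 y s)
      (P.q * (P.wJet K g X 1 x t - P.wJet K g X 1 0 t)) (Ici 0) t := by
  have hφ := P.continuous_phiD K
  have hΦ := (P.continuous_PhiD K 0).dotProduct (continuous_const (y := P.A *ᵥ X t))
  have hg1 := continuous_uncurry_right (h.jet.cont 1 h.one_le) t
  have hderiv := ((h.jet.flux x hx t ht).sub
    (h.jet.hasDerivWithinAt_integral_conv h.one_le (hφ 0) hx ht)).sub
      (h.hasDerivWithinAt_integral_PhiD_dotProduct K x ht)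
  simp only [h.integral_wJet_zero K]
  refine hderiv.congr_deriv ?_
  have hΦX : ∫ y in (0 : ℝ)..x, P.PhiD K 0 y ⬝ᵥ (P.A *ᵥ X t + g 1 0 t • P.B)
      = (∫ y in (0 : ℝ)..x, P.PhiD K 0 y ⬝ᵥ (P.A *ᵥ X t))
        + g 1 0 t * P.q * conv (P.phiD K 0) (fun _ => 1) x := by
    rw [conv_comm, one_conv, ← intervalIntegral.integral_const_mul,
      ← intervalIntegral.integral_add (hΦ.intervalIntegrable _ _)
        (((hφ 0).const_mul _).intervalIntegrable _ _)]
    simp only [dotProduct_add, dotProduct_smul, smul_eq_mul, PhiD_dotProduct_B P K hq, mul_assoc]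
  have hconst : conv (P.phiD K 0) (fun y => P.q * (g 1 y t - g 1 0 t)) x
      = P.q * (conv (P.phiD K 0) (fun y => g 1 y t) x
        - g 1 0 t * conv (P.phiD K 0) (fun _ => 1) x) := by
    rw [conv_const_mul, conv_sub (hφ 0) hg1 continuous_const, ← conv_const_mul]
    simp only [mul_one]
  have hparts := conv_deriv (P.hasDerivAt_phiD K 0) (hφ 1) hg1
    (continuous_uncurry_right (h.jet.cont 0 (by lia)) t) (h.jet.space 0 h.one_le t ht) hx
  rw [hΦX, hconst, hparts, integral_PhiD_dotProduct P K hq, ← h.left t ht]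
  simp only [wJet, transJet, Finset.sum_range_one, conv_apply_zero, Nat.sub_self]
  ring

lemma heatJet_wJet (h : P.IsReduced N g X) (hq : P.q ≠ 0) : HeatJet P.q N (P.wJet K g X) where
  cont i hi := continuous_transJet (P.continuous_phiD K) (P.continuous_PhiD K) h.jet.cont h.contX hi
  space i hi t ht x hx := hasDerivWithinAt_transJet (P.hasDerivAt_phiD K) (P.hasDerivAt_PhiD K)
    (continuous_uncurry_right (h.jet.cont 0 (by lia)) t)
    (fun j hj x hx => h.jet.space j (by lia) t ht x hx) hx
  flux x hx t ht := h.flux_wJet K hq hx ht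

end IsReduced

end Plant

/-! ### The inverse transformation -/

lemma eq_zero_of_hasDerivWithinAt_clm {E : Type*} [NormedAddCommGroup E] [NormedSpace ℝ E]
    (L : E →L[ℝ] E) {v : ℝ → E} {a b : ℝ}
    (hv : ∀ x ∈ Icc a b, HasDerivWithinAt v (L (v x)) (Icc a b) x) (hv0 : v a = 0) {x : ℝ}
    (hx : x ∈ Icc a b) : v x = 0 := by
  have hgron := norm_le_gronwallBound_of_norm_deriv_right_le (δ := 0) (K := ‖L‖) (ε := 0)
    (fun x hx => (hv x hx).continuousWithinAt)
    (fun x hx => (hv x (Ico_subset_Icc_self hx)).mono_of_mem_nhdsWithin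
      (mem_of_superset (Icc_mem_nhdsGE hx.2) (Icc_subset_Icc_left hx.1)))
    (by simp [hv0]) (fun x _ => by rw [add_zero]; exact L.le_opNorm (v x)) x hx
  rwa [gronwallBound_ε0, zero_mul, norm_le_zero_iff] at hgron

namespace Plant

variable (P : Plant n m) (K : Fin n → ℝ)

lemma PhiD_two_eq_vecMul (x : ℝ) :
    P.PhiD K 2 x = P.PhiD K 0 x ᵥ* (P.q⁻¹ • P.A)
      - P.PhiD K 1 x ᵥ* (P.q⁻¹ • Matrix.vecMulVec P.B P.CX) := by
  rw [P.PhiD_add_two K 0, phiD, Matrix.vecMul_smul, Matrix.vecMul_smul, Matrix.vecMul_vecMulVec,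
    smul_smul]

lemma convVec_psiD_PhiD_two (x : ℝ) :
    convVec (P.psiD K 0) (P.PhiD K 2) x
      = convVec (P.psiD K 0) (P.PhiD K 0) x ᵥ* (P.q⁻¹ • P.A)
        - convVec (P.psiD K 0) (P.PhiD K 1) x ᵥ* (P.q⁻¹ • Matrix.vecMulVec P.B P.CX) := by
  have hψ := P.continuous_psiD K 0
  have hΦ := P.continuous_PhiD K
  rw [funext (P.PhiD_two_eq_vecMul K), convVec_sub hψ ((hΦ 0).matrix_vecMul continuous_const)
    ((hΦ 1).matrix_vecMul continuous_const), convVec_vecMul hψ (hΦ 0), convVec_vecMul hψ (hΦ 1)]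

-- The defect `r = Γ + Φ - ψ * Φ` and its derivative solve the same linear second order equation
-- as `Φ`, with zero initial data.
lemma GamD_add_PhiD {x : ℝ} (hx : x ∈ Icc (0 : ℝ) 1) :
    P.GamD K 0 x + P.PhiD K 0 x = convVec (P.psiD K 0) (P.PhiD K 0) x := by
  let M := P.q⁻¹ • P.A
  let N := P.q⁻¹ • Matrix.vecMulVec P.B P.CX
  let r : ℝ → Fin n → ℝ := fun x =>
    P.GamD K 0 x + P.PhiD K 0 x - convVec (P.psiD K 0) (P.PhiD K 0) x
  let r' : ℝ → Fin n → ℝ := fun x =>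
    P.GamD K 1 x + P.PhiD K 1 x - (P.psiD K 0 x • P.CX + convVec (P.psiD K 0) (P.PhiD K 1) x)
  have hconv : ∀ k, ∀ x ∈ Icc (0 : ℝ) 1, HasDerivWithinAt (convVec (P.psiD K 0) (P.PhiD K k))
      (P.psiD K 0 x • P.PhiD K k 0 + convVec (P.psiD K 0) (P.PhiD K (k + 1)) x) (Icc 0 1) x :=
    fun k x hx => hasDerivWithinAt_convVec (P.continuous_psiD K 0) (P.hasDerivAt_PhiD K k)
      (P.continuous_PhiD K (k + 1)) Icc_subset_Ici_self hx.1
  have hr : ∀ x ∈ Icc (0 : ℝ) 1, HasDerivWithinAt r (r' x) (Icc 0 1) x := fun x hx => by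
    refine (((P.hasDerivAt_GamD K 0 x).add (P.hasDerivAt_PhiD K 0 x)).hasDerivWithinAt.sub
      (hconv 0 x hx)).congr_deriv ?_
    rw [PhiD_zero_zero]
  have hr' : ∀ x ∈ Icc (0 : ℝ) 1, HasDerivWithinAt r' (r x ᵥ* M - r' x ᵥ* N) (Icc 0 1) x := by
    intro x hx
    have hψ := ((P.hasDerivAt_psiD K 0 x).smul_const P.CX).hasDerivWithinAt (s := Icc 0 1)
    refine (((P.hasDerivAt_GamD K 1 x).add (P.hasDerivAt_PhiD K 1 x)).hasDerivWithinAt.sub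
      (hψ.add (hconv 1 x hx))).congr_deriv ?_
    rw [P.convVec_psiD_PhiD_two K, P.PhiD_two_eq_vecMul K, P.GamD_add_two K 0, PhiD_one_zero,
      psiD.eq_def P K 1]
    simp only [r, r', M, N, Matrix.add_vecMul, Matrix.sub_vecMul, Matrix.vecMul_smul,
      Matrix.vecMul_vecMulVec, add_dotProduct, sub_dotProduct, smul_dotProduct, smul_eq_mul]
    module
  let L : (Fin n → ℝ) × (Fin n → ℝ) →ₗ[ℝ] (Fin n → ℝ) × (Fin n → ℝ) :=
    (LinearMap.snd ℝ _ _).prod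
      (Matrix.vecMulLinear M ∘ₗ LinearMap.fst ℝ _ _ - Matrix.vecMulLinear N ∘ₗ LinearMap.snd ℝ _ _)
  have hzero : r 0 = 0 ∧ r' 0 = 0 := by
    simp only [r, r', convVec_apply_zero, PhiD_zero_zero, PhiD_one_zero, GamD_zero_zero,
      GamD_one_zero, psiD, neg_dotProduct]
    constructor <;> module
  have hdefect := eq_zero_of_hasDerivWithinAt_clm (v := fun x => (r x, r' x))
    (LinearMap.toContinuousLinearMap L) (fun x hx => (hr x hx).prodMk (hr' x hx))
    (Prod.ext hzero.1 hzero.2) hx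
  exact sub_eq_zero.1 (congrArg Prod.fst hdefect)

lemma conv_psiD_phiD {x : ℝ} (hx : x ∈ Icc (0 : ℝ) 1) :
    conv (P.psiD K 0) (P.phiD K 0) x = P.psiD K 0 x + P.phiD K 0 x := by
  have hφ : P.phiD K 0 = fun y => P.q⁻¹ * (P.PhiD K 0 y ⬝ᵥ P.B) := rfl
  rw [hφ, conv_const_mul, conv_dotProduct (P.continuous_psiD K 0) (P.continuous_PhiD K 0),
    ← P.GamD_add_PhiD K hx, add_dotProduct, mul_add, psiD]

variable {P} {N : ℕ} {g : ℕ → ℝ → ℝ → ℝ} {X : ℝ → Fin n → ℝ}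

lemma conv_psiD_conv_phiD {f : ℝ → ℝ} (hf : Continuous f) {x : ℝ} (hx : x ∈ Icc (0 : ℝ) 1) :
    conv (P.psiD K 0) (conv (P.phiD K 0) f) x
      = conv (P.psiD K 0) f x + conv (P.phiD K 0) f x := by
  have hψ := P.continuous_psiD K 0
  have hφ := P.continuous_phiD K 0
  rw [conv_assoc hψ hφ hf hx.1, conv_congr_left hx.1 (k' := fun y => P.psiD K 0 y + P.phiD K 0 y)
    fun y hy => P.conv_psiD_phiD K ⟨hy.1, hy.2.trans hx.2⟩, conv_comm, conv_add hf hψ hφ,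
    conv_comm, conv_comm (P.phiD K 0)]

lemma IsReduced.transJet_wJet_zero (h : P.IsReduced N g X) (t : ℝ) {x : ℝ}
    (hx : x ∈ Icc (0 : ℝ) 1) :
    transJet (P.psiD K) (P.GamD K) (P.wJet K g X) X 0 x t = g 0 x t := by
  have hu := continuous_uncurry_right (h.jet.cont 0 (by lia)) t
  have hψ := P.continuous_psiD K 0
  have hφu := continuous_conv (P.continuous_phiD K 0) hu
  have hΦ := P.continuous_PhiD K 0
  have hdiff : Continuous fun y => g 0 y t - conv (P.phiD K 0) (fun y => g 0 y t) y := hu.sub hφu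
  have hw : conv (P.psiD K 0) (fun y => P.wJet K g X 0 y t) x
      = -conv (P.phiD K 0) (fun y => g 0 y t) x - (P.GamD K 0 x + P.PhiD K 0 x) ⬝ᵥ X t := by
    simp only [wJet, transJet_zero]
    rw [conv_sub hψ hdiff (hΦ.dotProduct continuous_const), conv_sub hψ hu hφu,
      conv_psiD_conv_phiD K hu hx, conv_dotProduct hψ hΦ, P.GamD_add_PhiD K hx]
    ring
  rw [transJet_zero, hw, wJet, transJet_zero, add_dotProduct]
  ring

lemma IsReduced.transJet_wJet (h : P.IsReduced N g X) (hq : P.q ≠ 0) {k : ℕ} (hk : k ≤ N)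
    {t : ℝ} (ht : 0 ≤ t) {x : ℝ} (hx : x ∈ Icc (0 : ℝ) 1) :
    transJet (P.psiD K) (P.GamD K) (P.wJet K g X) X k x t = g k x t := by
  have hw := h.heatJet_wJet K hq
  induction k generalizing x with
  | zero => exact h.transJet_wJet_zero K t hx
  | succ k ih =>
    have htrans := hasDerivWithinAt_transJet (X := X) (P.hasDerivAt_psiD K) (P.hasDerivAt_GamD K)
      (continuous_uncurry_right (hw.cont 0 (by lia)) t) (i := k)
      (fun j hj x hx => hw.space j (by lia) t ht x hx) hx
    have hjet := (h.jet.space k (by lia) t ht x hx).congr (fun y hy => ih (by lia) hy)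
      (ih (by lia) hx)
    exact (uniqueDiffOn_Icc (zero_lt_one (α := ℝ)) x hx).eq_deriv _ htrans hjet

end Plant

/-! ### The feedback law as a functional of boundary traces -/

/-- The linear functionals of a jet `(v 0, v 1, …)` that depend only on its first `N` entries. -/
def jetFunctionals (N : ℕ) : Submodule ℝ ((ℕ → ℝ) →ₗ[ℝ] ℝ) :=
  Submodule.span ℝ ((fun k => LinearMap.proj k) '' Iio N)

lemma proj_mem_jetFunctionals {k N : ℕ} (hk : k < N) : LinearMap.proj k ∈ jetFunctionals N :=
  Submodule.subset_span (mem_image_of_mem _ hk)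

lemma exists_bound_of_mem_jetFunctionals {N : ℕ} {ℓ : (ℕ → ℝ) →ₗ[ℝ] ℝ} (hℓ : ℓ ∈ jetFunctionals N) :
    ∃ C : ℝ, 0 ≤ C ∧ ∀ (v : ℕ → ℝ) (S : ℝ), (∀ k < N, |v k| ≤ S) → |ℓ v| ≤ C * S := by
  induction hℓ using Submodule.span_induction with
  | mem ℓ hℓ =>
    obtain ⟨k, hk, rfl⟩ := hℓ
    exact ⟨1, zero_le_one, fun v S hv => (hv k hk).trans_eq (one_mul S).symm⟩
  | zero => exact ⟨0, le_rfl, fun v S _ => by simp⟩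
  | add ℓ ℓ' _ _ ih ih' =>
    obtain ⟨C, hC, hb⟩ := ih
    obtain ⟨C', hC', hb'⟩ := ih'
    refine ⟨C + C', add_nonneg hC hC', fun v S hv => ?_⟩
    rw [LinearMap.add_apply, add_mul]
    exact (abs_add_le _ _).trans (add_le_add (hb v S hv) (hb' v S hv))
  | smul a ℓ _ ih =>
    obtain ⟨C, hC, hb⟩ := ih
    refine ⟨|a| * C, by positivity, fun v S hv => ?_⟩
    rw [LinearMap.smul_apply, smul_eq_mul, abs_mul, mul_assoc]
    exact mul_le_mul_of_nonneg_left (hb v S hv) (abs_nonneg _)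

lemma apply_congr_of_mem_jetFunctionals {N : ℕ} {ℓ : (ℕ → ℝ) →ₗ[ℝ] ℝ} (hℓ : ℓ ∈ jetFunctionals N)
    {v v' : ℕ → ℝ} (hv : ∀ k < N, v k = v' k) : ℓ v = ℓ v' := by
  obtain ⟨C, -, hb⟩ := exists_bound_of_mem_jetFunctionals hℓ
  have hdiff := hb (v - v') 0 fun k hk => by rw [Pi.sub_apply, hv k hk, sub_self, abs_zero]
  rwa [mul_zero, abs_nonpos_iff, map_sub, sub_eq_zero] at hdiff

lemma sum_Icc_one {M : Type*} [AddCommMonoid M] (f : ℕ → M) (N : ℕ) :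
    ∑ i ∈ Finset.Icc 1 N, f i = ∑ i ∈ Finset.range N, f (i + 1) := by
  rw [Finset.range_eq_Ico, Finset.sum_Ico_add' f 0 N 1]
  rfl

namespace Plant

variable (P : Plant n m) (K : Fin n → ℝ)

/-- `invD` as a functional of the jet. -/
def invJ (k : ℕ) : (ℕ → ℝ) →ₗ[ℝ] ℝ :=
  LinearMap.proj k - ∑ j ∈ Finset.range k, P.psiD K j 0 • LinearMap.proj (k - 1 - j)

/-- The passage from the jet of `w` to the part of the jet of `u` that is local in `w`. -/
def invJets : (ℕ → ℝ) →ₗ[ℝ] (ℕ → ℝ) :=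
  LinearMap.pi (P.invJ K)

/-- `𝓑` as a functional of the jet that `invJets` produces at `x = 1`. -/
def traceB : (ℕ → ℝ) →ₗ[ℝ] ℝ :=
  ∑ k : Fin m, (P.a k * P.q ^ (k : ℕ)) • LinearMap.proj (2 * (k : ℕ) : ℕ)
    - P.q ^ m • ∑ i ∈ Finset.range (2 * m), P.phiD K i 0 • LinearMap.proj (2 * m - 1 - i)

/-- `𝓒` as a functional of the jet that `invJets` produces at `x = 0`. -/
def traceC : (ℕ → ℝ) →ₗ[ℝ] ℝ :=
  P.q ^ m • ∑ i ∈ Finset.range (2 * m), P.phiD K i 1 • LinearMap.proj (2 * m - 1 - i)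
    - ∑ i ∈ Finset.range m, ((P.PhiD K 0 1 ⬝ᵥ (P.A ^ i *ᵥ P.B)) * P.q ^ (m - 1 - i)) •
      LinearMap.proj (2 * (m - 1 - i) + 1)

/-- `𝓑` as a functional of the jet. -/
def jetB : (ℕ → ℝ) →ₗ[ℝ] ℝ :=
  P.traceB K ∘ₗ P.invJets K

/-- `𝓒` as a functional of the jet. -/
def jetC : (ℕ → ℝ) →ₗ[ℝ] ℝ :=
  P.traceC K ∘ₗ P.invJets K

/-- `𝓛` as a functional of the jet. -/
def jetL (c : ℕ → ℝ) (cm : ℝ) : (ℕ → ℝ) →ₗ[ℝ] ℝ :=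
  -P.jetB K - ∑ i ∈ Finset.range m, (P.q ^ i * (alpha m c i + cm * beta m c i)) •
    LinearMap.proj (2 * i)

lemma invJ_mem {k N : ℕ} (hk : k < N) : P.invJ K k ∈ jetFunctionals N :=
  sub_mem (proj_mem_jetFunctionals hk)
    (sum_mem fun _ _ => Submodule.smul_mem _ _ (proj_mem_jetFunctionals (by lia)))

lemma comp_invJets_mem {N : ℕ} {ℓ : (ℕ → ℝ) →ₗ[ℝ] ℝ} (hℓ : ℓ ∈ jetFunctionals N) :
    ℓ ∘ₗ P.invJets K ∈ jetFunctionals N := by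
  suffices jetFunctionals N ≤ (jetFunctionals N).comap (LinearMap.lcomp ℝ ℝ (P.invJets K)) from
    this hℓ
  refine Submodule.span_le.2 ?_
  rintro _ ⟨k, hk, rfl⟩
  exact P.invJ_mem K hk

lemma traceB_mem (hm : 1 ≤ m) : P.traceB K ∈ jetFunctionals (2 * m) :=
  sub_mem (sum_mem fun _ _ => Submodule.smul_mem _ _ (proj_mem_jetFunctionals (by lia)))
    (Submodule.smul_mem _ _
      (sum_mem fun _ _ => Submodule.smul_mem _ _ (proj_mem_jetFunctionals (by lia))))

lemma traceC_mem (hm : 1 ≤ m) : P.traceC K ∈ jetFunctionals (2 * m) :=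
  sub_mem (Submodule.smul_mem _ _
      (sum_mem fun _ _ => Submodule.smul_mem _ _ (proj_mem_jetFunctionals (by lia))))
    (sum_mem fun _ _ => Submodule.smul_mem _ _ (proj_mem_jetFunctionals (by lia)))

lemma jetB_mem (hm : 1 ≤ m) : P.jetB K ∈ jetFunctionals (2 * m) :=
  P.comp_invJets_mem K (P.traceB_mem K hm)

lemma jetC_mem (hm : 1 ≤ m) : P.jetC K ∈ jetFunctionals (2 * m) :=
  P.comp_invJets_mem K (P.traceC_mem K hm)

lemma jetL_mem (hm : 1 ≤ m) (c : ℕ → ℝ) (cm : ℝ) : P.jetL K c cm ∈ jetFunctionals (2 * m) :=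
  sub_mem (neg_mem (P.jetB_mem K hm)) (sum_mem fun i hi => Submodule.smul_mem _ _
    (proj_mem_jetFunctionals (by have := Finset.mem_range.1 hi; lia)))

lemma invD_eq (k : ℕ) (x₀ : ℝ) (f : ℝ → ℝ) (x : ℝ) :
    P.invD K k x₀ f x = P.invJ K k fun k => dx k f x := by
  simp only [invD, invJ, chi_eq, LinearMap.sub_apply, LinearMap.proj_apply, LinearMap.sum_apply,
    LinearMap.smul_apply, smul_eq_mul]
  refine congrArg₂ _ rfl (Finset.sum_congr rfl fun j hj => ?_)
  rw [if_pos (Finset.mem_range.1 hj), Nat.sub_right_comm]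

lemma dyPhi_signed (i : ℕ) (x y : ℝ) :
    (-1) ^ (i + 1) * P.dyPhi K i x y = -P.phiD K i (x - y) := by
  rw [dyPhi_eq, ← mul_assoc, ← pow_add, show i + 1 + i = 2 * i + 1 by ring, pow_succ, pow_mul,
    neg_one_sq, one_pow, one_mul, neg_one_mul]

lemma opB_eq (f : ℝ → ℝ) (x : ℝ) : P.opB K f x = P.jetB K fun k => dx k f x := by
  simp only [opB, jetB, traceB, invJets, LinearMap.comp_apply, LinearMap.pi_apply,
    LinearMap.proj_apply, invD_eq, sum_Icc_one, dyPhi_signed, LinearMap.sub_apply,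
    LinearMap.sum_apply, LinearMap.smul_apply, smul_eq_mul, sub_self, Nat.add_sub_cancel, neg_mul,
    Finset.sum_neg_distrib, mul_neg, ← sub_eq_add_neg, Nat.sub_sub, add_comm 1]

lemma opC_eq (f : ℝ → ℝ) (x : ℝ) : P.opC K f x = P.jetC K fun k => dx k f x := by
  simp only [opC, jetC, traceC, invJets, LinearMap.comp_apply, LinearMap.pi_apply,
    LinearMap.proj_apply, invD_eq, sum_Icc_one, dyPhi_signed, LinearMap.sub_apply,
    LinearMap.sum_apply, LinearMap.smul_apply, smul_eq_mul, sub_zero, Nat.add_sub_cancel, neg_mul,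
    Finset.sum_neg_distrib, mul_neg, neg_neg, Nat.sub_sub, add_comm 1, PhiD_zero]

lemma opL_eq (c : ℕ → ℝ) (cm : ℝ) (f : ℝ → ℝ) (x : ℝ) :
    P.opL K c cm f x = P.jetL K c cm fun k => dx k f x := by
  simp only [opL, jetL, opB_eq, LinearMap.sub_apply, LinearMap.neg_apply, LinearMap.sum_apply,
    LinearMap.smul_apply, LinearMap.proj_apply, smul_eq_mul]

end Plant

lemma dx_eq_of_hasDerivWithinAt {F : ℝ → ℝ} {f : ℕ → ℝ → ℝ} {N : ℕ}
    (h0 : ∀ x ∈ Icc (0 : ℝ) 1, F x = f 0 x)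
    (h : ∀ i < N, ∀ x ∈ Icc (0 : ℝ) 1, HasDerivWithinAt (f i) (f (i + 1) x) (Icc 0 1) x) {k : ℕ}
    (hk : k ≤ N) {x : ℝ} (hx : x ∈ Icc (0 : ℝ) 1) : dx k F x = f k x := by
  induction k generalizing x with
  | zero => rw [dx, iteratedDerivWithin_zero]; exact h0 x hx
  | succ k ih =>
    have hderiv := (h k (by lia) x hx).congr (fun y hy => ih (by lia) hy) (ih (by lia) hx)
    rw [dx, iteratedDerivWithin_succ]
    exact hderiv.derivWithin (uniqueDiffOn_Icc zero_lt_one x hx)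

lemma Plant.dx_Phi (P : Plant n m) (K : Fin n → ℝ) (k : ℕ) (j : Fin n) {x : ℝ}
    (hx : x ∈ Icc (0 : ℝ) 1) : dx k (fun x => P.Phi K x j) x = P.PhiD K k x j :=
  dx_eq_of_hasDerivWithinAt (f := fun k x => P.PhiD K k x j) (fun x _ => by rw [PhiD_zero])
    (fun i _ x _ => (hasDerivAt_pi.1 (P.hasDerivAt_PhiD K i x) j).hasDerivWithinAt) le_rfl hx

namespace Plant.IsReduced

variable {P : Plant n m} (K : Fin n → ℝ) {N : ℕ} {g : ℕ → ℝ → ℝ → ℝ} {X : ℝ → Fin n → ℝ}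

lemma dx_volt (h : P.IsReduced N g X) (hq : P.q ≠ 0) {t : ℝ} (ht : 0 ≤ t) {f : ℝ → ℝ}
    (hf : ∀ x ∈ Icc (0 : ℝ) 1, f x = g 0 x t) {k : ℕ} (hk : k ≤ N) {x : ℝ}
    (hx : x ∈ Icc (0 : ℝ) 1) :
    dx k (P.volt K f) x = g k x t - P.wJet K g X k x t - P.PhiD K k x ⬝ᵥ X t := by
  refine dx_eq_of_hasDerivWithinAt (N := N)
    (f := fun k x => g k x t - P.wJet K g X k x t - P.PhiD K k x ⬝ᵥ X t) (fun x hx => ?_)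
    (fun i hi x hx => ((h.jet.space i hi t ht x hx).sub
      ((h.heatJet_wJet K hq).space i hi t ht x hx)).sub
        (hasDerivAt_dotProduct_const (P.hasDerivAt_PhiD K i x) (X t)).hasDerivWithinAt) hk hx
  have hvolt : P.volt K f x = conv (P.phiD K 0) (fun y => g 0 y t) x := by
    rw [← conv_congr_right hx.1 fun y hy => hf y ⟨hy.1, hy.2.trans hx.2⟩]
    simp only [volt, conv, phi_eq]
  simp only [hvolt, wJet, transJet_zero]
  ring

lemma apply_wJet (h : P.IsReduced N g X) (hq : P.q ≠ 0) {t : ℝ} (ht : 0 ≤ t) {f : ℝ → ℝ}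
    (hf : ∀ x ∈ Icc (0 : ℝ) 1, f x = g 0 x t) {ℓ : (ℕ → ℝ) →ₗ[ℝ] ℝ}
    (hℓ : ℓ ∈ jetFunctionals (N + 1)) {x : ℝ} (hx : x ∈ Icc (0 : ℝ) 1) :
    ℓ (fun k => P.wJet K g X k x t) = ℓ (fun k => dx k f x)
      - (fun j => ℓ fun k => dx k (fun x => P.Phi K x j) x) ⬝ᵥ X t
      - ℓ (fun k => dx k (P.volt K f) x) := by
  have hdot : (fun j => ℓ fun k => dx k (fun x => P.Phi K x j) x) ⬝ᵥ X t
      = ℓ fun k => P.PhiD K k x ⬝ᵥ X t := by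
    have hsum : (fun k => P.PhiD K k x ⬝ᵥ X t) = ∑ j, X t j • fun k => P.PhiD K k x j := by
      ext k
      simp only [dotProduct, Finset.sum_apply, Pi.smul_apply, smul_eq_mul, mul_comm (X t _)]
    rw [hsum, map_sum]
    simp only [map_smul, P.dx_Phi K _ _ hx, dotProduct, smul_eq_mul, mul_comm (X t _)]
  rw [hdot, ← map_sub, ← map_sub]
  refine apply_congr_of_mem_jetFunctionals hℓ fun k hk => ?_
  have hk : k ≤ N := by lia
  have hu : dx k f x = g k x t := dx_eq_of_hasDerivWithinAt (f := fun k x => g k x t) hf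
    (fun i hi x hx => h.jet.space i hi t ht x hx) hk hx
  simp only [Pi.sub_apply, hu, h.dx_volt K hq ht hf hk hx]
  ring

lemma feedback_eq (h : P.IsReduced (2 * m - 1) g X) (hq : P.q ≠ 0) (hm : 1 ≤ m) (c : ℕ → ℝ)
    (cm : ℝ) {t : ℝ} (ht : 0 ≤ t) {f : ℝ → ℝ} (hf : ∀ x ∈ Icc (0 : ℝ) 1, f x = g 0 x t) :
    P.feedback K c cm f (X t) = P.jetL K c cm (fun k => P.wJet K g X k 1 t)
      - P.jetC K (fun k => P.wJet K g X k 0 t) := by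
  have hN : 2 * m - 1 + 1 = 2 * m := by lia
  have hgain : (fun j => P.opL K c cm (fun x => P.Phi K x j) 1 - P.opC K (fun x => P.Phi K x j) 0)
      = (fun j => P.jetL K c cm fun k => dx k (fun x => P.Phi K x j) 1)
        - fun j => P.jetC K fun k => dx k (fun x => P.Phi K x j) 0 := by
    funext j
    rw [opL_eq, opC_eq, Pi.sub_apply]
  rw [feedback, hgain, sub_dotProduct, opL_eq, opC_eq, opL_eq, opC_eq,
    h.apply_wJet K hq ht hf (hN ▸ P.jetL_mem K hm c cm) unitInterval.one_mem,
    h.apply_wJet K hq ht hf (hN ▸ P.jetC_mem K hm) unitInterval.zero_mem]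
  ring

end Plant.IsReduced

/-! ### The boundary values of the backstepping variable -/

lemma conv_eq_mul_integral_add_conv {k k' f : ℝ → ℝ} (hk : ∀ x, HasDerivAt k (k' x) x)
    (hk' : Continuous k') (hf : Continuous f) {x : ℝ} (hx : 0 ≤ x) :
    conv k f x = k 0 * (∫ y in (0 : ℝ)..x, f y) + conv k' (fun y => ∫ z in (0 : ℝ)..y, f z) x := by
  have hprimitive : Continuous fun y => ∫ z in (0 : ℝ)..y, f z :=
    intervalIntegral.continuous_primitive (fun _ _ => hf.intervalIntegrable _ _) 0
  rw [conv_deriv hk hk' hf hprimitive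
    (fun y _ => hasDerivWithinAt_integral_right hf 0 y (Icc 0 x)) (right_mem_Icc.2 hx),
    intervalIntegral.integral_same, mul_zero, sub_zero]

lemma conv_deriv_sub_left {k k' k'' f f' : ℝ → ℝ} (hk : ∀ x, HasDerivAt k (k' x) x)
    (hk' : ∀ x, HasDerivAt k' (k'' x) x) (hk'' : Continuous k'') (hf' : Continuous f')
    (hfc : Continuous f) {x : ℝ} (hx : 0 ≤ x)
    (hf : ∀ y ∈ Icc 0 x, HasDerivWithinAt f (f' y) (Icc 0 x) y) :
    conv k' (fun y => f' y - f' 0) x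
      = k' 0 * f x - k' x * f 0 + conv k'' f x - (k x - k 0) * f' 0 := by
  have hk'c : Continuous k' := continuous_iff_continuousAt.2 fun y => (hk' y).continuousAt
  have hconst : conv k' (fun _ => 1 * f' 0) x = (k x - k 0) * f' 0 := by
    rw [conv_mul_const, conv_comm, one_conv, intervalIntegral.integral_eq_sub_of_hasDerivAt
      (fun y _ => hk y) (hk'c.intervalIntegrable _ _)]
  simp only [one_mul] at hconst
  rw [conv_sub hk'c hf' continuous_const, hconst,
    conv_deriv hk' hk'' hf' hfc hf (right_mem_Icc.2 hx)]

-- Only the flux form of the equation is available for `g 0`, so one derivative is first moved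
-- onto the kernel; the flux at `0` that this produces cancels except for its boundary part.
lemma HeatJet.hasDerivWithinAt_conv_one {q : ℝ} {N : ℕ} {g : ℕ → ℝ → ℝ → ℝ} (hg : HeatJet q N g)
    (hN : 1 ≤ N) {k k' k'' : ℝ → ℝ} (hk : ∀ x, HasDerivAt k (k' x) x)
    (hk' : ∀ x, HasDerivAt k' (k'' x) x) (hk'' : Continuous k'') {t : ℝ} (ht : 0 ≤ t) :
    HasDerivWithinAt (fun t => conv k (fun y => g 0 y t) 1)
      (q * (conv k'' (fun y => g 0 y t) 1 + (k 0 * g 1 1 t - k 1 * g 1 0 t)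
        + (k' 0 * g 0 1 t - k' 1 * g 0 0 t))) (Ici 0) t := by
  have hk'c : Continuous k' := continuous_iff_continuousAt.2 fun x => (hk' x).continuousAt
  have hg0 := continuous_uncurry_right (hg.cont 0 (by lia))
  have hg1 := hg.cont 1 hN
  have hparts s := conv_eq_mul_integral_add_conv hk hk'c (hg0 s) zero_le_one
  have hconv := hasDerivWithinAt_conv_param (k := k') (F := fun x s => ∫ y in (0 : ℝ)..x, g 0 y s)
    (F' := fun x s => q * (g 1 x s - g 1 0 s)) zero_le_one ordConnected_Ici hk'c
    (fun s => intervalIntegral.continuous_primitive (fun _ _ => (hg0 s).intervalIntegrable _ _) 0)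
    (continuous_const.mul (hg1.sub (hg1.comp (continuous_const.prodMk continuous_snd))))
    (fun y hy s hs => hg.flux y hy s hs) ht
  refine ((((hg.flux 1 unitInterval.one_mem t ht).const_mul (k 0)).add hconv).congr
    (fun s _ => hparts s) (hparts t)).congr_deriv ?_
  rw [conv_const_mul, conv_deriv_sub_left (f := fun y => g 0 y t) hk hk' hk''
    (continuous_uncurry_right hg1 t) (hg0 t) zero_le_one fun x hx => hg.space 0 (by lia) t ht x hx]
  ring

namespace Plant

variable (P : Plant n m) (K : Fin n → ℝ)

/-- The `k`-th time derivative of `Φ(1) X`. -/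
def tX (g : ℕ → ℝ → ℝ → ℝ) (X : ℝ → Fin n → ℝ) (k : ℕ) (t : ℝ) : ℝ :=
  P.PhiD K 0 1 ⬝ᵥ (P.A ^ k *ᵥ X t) + ∑ i ∈ Finset.range k,
    (P.PhiD K 0 1 ⬝ᵥ (P.A ^ i *ᵥ P.B)) * P.q ^ (k - 1 - i) * g (2 * (k - 1 - i) + 1) 0 t

/-- The `k`-th time derivative of `∫₀¹ φ(1,y) u(y) dy`, with the `x`-derivatives of `u` moved onto
the kernel. -/
def tV (g : ℕ → ℝ → ℝ → ℝ) (k : ℕ) (t : ℝ) : ℝ :=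
  P.q ^ k * (conv (P.phiD K (2 * k)) (fun y => g 0 y t) 1 + ∑ i ∈ Finset.range (2 * k),
    (P.phiD K i 0 * g (2 * k - 1 - i) 1 t - P.phiD K i 1 * g (2 * k - 1 - i) 0 t))

/-- The part of the jet of `u` that depends on `w` and `X` only through an integral of `w` and
through `X` itself, with the sign changed. -/
def nonlocalJet (w : ℝ → ℝ) (ξ : Fin n → ℝ) (x : ℝ) (k : ℕ) : ℝ :=
  conv (P.psiD K k) w x + P.GamD K k x ⬝ᵥ ξ

/-- What the feedback law leaves of the equation for `∂_t^m w(1,t)`: a functional of `w` and `X`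
that involves no derivative of `w`. -/
def remainder (w : ℝ → ℝ) (ξ : Fin n → ℝ) : ℝ :=
  -P.traceB K (P.nonlocalJet K w ξ 1) - P.traceC K (P.nonlocalJet K w ξ 0)
    - P.q ^ m * conv (P.phiD K (2 * m)) (fun y => w y - P.nonlocalJet K w ξ y 0) 1
    - P.PhiD K 0 1 ⬝ᵥ (P.A ^ m *ᵥ ξ)

lemma tV_add_tX (g : ℕ → ℝ → ℝ → ℝ) (X : ℝ → Fin n → ℝ) (t : ℝ) :
    P.tV K g m t + P.tX K g X m t
      = (∑ k : Fin m, P.a k * P.q ^ (k : ℕ) * g (2 * k) 1 t) - P.traceB K (fun k => g k 1 t)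
        - P.traceC K (fun k => g k 0 t)
        + P.q ^ m * conv (P.phiD K (2 * m)) (fun y => g 0 y t) 1
        + P.PhiD K 0 1 ⬝ᵥ (P.A ^ m *ᵥ X t) := by
  simp only [tV, tX, traceB, traceC, LinearMap.sub_apply, LinearMap.sum_apply, LinearMap.smul_apply,
    LinearMap.proj_apply, smul_eq_mul, Finset.sum_sub_distrib]
  ring

variable {P} {N : ℕ} {g : ℕ → ℝ → ℝ → ℝ} {X : ℝ → Fin n → ℝ}

namespace IsReduced

lemma hasDerivWithinAt_tX (h : P.IsReduced N g X) (hq : 0 < P.q) {k : ℕ} (hk : 2 * k + 1 ≤ N)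
    {t : ℝ} (ht : 0 ≤ t) :
    HasDerivWithinAt (P.tX K g X k) (P.tX K g X (k + 1) t) (Ici 0) t := by
  have hstate : HasDerivWithinAt (fun t => P.PhiD K 0 1 ⬝ᵥ (P.A ^ k *ᵥ X t))
      (P.PhiD K 0 1 ⬝ᵥ (P.A ^ k *ᵥ (P.A *ᵥ X t + g 1 0 t • P.B))) (Ici 0) t := by
    simp only [Matrix.dotProduct_mulVec, dotProduct_comm (P.PhiD K 0 1 ᵥ* P.A ^ k)]
    exact hasDerivWithinAt_dotProduct_const (h.odeX t ht) _
  have hsum : HasDerivWithinAt (fun t => ∑ i ∈ Finset.range k,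
      (P.PhiD K 0 1 ⬝ᵥ (P.A ^ i *ᵥ P.B)) * P.q ^ (k - 1 - i) * g (2 * (k - 1 - i) + 1) 0 t)
      (∑ i ∈ Finset.range k, (P.PhiD K 0 1 ⬝ᵥ (P.A ^ i *ᵥ P.B)) * P.q ^ (k - i)
        * g (2 * (k - i) + 1) 0 t) (Ici 0) t := by
    refine HasDerivWithinAt.fun_sum fun i hi => ?_
    obtain ⟨j, rfl⟩ := Nat.exists_eq_add_of_lt (Finset.mem_range.1 hi)
    refine ((h.jet.time hq (i := 2 * (i + j + 1 - 1 - i) + 1) (by lia) ht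
      unitInterval.zero_mem).const_mul _).congr_deriv ?_
    rw [show i + j + 1 - 1 - i = j by lia, show i + j + 1 - i = j + 1 by lia, pow_succ,
      show 2 * (j + 1) + 1 = 2 * j + 1 + 2 by ring]
    ring
  refine (hstate.add hsum).congr_deriv ?_
  rw [tX, Finset.sum_range_succ]
  simp only [Nat.add_sub_cancel, Nat.sub_self, pow_zero, mul_zero, zero_add, mul_one,
    Matrix.mulVec_add, Matrix.mulVec_mulVec, Matrix.mulVec_smul, dotProduct_add, dotProduct_smul,
    smul_eq_mul, pow_succ]
  ring

lemma hasDerivWithinAt_tV (h : P.IsReduced N g X) (hq : 0 < P.q) {k : ℕ} (hk : 2 * k + 1 ≤ N)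
    {t : ℝ} (ht : 0 ≤ t) :
    HasDerivWithinAt (P.tV K g k) (P.tV K g (k + 1) t) (Ici 0) t := by
  have hconv := h.jet.hasDerivWithinAt_conv_one h.one_le (P.hasDerivAt_phiD K (2 * k))
    (P.hasDerivAt_phiD K (2 * k + 1)) (P.continuous_phiD K (2 * k + 2)) ht
  have hsum : HasDerivWithinAt (fun t => ∑ i ∈ Finset.range (2 * k),
      (P.phiD K i 0 * g (2 * k - 1 - i) 1 t - P.phiD K i 1 * g (2 * k - 1 - i) 0 t))
      (∑ i ∈ Finset.range (2 * k), P.q *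
        (P.phiD K i 0 * g (2 * k + 1 - i) 1 t - P.phiD K i 1 * g (2 * k + 1 - i) 0 t))
      (Ici 0) t := by
    refine HasDerivWithinAt.fun_sum fun i hi => ?_
    have hi := Finset.mem_range.1 hi
    have hone := (h.jet.time hq (i := 2 * k - 1 - i) (by lia) ht
      unitInterval.one_mem).const_mul (P.phiD K i 0)
    have hzero := (h.jet.time hq (i := 2 * k - 1 - i) (by lia) ht
      unitInterval.zero_mem).const_mul (P.phiD K i 1)
    rw [show 2 * k - 1 - i + 2 = 2 * k + 1 - i by lia] at hone hzero
    exact (hone.sub hzero).congr_deriv (by ring)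
  refine ((hconv.add hsum).const_mul (P.q ^ k)).congr_deriv ?_
  rw [tV, show 2 * (k + 1) = 2 * k + 1 + 1 by ring, Finset.sum_range_succ, Finset.sum_range_succ,
    pow_succ, ← Finset.mul_sum]
  simp only [Nat.add_sub_cancel, Nat.sub_self, Nat.add_sub_cancel_left]
  ring

lemma wJet_one_eq (h : P.IsReduced N g X) (hq : 0 < P.q) {k : ℕ} (hk : 2 * k ≤ N) {t : ℝ}
    (ht : 0 ≤ t) :
    P.q ^ k * P.wJet K g X (2 * k) 1 t
      = P.q ^ k * g (2 * k) 1 t - P.tV K g k t - P.tX K g X k t := by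
  induction k generalizing t with
  | zero => simp [wJet, transJet, tV, tX]
  | succ k ih =>
    have hw := ((h.heatJet_wJet K hq.ne').time hq (i := 2 * k) (by lia) ht
      unitInterval.one_mem).const_mul (P.q ^ k)
    have hu := ((((h.jet.time hq (i := 2 * k) (by lia) ht
      unitInterval.one_mem).const_mul (P.q ^ k)).sub
      (h.hasDerivWithinAt_tV K hq (k := k) (by lia) ht)).sub
      (h.hasDerivWithinAt_tX K hq (k := k) (by lia) ht)).congr
      (fun s hs => ih (by lia) hs) (ih (by lia) ht)
    have hderiv := (uniqueDiffOn_Ici (0 : ℝ) t ht).eq_deriv _ hw hu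
    rw [show 2 * (k + 1) = 2 * k + 2 by ring, pow_succ, mul_assoc, hderiv]
    ring

lemma invJ_wJet (h : P.IsReduced N g X) (hq : P.q ≠ 0) {k : ℕ} (hk : k ≤ N) {t : ℝ} (ht : 0 ≤ t)
    {x : ℝ} (hx : x ∈ Icc (0 : ℝ) 1) :
    P.invJ K k (fun k => P.wJet K g X k x t)
      = g k x t + P.nonlocalJet K (fun y => P.wJet K g X 0 y t) (X t) x k := by
  rw [← h.transJet_wJet K hq hk ht hx]
  simp only [invJ, nonlocalJet, transJet, LinearMap.sub_apply, LinearMap.proj_apply,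
    LinearMap.sum_apply, LinearMap.smul_apply, smul_eq_mul]
  ring

lemma apply_invJets_wJet (h : P.IsReduced N g X) (hq : P.q ≠ 0) {ℓ : (ℕ → ℝ) →ₗ[ℝ] ℝ}
    (hℓ : ℓ ∈ jetFunctionals (N + 1)) {t : ℝ} (ht : 0 ≤ t) {x : ℝ} (hx : x ∈ Icc (0 : ℝ) 1) :
    ℓ (P.invJets K fun k => P.wJet K g X k x t) = ℓ (fun k => g k x t)
      + ℓ (P.nonlocalJet K (fun y => P.wJet K g X 0 y t) (X t) x) := by
  rw [← map_add]
  exact apply_congr_of_mem_jetFunctionals hℓ fun k hk =>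
    h.invJ_wJet K hq (Nat.lt_succ_iff.1 hk) ht hx

lemma wJet_sub_nonlocalJet (h : P.IsReduced N g X) (hq : P.q ≠ 0) {t : ℝ} (ht : 0 ≤ t) {x : ℝ}
    (hx : x ∈ Icc (0 : ℝ) 1) :
    P.wJet K g X 0 x t - P.nonlocalJet K (fun y => P.wJet K g X 0 y t) (X t) x 0 = g 0 x t := by
  have hinv := h.invJ_wJet K hq (k := 0) (by lia) ht hx
  simp only [invJ, Finset.range_zero, Finset.sum_empty, sub_zero, LinearMap.proj_apply] at hinv
  rw [hinv, add_sub_cancel_right]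

lemma boundary_identity (h : P.IsReduced (2 * m - 1) g X) (hm : 1 ≤ m) (hq : P.q ≠ 0) {t : ℝ}
    (ht : 0 ≤ t) :
    (∑ k : Fin m, P.a k * P.q ^ (k : ℕ) * g (2 * k) 1 t) - P.tV K g m t - P.tX K g X m t
      - P.jetB K (fun k => P.wJet K g X k 1 t) - P.jetC K (fun k => P.wJet K g X k 0 t)
      = P.remainder K (fun y => P.wJet K g X 0 y t) (X t) := by
  have hN : 2 * m - 1 + 1 = 2 * m := by lia
  have hconv := conv_congr_right (k := P.phiD K (2 * m)) zero_le_one fun y hy =>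
    h.wJet_sub_nonlocalJet K hq ht hy
  rw [sub_sub _ (P.tV K g m t), tV_add_tX, jetB, jetC, LinearMap.comp_apply, LinearMap.comp_apply,
    h.apply_invJets_wJet K hq (hN ▸ P.traceB_mem K hm) ht unitInterval.one_mem,
    h.apply_invJets_wJet K hq (hN ▸ P.traceC_mem K hm) ht unitInterval.zero_mem, remainder, hconv]
  ring

end IsReduced

end Plant

/-! ### The virtual controls -/

lemma tau_coeff_eq_zero (c : ℕ → ℝ) {i j : ℕ} (hij : i ≤ j) : (tau c i).coeff j = 0 := by
  induction i using Nat.strong_induction_on generalizing j with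
  | _ i ih =>
    match i with
    | 0 => rw [tau, Polynomial.coeff_zero]
    | 1 => rw [tau, Polynomial.coeff_C_of_ne_zero (by lia)]
    | i + 2 =>
      obtain ⟨j, rfl⟩ := Nat.exists_eq_add_of_lt (show 0 < j by lia)
      simp only [tau, Polynomial.coeff_add, zero_add, Polynomial.coeff_X_mul,
        Polynomial.coeff_C_mul, Polynomial.coeff_X_pow, ih (i + 1) (by lia) (j := j) (by lia),
        ih i (by lia) (j := j + 1) (by lia), ih (i + 1) (by lia) (j := j + 1) (by lia)]
      rw [if_neg (by lia), if_neg (by lia)]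
      ring

lemma X_mul_yPoly (c : ℕ → ℝ) (i : ℕ) :
    Polynomial.X * yPoly c (i + 1)
      = yPoly c (i + 2) - yPoly c i - Polynomial.C (c (i + 1)) * yPoly c (i + 1) := by
  match i with
  | 0 => simp [yPoly, tau]
  | i + 1 =>
    simp only [yPoly, tau]
    ring

lemma yPoly_succ_coeff (c : ℕ → ℝ) {i j : ℕ} (hij : i ≤ j) :
    (yPoly c (i + 1)).coeff j = if i = j then 1 else 0 := by
  rw [yPoly, Polynomial.coeff_add, Polynomial.coeff_X_pow, tau_coeff_eq_zero c hij, add_zero]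
  simp only [eq_comm]

/-- `p(∂_t)` applied to a function with time derivatives `η`, truncated at the order `N`. -/
def evP (N : ℕ) (p : Polynomial ℝ) (η : ℕ → ℝ) : ℝ := ∑ j ∈ Finset.range N, p.coeff j * η j

section EvP

variable {N : ℕ}

lemma evP_add (p p' : Polynomial ℝ) (η : ℕ → ℝ) : evP N (p + p') η = evP N p η + evP N p' η := by
  simp only [evP, Polynomial.coeff_add, add_mul, Finset.sum_add_distrib]

lemma evP_sub (p p' : Polynomial ℝ) (η : ℕ → ℝ) : evP N (p - p') η = evP N p η - evP N p' η := by
  simp only [evP, Polynomial.coeff_sub, sub_mul, Finset.sum_sub_distrib]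

lemma evP_C_mul (a : ℝ) (p : Polynomial ℝ) (η : ℕ → ℝ) :
    evP N (Polynomial.C a * p) η = a * evP N p η := by
  simp only [evP, Polynomial.coeff_C_mul, Finset.mul_sum, mul_assoc]

lemma evP_X_pow (k : ℕ) (η : ℕ → ℝ) : evP N (Polynomial.X ^ k) η = if k < N then η k else 0 := by
  simp only [evP, Polynomial.coeff_X_pow, ite_mul, one_mul, zero_mul, Finset.sum_ite_eq',
    Finset.mem_range]

lemma abs_evP_le (p : Polynomial ℝ) {η : ℕ → ℝ} {S : ℝ} (h : ∀ j < N, |η j| ≤ S) :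
    |evP N p η| ≤ (∑ j ∈ Finset.range N, |p.coeff j|) * S := by
  rw [Finset.sum_mul]
  refine (Finset.abs_sum_le_sum_abs _ _).trans (Finset.sum_le_sum fun j hj => ?_)
  rw [abs_mul]
  exact mul_le_mul_of_nonneg_left (h j (Finset.mem_range.1 hj)) (abs_nonneg _)

lemma evP_eq_of_coeff_eq_zero {p : Polynomial ℝ} {k : ℕ} (hk : k ≤ N)
    (hp : ∀ j, k ≤ j → p.coeff j = 0) (η : ℕ → ℝ) : evP N p η = evP k p η :=
  (Finset.sum_subset (Finset.range_mono hk) fun j _ hj => by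
    rw [hp j (not_lt.1 (mt Finset.mem_range.2 hj)), zero_mul]).symm

lemma hasDerivWithinAt_evP {η : ℕ → ℝ → ℝ} {t : ℝ} {s : Set ℝ}
    (h : ∀ j < N + 1, HasDerivWithinAt (η j) (η (j + 1) t) s t) (p : Polynomial ℝ) :
    HasDerivWithinAt (fun t => evP (N + 1) p fun j => η j t)
      (evP (N + 1) (Polynomial.X * p) (fun j => η j t) + p.coeff N * η (N + 1) t) s t := by
  have hsum : HasDerivWithinAt (fun t => evP (N + 1) p fun j => η j t)
      (∑ j ∈ Finset.range (N + 1), p.coeff j * η (j + 1) t) s t :=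
    HasDerivWithinAt.fun_sum fun j hj => (h j (Finset.mem_range.1 hj)).const_mul _
  refine hsum.congr_deriv ?_
  rw [Finset.sum_range_succ, evP, Finset.sum_range_succ']
  simp only [Polynomial.coeff_X_mul, Polynomial.coeff_X_mul_zero, zero_mul, add_zero]

end EvP

lemma evP_yPoly_succ (c : ℕ → ℝ) {j N : ℕ} (hj : j < N) (η : ℕ → ℝ) :
    evP N (yPoly c (j + 1)) η = η j + evP j (tau c j) η := by
  rw [yPoly, evP_add, evP_X_pow, if_pos hj,
    evP_eq_of_coeff_eq_zero hj.le fun _ => tau_coeff_eq_zero c]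

lemma exists_bound_of_yPoly (c : ℕ → ℝ) (N : ℕ) :
    ∃ C : ℝ, 0 ≤ C ∧ ∀ (η : ℕ → ℝ) (S : ℝ), 0 ≤ S →
      (∀ j < N, |η j + evP j (tau c j) η| ≤ S) → ∀ j < N, |η j| ≤ C * S := by
  induction N with
  | zero => exact ⟨0, le_rfl, fun _ _ _ _ j hj => absurd hj (Nat.not_lt_zero j)⟩
  | succ J ih =>
    obtain ⟨C, hC, hbound⟩ := ih
    set A := ∑ l ∈ Finset.range J, |(tau c J).coeff l|
    have hA : 0 ≤ A := Finset.sum_nonneg fun _ _ => abs_nonneg _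
    refine ⟨C + (1 + A * C), by positivity, fun η S hS h j hj => ?_⟩
    have hlower := hbound η S hS fun j hj => h j (by lia)
    have htau : |evP J (tau c J) η| ≤ A * (C * S) := abs_evP_le _ hlower
    have hCS : 0 ≤ C * S := by positivity
    have hAC : 0 ≤ A * C * S := by positivity
    rw [add_mul, add_mul, one_mul, mul_assoc A]
    rcases Nat.lt_succ_iff_lt_or_eq.1 hj with hj | rfl
    · linarith [hlower j hj]
    · have hlast := abs_sub (η j + evP j (tau c j) η) (evP j (tau c j) η)
      rw [add_sub_cancel_right] at hlast
      linarith [h j hj]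

/-! ### The target system -/

lemma abs_dotProduct_le (v ξ : Fin n → ℝ) : |v ⬝ᵥ ξ| ≤ (∑ i, |v i|) * ‖ξ‖ := by
  rw [Finset.sum_mul]
  refine (Finset.abs_sum_le_sum_abs _ _).trans (Finset.sum_le_sum fun i _ => ?_)
  rw [abs_mul]
  exact mul_le_mul_of_nonneg_left (norm_le_pi_norm ξ i) (abs_nonneg _)

namespace Plant

section Remainder

variable (P : Plant n m) (K : Fin n → ℝ)

lemma exists_bound_nonlocalJet (k : ℕ) :
    ∃ C : ℝ, 0 ≤ C ∧ ∀ (w : ℝ → ℝ) (ξ : Fin n → ℝ) (S : ℝ),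
      (∀ x ∈ Icc (0 : ℝ) 1, |w x| ≤ S) → ‖ξ‖ ≤ S → ∀ x ∈ Icc (0 : ℝ) 1,
        |P.nonlocalJet K w ξ x k| ≤ C * S := by
  have hGam : Continuous fun x => ∑ i, |P.GamD K k x i| :=
    continuous_finsetSum _ fun i _ => ((continuous_apply i).comp (P.continuous_GamD K k)).abs
  obtain ⟨C₁, hC₁⟩ := isCompact_Icc.exists_bound_of_continuousOn
    (P.continuous_psiD K k).continuousOn (s := Icc (0 : ℝ) 1)
  obtain ⟨C₂, hC₂⟩ := isCompact_Icc.exists_bound_of_continuousOn hGam.continuousOn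
    (s := Icc (0 : ℝ) 1)
  have hC₁0 : 0 ≤ C₁ := (norm_nonneg _).trans (hC₁ 0 unitInterval.zero_mem)
  have hC₂0 : 0 ≤ C₂ := (norm_nonneg _).trans (hC₂ 0 unitInterval.zero_mem)
  refine ⟨C₁ + C₂, add_nonneg hC₁0 hC₂0, fun w ξ S hw hξ x hx => ?_⟩
  rw [nonlocalJet, add_mul]
  refine (abs_add_le _ _).trans (add_le_add (abs_conv_le hx (fun y hy => hC₁ y hy) hw) ?_)
  exact (abs_dotProduct_le _ _).trans
    (mul_le_mul ((le_abs_self _).trans (hC₂ x hx)) hξ (norm_nonneg _) hC₂0)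

lemma exists_bound_apply_nonlocalJet {N : ℕ} {ℓ : (ℕ → ℝ) →ₗ[ℝ] ℝ} (hℓ : ℓ ∈ jetFunctionals N) :
    ∃ C : ℝ, 0 ≤ C ∧ ∀ (w : ℝ → ℝ) (ξ : Fin n → ℝ) (S : ℝ),
      (∀ x ∈ Icc (0 : ℝ) 1, |w x| ≤ S) → ‖ξ‖ ≤ S → ∀ x ∈ Icc (0 : ℝ) 1,
        |ℓ (P.nonlocalJet K w ξ x)| ≤ C * S := by
  obtain ⟨C, hC, hbound⟩ := exists_bound_of_mem_jetFunctionals hℓ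
  choose D hD hjet using P.exists_bound_nonlocalJet K
  refine ⟨C * ∑ k ∈ Finset.range N, D k, mul_nonneg hC (Finset.sum_nonneg fun k _ => hD k),
    fun w ξ S hw hξ x hx => ?_⟩
  rw [mul_assoc]
  refine hbound _ _ fun k hk => (hjet k w ξ S hw hξ x hx).trans ?_
  exact mul_le_mul_of_nonneg_right (Finset.single_le_sum (fun k _ => hD k) (Finset.mem_range.2 hk))
    ((norm_nonneg ξ).trans hξ)

lemma exists_bound_conv_sub_nonlocalJet {k : ℝ → ℝ} (hk : Continuous k) :
    ∃ C : ℝ, 0 ≤ C ∧ ∀ (w : ℝ → ℝ) (ξ : Fin n → ℝ) (S : ℝ),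
      (∀ x ∈ Icc (0 : ℝ) 1, |w x| ≤ S) → ‖ξ‖ ≤ S →
        |conv k (fun y => w y - P.nonlocalJet K w ξ y 0) 1| ≤ C * S := by
  obtain ⟨D, hD, hjet⟩ := P.exists_bound_nonlocalJet K 0
  obtain ⟨C, hC⟩ := isCompact_Icc.exists_bound_of_continuousOn hk.continuousOn
    (s := Icc (0 : ℝ) 1)
  have hC0 : 0 ≤ C := (norm_nonneg _).trans (hC 0 unitInterval.zero_mem)
  refine ⟨C * (1 + D), by positivity, fun w ξ S hw hξ => ?_⟩
  rw [mul_assoc]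
  refine abs_conv_le unitInterval.one_mem (fun y hy => hC y hy) fun y hy => ?_
  linarith [abs_sub (w y) (P.nonlocalJet K w ξ y 0), hw y hy, hjet w ξ S hw hξ y hy]

lemma exists_bound_remainder (hm : 1 ≤ m) :
    ∃ C : ℝ, 0 ≤ C ∧ ∀ (w : ℝ → ℝ) (ξ : Fin n → ℝ) (S : ℝ),
      (∀ x ∈ Icc (0 : ℝ) 1, |w x| ≤ S) → ‖ξ‖ ≤ S → |P.remainder K w ξ| ≤ C * S := by
  obtain ⟨C₁, hC₁, hB⟩ := P.exists_bound_apply_nonlocalJet K (P.traceB_mem K hm)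
  obtain ⟨C₀, hC₀, hC⟩ := P.exists_bound_apply_nonlocalJet K (P.traceC_mem K hm)
  obtain ⟨C₂, hC₂, hconv⟩ :=
    P.exists_bound_conv_sub_nonlocalJet K (P.continuous_phiD K (2 * m))
  set C₃ := ∑ i, |(P.PhiD K 0 1 ᵥ* P.A ^ m) i|
  have hC₃ : 0 ≤ C₃ := Finset.sum_nonneg fun _ _ => abs_nonneg _
  refine ⟨C₁ + C₀ + |P.q ^ m| * C₂ + C₃, by positivity, fun w ξ S hw hξ => ?_⟩
  have hstate : |P.PhiD K 0 1 ⬝ᵥ (P.A ^ m *ᵥ ξ)| ≤ C₃ * S := by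
    rw [Matrix.dotProduct_mulVec]
    exact (abs_dotProduct_le _ _).trans (mul_le_mul_of_nonneg_left hξ hC₃)
  simp only [remainder, add_mul]
  refine (abs_sub _ _).trans (add_le_add ((abs_sub _ _).trans (add_le_add
    ((abs_sub _ _).trans (add_le_add ?_ (hC w ξ S hw hξ 0 unitInterval.zero_mem))) ?_)) hstate)
  · rw [abs_neg]
    exact hB w ξ S hw hξ 1 unitInterval.one_mem
  · rw [abs_mul, mul_assoc]
    exact mul_le_mul_of_nonneg_left (hconv w ξ S hw hξ) (abs_nonneg _)

end Remainder

/-- The closed loop in terms of the jet `w` of the backstepping variable and the state `X`. The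
last field is the equation for `∂_t^{m-1} w(1,t) = q^{m-1} ∂ₓ^{2(m-1)} w(1,t)`. -/
structure IsTarget (P : Plant n m) (K : Fin n → ℝ) (c : ℕ → ℝ) (cm : ℝ) (w : ℕ → ℝ → ℝ → ℝ)
    (X : ℝ → Fin n → ℝ) : Prop where
  jet : HeatJet P.q (2 * m - 1) w
  odeX : ∀ t, 0 ≤ t → HasDerivWithinAt X (P.AK K *ᵥ X t + w 1 0 t • P.B) (Ici 0) t
  left : ∀ t, 0 ≤ t → w 0 0 t = 0
  top : ∀ t, 0 ≤ t → HasDerivWithinAt (fun t => P.q ^ (m - 1) * w (2 * (m - 1)) 1 t)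
    (P.remainder K (fun x => w 0 x t) (X t)
      - ∑ i ∈ Finset.range m, (alpha m c i + cm * beta m c i) * (P.q ^ i * w (2 * i) 1 t))
    (Ici 0) t

lemma Az_mulVec_of_lt (P : Plant n m) {i : ℕ} (hi : i + 1 < m) (z : Fin m → ℝ) :
    (P.Az *ᵥ z) ⟨i, by lia⟩ = z ⟨i + 1, hi⟩ := by
  have hne : i + 1 ≠ m := hi.ne
  rw [Matrix.mulVec, dotProduct, Finset.sum_eq_single ⟨i + 1, hi⟩ (fun j _ hj => ?_) (by simp)]
  · simp [Az, hne]
  · have hj' : (j : ℕ) ≠ i + 1 := fun h => hj (Fin.ext h)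
    simp [Az, hne, hj']

lemma Cz_dotProduct (hm : 0 < m) (z : Fin m → ℝ) : Cz m ⬝ᵥ z = z ⟨0, hm⟩ := by
  rw [dotProduct, Finset.sum_eq_single ⟨0, hm⟩ (fun j _ hj => ?_) (by simp)]
  · simp [Cz]
  · have hj' : (j : ℕ) ≠ 0 := fun h => hj (Fin.ext h)
    simp [Cz, hj']

namespace IsClosedLoopSolution

variable {P : Plant n m} {K : Fin n → ℝ} {c : ℕ → ℝ} {cm : ℝ} {u : ℝ → ℝ → ℝ}
  {X : ℝ → Fin n → ℝ} {Z : ℝ → Fin m → ℝ} {U : ℝ → ℝ}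

-- `X` is unconstrained at negative times; freezing it there makes it continuous on all of `ℝ`.
lemma isReduced (h : P.IsClosedLoopSolution K c cm u X Z U) (hm : 1 ≤ m) :
    P.IsReduced (2 * m - 1) (uJet u) fun t => X (max t 0) where
  one_le := by lia
  jet := h.heatJet hm
  contX := by
    have hX : ContinuousOn X (Ici 0) := fun t ht => (h.odeX t ht).continuousWithinAt
    exact hX.comp_continuous (by fun_prop) fun t => mem_Ici.2 (le_max_right _ _)
  odeX t ht := by
    have hX : ∀ s ∈ Ici (0 : ℝ), X (max s 0) = X s := fun s hs => by rw [max_eq_left hs]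
    refine ((h.odeX t ht).congr hX (hX t ht)).congr_deriv ?_
    rw [hX t ht, uJet_of_mem u 1 unitInterval.zero_mem ht]
  left t ht := by rw [uJet_zero u unitInterval.zero_mem ht, h.left t ht, max_eq_left ht]

lemma Z_eq (h : P.IsClosedLoopSolution K c cm u X Z U) (hq : 0 < P.q) {i : ℕ} (hi : i < m) {t : ℝ}
    (ht : 0 ≤ t) : Z t ⟨i, hi⟩ = P.q ^ i * uJet u (2 * i) 1 t := by
  induction i generalizing t with
  | zero =>
    rw [pow_zero, one_mul, mul_zero, uJet_zero u unitInterval.one_mem ht, h.right t ht,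
      Cz_dotProduct hi]
  | succ i ih =>
    have hZ := hasDerivWithinAt_pi.1 (h.odeZ t ht) ⟨i, by lia⟩
    have hu := (((h.heatJet (by lia)).time hq (i := 2 * i) (by lia) ht
      unitInterval.one_mem).const_mul (P.q ^ i)).congr (fun s hs => ih (by lia) hs) (ih (by lia) ht)
    have hne : i + 1 ≠ m := hi.ne
    have hderiv := (uniqueDiffOn_Ici (0 : ℝ) t ht).eq_deriv _ hZ hu
    simp only [Pi.add_apply, P.Az_mulVec_of_lt hi, Pi.smul_apply, Bz, hne, if_false, smul_zero,
      add_zero] at hderiv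
    rw [hderiv, show 2 * (i + 1) = 2 * i + 2 by ring, pow_succ, mul_assoc]

lemma hasDerivWithinAt_top (h : P.IsClosedLoopSolution K c cm u X Z U) (hm : 1 ≤ m) (hq : 0 < P.q)
    {t : ℝ} (ht : 0 ≤ t) :
    HasDerivWithinAt (fun t => P.q ^ (m - 1) * uJet u (2 * (m - 1)) 1 t)
      ((∑ k : Fin m, P.a k * P.q ^ (k : ℕ) * uJet u (2 * k) 1 t) + U t) (Ici 0) t := by
  have hlast : m - 1 < m := by lia
  have hZ := hasDerivWithinAt_pi.1 (h.odeZ t ht) ⟨m - 1, hlast⟩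
  refine (hZ.congr (fun s hs => (h.Z_eq hq hlast hs).symm)
    (h.Z_eq hq hlast ht).symm).congr_deriv ?_
  have hm' : m - 1 + 1 = m := by lia
  simp only [Pi.add_apply, Pi.smul_apply, Bz, hm', if_true, smul_eq_mul, mul_one, Matrix.mulVec,
    dotProduct, Az, fun k : Fin m => h.Z_eq hq k.2 ht, mul_assoc]

lemma control_eq (h : P.IsClosedLoopSolution K c cm u X Z U) (hm : 1 ≤ m) (hq : P.q ≠ 0) {t : ℝ}
    (ht : 0 ≤ t) :
    U t = P.jetL K c cm (fun k => P.wJet K (uJet u) (fun t => X (max t 0)) k 1 t)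
      - P.jetC K (fun k => P.wJet K (uJet u) (fun t => X (max t 0)) k 0 t) := by
  rw [← (h.isReduced hm).feedback_eq K hq hm c cm ht (f := fun x => u x t)
    (fun x hx => (uJet_zero u hx ht).symm), h.control t ht, max_eq_left ht]

lemma isTarget (h : P.IsClosedLoopSolution K c cm u X Z U) (hm : 1 ≤ m) (hq : 0 < P.q) :
    P.IsTarget K c cm (P.wJet K (uJet u) fun t => X (max t 0)) fun t => X (max t 0) where
  jet := (h.isReduced hm).heatJet_wJet K hq.ne'
  odeX _ ht := (h.isReduced hm).odeX_wJet K ht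
  left _ ht := (h.isReduced hm).wJet_zero_left K ht
  top t ht := by
    have hr := h.isReduced hm
    have hu := ((h.hasDerivWithinAt_top hm hq ht).sub
      (hr.hasDerivWithinAt_tV K hq (k := m - 1) (by lia) ht)).sub
      (hr.hasDerivWithinAt_tX K hq (k := m - 1) (by lia) ht)
    refine (hu.congr (fun s hs => hr.wJet_one_eq K hq (by lia) hs)
      (hr.wJet_one_eq K hq (by lia) ht)).congr_deriv ?_
    rw [h.control_eq hm hq.ne' ht, ← hr.boundary_identity K hm hq.ne' ht,
      show m - 1 + 1 = m by lia]
    simp only [jetL, LinearMap.sub_apply, LinearMap.neg_apply, LinearMap.sum_apply,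
      LinearMap.smul_apply, LinearMap.proj_apply, smul_eq_mul, mul_left_comm _ (P.q ^ _), mul_assoc]
    ring

end IsClosedLoopSolution

end Plant

/-! ### Decay of the target system -/

lemma HeatJet.abs_sub_le {q M t : ℝ} {N i : ℕ} {g : ℕ → ℝ → ℝ → ℝ} (hg : HeatJet q N g)
    (hi : i + 1 ≤ N) (ht : 0 ≤ t) (hM : ∀ x ∈ Icc (0 : ℝ) 1, |g (i + 1) x t| ≤ M)
    {x y : ℝ} (hx : x ∈ Icc (0 : ℝ) 1) (hy : y ∈ Icc (0 : ℝ) 1) :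
    |g i x t - g i y t| ≤ M * |x - y| :=
  (convex_Icc (0 : ℝ) 1).norm_image_sub_le_of_norm_hasDerivWithin_le
    (fun z hz => hg.space i (by lia) t ht z hz) hM hy hx

lemma exists_weighted_bound {f : ℝ → ℝ} (lam : ℝ) {T : ℝ} (hT : 0 ≤ T) (hf : Continuous f) :
    ∃ s ∈ Icc 0 T, ∀ t ∈ Icc 0 T, |f t| ≤ |f s| * Real.exp (lam * s) * Real.exp (-lam * t) := by
  obtain ⟨s, hs, hmax⟩ := isCompact_Icc.exists_isMaxOn (nonempty_Icc.2 hT)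
    (f := fun s => |f s| * Real.exp (lam * s)) (by fun_prop)
  refine ⟨s, hs, fun t ht => ?_⟩
  have hst : |f t| * Real.exp (lam * t) ≤ |f s| * Real.exp (lam * s) := hmax ht
  rw [neg_mul, Real.exp_neg]
  exact (le_mul_inv_iff₀ (Real.exp_pos _)).2 hst

namespace Plant

/-- The `k`-th time derivative of `w(1,·)` for `k ≤ m`, in terms of the state of the target
system. -/
def topDt (P : Plant n m) (K : Fin n → ℝ) (c : ℕ → ℝ) (cm : ℝ) (w : ℕ → ℝ → ℝ → ℝ)
    (X : ℝ → Fin n → ℝ) (k : ℕ) (t : ℝ) : ℝ :=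
  if k < m then P.q ^ k * w (2 * k) 1 t
  else P.remainder K (fun x => w 0 x t) (X t)
    - ∑ i ∈ Finset.range m, (alpha m c i + cm * beta m c i) * (P.q ^ i * w (2 * i) 1 t)

/-- The backstepping variable `y_i` of the boundary chain. -/
def chain (P : Plant n m) (K : Fin n → ℝ) (c : ℕ → ℝ) (cm : ℝ) (w : ℕ → ℝ → ℝ → ℝ)
    (X : ℝ → Fin n → ℝ) (i : ℕ) (t : ℝ) : ℝ :=
  evP m (yPoly c i) fun j => P.topDt K c cm w X j t

/-- `M` bounds the initial jet and the initial state of the target system. -/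
structure InitialBound (m : ℕ) (w : ℕ → ℝ → ℝ → ℝ) (X : ℝ → Fin n → ℝ) (M : ℝ) : Prop where
  jet : ∀ i < 2 * m, ∀ x ∈ Icc (0 : ℝ) 1, |w i x 0| ≤ M
  state : ‖X 0‖ ≤ M

lemma InitialBound.nonneg {w : ℕ → ℝ → ℝ → ℝ} {X : ℝ → Fin n → ℝ} {M : ℝ}
    (hM : InitialBound m w X M) : 0 ≤ M :=
  (norm_nonneg _).trans hM.state

/-- The remainder decays at the rate `lam`, with gain `C`, on every interval on which `w(1,·)`
does; `M` is the size of the initial data. -/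
def RemainderGain (P : Plant n m) (K : Fin n → ℝ) (w : ℕ → ℝ → ℝ → ℝ) (X : ℝ → Fin n → ℝ)
    (lam C M : ℝ) : Prop :=
  ∀ S T, M ≤ S → (∀ t ∈ Icc 0 T, |w 0 1 t| ≤ S * Real.exp (-lam * t)) →
    ∀ t ∈ Icc 0 T, |P.remainder K (fun x => w 0 x t) (X t)| ≤ C * S * Real.exp (-lam * t)

section TopDt

variable {P : Plant n m} {K : Fin n → ℝ} {c : ℕ → ℝ} {cm : ℝ} {w : ℕ → ℝ → ℝ → ℝ}
  {X : ℝ → Fin n → ℝ}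

lemma topDt_of_lt {k : ℕ} (hk : k < m) (t : ℝ) :
    P.topDt K c cm w X k t = P.q ^ k * w (2 * k) 1 t := if_pos hk

lemma topDt_self (t : ℝ) :
    P.topDt K c cm w X m t = P.remainder K (fun x => w 0 x t) (X t)
      - ∑ i ∈ Finset.range m, (alpha m c i + cm * beta m c i) * P.topDt K c cm w X i t := by
  rw [topDt, if_neg (lt_irrefl m)]
  congr 1
  exact Finset.sum_congr rfl fun i hi => by rw [topDt_of_lt (Finset.mem_range.1 hi)]

lemma topDt_zero (hm : 1 ≤ m) (t : ℝ) : P.topDt K c cm w X 0 t = w 0 1 t := by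
  rw [topDt_of_lt hm, pow_zero, one_mul]

lemma inv_pow_mul_topDt (hq : P.q ≠ 0) {k : ℕ} (hk : k < m) (t : ℝ) :
    P.q⁻¹ ^ k * P.topDt K c cm w X k t = w (2 * k) 1 t := by
  rw [topDt_of_lt hk, inv_pow, inv_mul_cancel_left₀ (pow_ne_zero k hq)]

lemma chain_zero (t : ℝ) : P.chain K c cm w X 0 t = 0 := by simp [chain, yPoly, evP]

lemma chain_succ {j : ℕ} (hj : j < m) (t : ℝ) :
    P.chain K c cm w X (j + 1) t
      = P.topDt K c cm w X j t + evP j (tau c j) fun i => P.topDt K c cm w X i t :=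
  evP_yPoly_succ c hj _

lemma chain_one (hm : 1 ≤ m) (t : ℝ) : P.chain K c cm w X 1 t = w 0 1 t := by
  rw [chain_succ hm, topDt_zero hm, evP, Finset.sum_range_zero, add_zero]

lemma sum_mul_topDt (t : ℝ) :
    ∑ i ∈ Finset.range m, (alpha m c i + cm * beta m c i) * P.topDt K c cm w X i t
      = P.chain K c cm w X (m - 1) t
        + evP m (Polynomial.X * tau c (m - 1)) (fun j => P.topDt K c cm w X j t)
        + cm * P.chain K c cm w X m t := by
  rw [chain, ← evP_add, chain, evP, evP, Finset.mul_sum, ← Finset.sum_add_distrib]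
  refine Finset.sum_congr rfl fun i _ => ?_
  rw [alpha, beta]
  ring

end TopDt

namespace IsTarget

variable {P : Plant n m} {K : Fin n → ℝ} {c : ℕ → ℝ} {cm : ℝ} {w : ℕ → ℝ → ℝ → ℝ}
  {X : ℝ → Fin n → ℝ}

lemma hasDerivWithinAt_topDt (h : P.IsTarget K c cm w X) (hq : 0 < P.q) {k : ℕ} (hk : k < m)
    {t : ℝ} (ht : 0 ≤ t) :
    HasDerivWithinAt (P.topDt K c cm w X k) (P.topDt K c cm w X (k + 1) t) (Ici 0) t := by
  rw [funext (topDt_of_lt hk), topDt]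
  split_ifs with hk'
  · refine ((h.jet.time hq (i := 2 * k) (by lia) ht unitInterval.one_mem).const_mul
      _).congr_deriv ?_
    rw [show 2 * (k + 1) = 2 * k + 2 by ring, pow_succ]
    ring
  · obtain rfl : k = m - 1 := by lia
    exact h.top t ht

lemma hasDerivWithinAt_chain (h : P.IsTarget K c cm w X) (hq : 0 < P.q) {i : ℕ} (hi : i + 1 < m)
    {t : ℝ} (ht : 0 ≤ t) :
    HasDerivWithinAt (P.chain K c cm w X (i + 1)) (P.chain K c cm w X (i + 2) t
      - P.chain K c cm w X i t - c (i + 1) * P.chain K c cm w X (i + 1) t) (Ici 0) t := by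
  obtain ⟨k, rfl⟩ : ∃ k, m = k + 1 := ⟨m - 1, by lia⟩
  refine (hasDerivWithinAt_evP (fun j hj => h.hasDerivWithinAt_topDt hq hj ht) _).congr_deriv ?_
  rw [yPoly_succ_coeff c (by lia), if_neg (by lia), X_mul_yPoly, evP_sub, evP_sub, evP_C_mul,
    zero_mul, add_zero]
  rfl

lemma hasDerivWithinAt_chain_top (h : P.IsTarget K c cm w X) (hm : 1 ≤ m) (hq : 0 < P.q) {t : ℝ}
    (ht : 0 ≤ t) :
    HasDerivWithinAt (P.chain K c cm w X m) (-P.chain K c cm w X (m - 1) t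
      - cm * P.chain K c cm w X m t + P.remainder K (fun x => w 0 x t) (X t)) (Ici 0) t := by
  obtain ⟨k, rfl⟩ : ∃ k, m = k + 1 := ⟨m - 1, by lia⟩
  refine (hasDerivWithinAt_evP (fun j hj => h.hasDerivWithinAt_topDt hq hj ht) _).congr_deriv ?_
  rw [yPoly_succ_coeff c le_rfl, if_pos rfl, one_mul, topDt_self, sum_mul_topDt,
    add_tsub_cancel_right, yPoly, mul_add, evP_add, ← pow_succ', evP_X_pow, if_neg (lt_irrefl _)]
  ring

lemma left_even (h : P.IsTarget K c cm w X) (hq : 0 < P.q) {k : ℕ} (hk : k < m) {t : ℝ}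
    (ht : 0 ≤ t) : w (2 * k) 0 t = 0 := by
  induction k generalizing t with
  | zero => exact h.left t ht
  | succ k ih =>
    have hheat := h.jet.time hq (i := 2 * k) (by lia) ht unitInterval.zero_mem
    have hzero : HasDerivWithinAt (w (2 * k) 0) 0 (Ici 0) t :=
      (hasDerivWithinAt_const t (Ici 0) (0 : ℝ)).congr (fun s hs => ih (by lia) hs)
        (ih (by lia) ht)
    have hderiv := (uniqueDiffOn_Ici (0 : ℝ) t ht).eq_deriv _ hheat hzero
    exact (mul_eq_zero.1 hderiv).resolve_left hq.ne'

section InitialBound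

variable {M S : ℝ}

lemma abs_initial_le_mul (h : P.IsTarget K c cm w X) (hq : 0 < P.q) (hM : InitialBound m w X M)
    (hMS : M ≤ S) {k : ℕ} (hk : k < m) {x : ℝ} (hx : x ∈ Icc (0 : ℝ) 1) :
    |w (2 * k) x 0| ≤ S * x := by
  have hlip := h.jet.abs_sub_le (i := 2 * k) (by lia) le_rfl (hM.jet (2 * k + 1) (by lia)) hx
    unitInterval.zero_mem
  rw [h.left_even hq hk le_rfl, sub_zero, sub_zero, abs_of_nonneg hx.1] at hlip
  exact hlip.trans (mul_le_mul_of_nonneg_right hMS hx.1)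

lemma abs_initial_sub_le_mul (h : P.IsTarget K c cm w X) (hM : InitialBound m w X M)
    (hMS : M ≤ S) {k : ℕ} (hk : k < m) {x : ℝ} (hx : x ∈ Icc (0 : ℝ) 1) :
    |w (2 * k) x 0 - w (2 * k) 1 0| ≤ S * (1 - x) := by
  have hlip := h.jet.abs_sub_le (i := 2 * k) (by lia) le_rfl (hM.jet (2 * k + 1) (by lia)) hx
    unitInterval.one_mem
  rw [abs_sub_comm x, abs_of_nonneg (sub_nonneg.2 hx.2)] at hlip
  exact hlip.trans (mul_le_mul_of_nonneg_right hMS (sub_nonneg.2 hx.2))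

variable {lam T : ℝ}

lemma abs_left_deriv_le (h : P.IsTarget K c cm w X) (hq : 0 < P.q) (hlam : 0 < lam)
    (hlq : lam ≤ P.q) (hM : InitialBound m w X M) (hMS : M ≤ S) {k : ℕ} (hk : k < m)
    (hright : ∀ t ∈ Icc 0 T, |w (2 * k) 1 t| ≤ S * Real.exp (-lam * t)) {t : ℝ}
    (ht : t ∈ Icc 0 T) : |w (2 * k + 1) 0 t| ≤ 2 * S * Real.exp (-lam * t) :=
  h.jet.abs_deriv_zero_le hq hlam hlq (hM.nonneg.trans hMS) (by lia)
    (fun _ ht => h.left_even hq hk ht.1) hright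
    (fun _ hx => h.abs_initial_le_mul hq hM hMS hk hx) ht

lemma abs_right_deriv_le (h : P.IsTarget K c cm w X) (hq : 0 < P.q) (hlam : 0 < lam)
    (hlq : lam ≤ P.q) (hM : InitialBound m w X M) (hMS : M ≤ S) {k : ℕ} (hk : k < m)
    (hright : ∀ t ∈ Icc 0 T, |w (2 * k) 1 t| ≤ S * Real.exp (-lam * t))
    (hderiv : ∀ t ∈ Icc 0 T,
      |P.q⁻¹ ^ k * P.topDt K c cm w X (k + 1) t| ≤ P.q * S * Real.exp (-lam * t))
    {t : ℝ} (ht : t ∈ Icc 0 T) : |w (2 * k + 1) 1 t| ≤ 2 * S * Real.exp (-lam * t) := by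
  refine h.jet.abs_deriv_one_le hq hlam hlq (hM.nonneg.trans hMS) (by lia)
    (fun _ ht => h.left_even hq hk ht.1) hright (fun t ht => ?_) hderiv
    (fun _ hx => h.abs_initial_sub_le_mul hM hMS hk hx) ht
  exact ((h.hasDerivWithinAt_topDt hq hk ht).const_mul _).congr
    (fun s _ => (inv_pow_mul_topDt hq.ne' hk s).symm) (inv_pow_mul_topDt hq.ne' hk t).symm

lemma abs_le_of_right (h : P.IsTarget K c cm w X) (hm : 1 ≤ m) (hq : 0 < P.q) (hlam : 0 < lam)
    (hlq : lam ≤ P.q) (hM : InitialBound m w X M) (hMS : M ≤ S)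
    (hright : ∀ t ∈ Icc 0 T, |w 0 1 t| ≤ S * Real.exp (-lam * t)) {x t : ℝ}
    (hx : x ∈ Icc (0 : ℝ) 1) (ht : t ∈ Icc 0 T) : |w 0 x t| ≤ S * Real.exp (-lam * t) := by
  have hS : 0 ≤ S := hM.nonneg.trans hMS
  have hexp : 0 ≤ S * Real.exp (-lam * t) := by positivity
  refine (h.jet.abs_le_of_boundary hq hlam hlq hS (i := 0) (by lia) (fun t ht => h.left t ht.1)
    hright (fun _ hx => h.abs_initial_le_mul hq hM hMS (k := 0) hm hx) hx ht).trans ?_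
  nlinarith [mul_nonneg hexp (sq_nonneg (1 - x))]

end InitialBound

end IsTarget

end Plant

namespace Plant

lemma exists_bound_remainderGain (P : Plant n m) (K : Fin n → ℝ) (hm : 1 ≤ m) (hq : 0 < P.q)
    (hK : IsHurwitz (P.AK K)) :
    ∃ mu : ℝ, 0 < mu ∧ ∀ lam, 0 < lam → lam < mu → ∃ C : ℝ, 0 ≤ C ∧
      ∀ {c : ℕ → ℝ} {cm : ℝ} {w : ℕ → ℝ → ℝ → ℝ} {X : ℝ → Fin n → ℝ} {M : ℝ},
        P.IsTarget K c cm w X → InitialBound m w X M → P.RemainderGain K w X lam C M := by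
  obtain ⟨mu, hmu, hstable⟩ := exists_bound_of_isHurwitz hK
  obtain ⟨CG, hCG, hremainder⟩ := P.exists_bound_remainder K hm
  refine ⟨min mu P.q, lt_min hmu hq, fun lam hlam hlmu => ?_⟩
  obtain ⟨CX, hCX, hX⟩ := hstable lam (hlmu.trans_le (min_le_left _ _))
  have hlq : lam ≤ P.q := (hlmu.trans_le (min_le_right _ _)).le
  refine ⟨CG * (1 + CX * (1 + 2 * ‖P.B‖)), by positivity,
    fun {c cm w X M} h hM S T hMS hright t ht => ?_⟩
  have hS : 0 ≤ S := hM.nonneg.trans hMS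
  have hinput : ∀ s ∈ Icc 0 T, ‖w 1 0 s • P.B‖ ≤ 2 * S * ‖P.B‖ * Real.exp (-lam * s) :=
    fun s hs => by
      rw [norm_smul, Real.norm_eq_abs, mul_right_comm]
      exact mul_le_mul_of_nonneg_right
        (h.abs_left_deriv_le hq hlam hlq hM hMS (k := 0) hm hright hs) (norm_nonneg _)
  have hstate : ‖X t‖ ≤ CX * (1 + 2 * ‖P.B‖) * S * Real.exp (-lam * t) := by
    refine (hX X (fun t => w 1 0 t • P.B) _ T h.odeX hinput t ht).trans ?_
    rw [mul_assoc CX _ S]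
    gcongr
    linarith [hM.state]
  rw [mul_assoc CG, mul_assoc CG]
  refine hremainder _ _ _ (fun x hx => ?_) ?_
  · refine (h.abs_le_of_right hm hq hlam hlq hM hMS hright hx ht).trans ?_
    gcongr
    exact le_mul_of_one_le_left hS (le_add_of_nonneg_right (by positivity))
  · refine hstate.trans ?_
    gcongr
    exact le_add_of_nonneg_left zero_le_one

section Chain

variable {P : Plant n m} {K : Fin n → ℝ} {c : ℕ → ℝ} {cm lam C : ℝ}

lemma exists_sum_sq_chain_zero_le (P : Plant n m) (K : Fin n → ℝ) (c : ℕ → ℝ) (cm : ℝ) :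
    ∃ V : ℝ, 0 ≤ V ∧ ∀ {w : ℕ → ℝ → ℝ → ℝ} {X : ℝ → Fin n → ℝ} {M : ℝ}, InitialBound m w X M →
      ∑ i ∈ Finset.range m, P.chain K c cm w X (i + 1) 0 ^ 2 ≤ V * M ^ 2 := by
  set Q := ∑ j ∈ Finset.range m, |P.q ^ j|
  have hQ : 0 ≤ Q := Finset.sum_nonneg fun _ _ => abs_nonneg _
  refine ⟨∑ i ∈ Finset.range m, ((∑ j ∈ Finset.range m, |(yPoly c (i + 1)).coeff j|) * Q) ^ 2,
    Finset.sum_nonneg fun _ _ => sq_nonneg _, fun {w X M} hM => ?_⟩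
  have hdt : ∀ j < m, |P.topDt K c cm w X j 0| ≤ Q * M := fun j hj => by
    rw [topDt_of_lt hj, abs_mul]
    exact mul_le_mul (Finset.single_le_sum (f := fun j => |P.q ^ j|) (fun _ _ => abs_nonneg _)
      (Finset.mem_range.2 hj)) (hM.jet _ (by lia) 1 unitInterval.one_mem) (abs_nonneg _) hQ
  rw [Finset.sum_mul]
  refine Finset.sum_le_sum fun i _ => ?_
  rw [← mul_pow, ← sq_abs, mul_assoc]
  exact pow_le_pow_left₀ (abs_nonneg _) (abs_evP_le _ hdt) 2

variable {w : ℕ → ℝ → ℝ → ℝ} {X : ℝ → Fin n → ℝ} {M S T : ℝ}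

lemma RemainderGain.abs_topDt_self_le (hG : P.RemainderGain K w X lam C M) (hm : 1 ≤ m)
    (hM : 0 ≤ M) {D : ℝ} (hD : 0 ≤ D)
    (hlower : ∀ j < m, ∀ t, 0 ≤ t → |P.topDt K c cm w X j t| ≤ D * M * Real.exp (-lam * t))
    {t : ℝ} (ht : 0 ≤ t) :
    |P.topDt K c cm w X m t|
      ≤ (C * (1 + D) + (∑ i ∈ Finset.range m, |alpha m c i + cm * beta m c i|) * D)
        * M * Real.exp (-lam * t) := by
  have hright : ∀ s ∈ Icc 0 t, |w 0 1 s| ≤ (1 + D) * M * Real.exp (-lam * s) := fun s hs => by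
    have hw := hlower 0 hm s hs.1
    rw [topDt_zero hm] at hw
    refine hw.trans ?_
    gcongr
    exact le_add_of_nonneg_left zero_le_one
  have hremainder := hG _ t (le_mul_of_one_le_left hM (le_add_of_nonneg_right hD)) hright t
    ⟨ht, le_rfl⟩
  have hsum : |∑ i ∈ Finset.range m, (alpha m c i + cm * beta m c i) * P.topDt K c cm w X i t|
      ≤ (∑ i ∈ Finset.range m, |alpha m c i + cm * beta m c i|)
        * (D * M * Real.exp (-lam * t)) := by
    rw [Finset.sum_mul]
    refine (Finset.abs_sum_le_sum_abs _ _).trans (Finset.sum_le_sum fun i hi => ?_)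
    rw [abs_mul]
    exact mul_le_mul_of_nonneg_left (hlower i (Finset.mem_range.1 hi) t ht) (abs_nonneg _)
  rw [topDt_self]
  linarith [abs_sub (P.remainder K (fun x => w 0 x t) (X t))
    (∑ i ∈ Finset.range m, (alpha m c i + cm * beta m c i) * P.topDt K c cm w X i t)]

namespace IsTarget

lemma sum_sq_chain_le_of_right (h : P.IsTarget K c cm w X) (hm : 1 ≤ m) (hq : 0 < P.q)
    (hlam : 0 < lam) (hcm : 3 * lam ≤ cm) (hc : ∀ i, i + 1 < m → 3 * lam ≤ 2 * c (i + 1))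
    (hG : P.RemainderGain K w X lam C M) (hMS : M ≤ S)
    (hright : ∀ t ∈ Icc 0 T, |w 0 1 t| ≤ S * Real.exp (-lam * t)) {t : ℝ} (ht : t ∈ Icc 0 T) :
    ∑ i ∈ Finset.range m, P.chain K c cm w X (i + 1) t ^ 2
      ≤ (∑ i ∈ Finset.range m, P.chain K c cm w X (i + 1) 0 ^ 2 + (C * S) ^ 2 / (lam * cm))
        * Real.exp (-lam * t) ^ 2 := by
  obtain ⟨k, rfl⟩ : ∃ k, m = k + 1 := ⟨m - 1, by lia⟩
  exact sum_sq_le_of_chain hlam hcm (fun i hi => hc i (by lia)) chain_zero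
    (fun i hi t ht => h.hasDerivWithinAt_chain hq (by lia) ht)
    (fun t ht => h.hasDerivWithinAt_chain_top hm hq ht) (hG S T hMS hright) ht

-- The weighted maximum `Y` of `|w(1,·)| = |y_1|` enters the Lyapunov estimate through the remainder
-- with the factor `C² / (lam cm)`; for large `cm` it is absorbed by the left-hand side.
lemma sum_sq_chain_le (h : P.IsTarget K c cm w X) (hm : 1 ≤ m) (hq : 0 < P.q) (hlam : 0 < lam)
    (hcm : 3 * lam ≤ cm) (hC : 4 * C ^ 2 ≤ lam * cm)
    (hc : ∀ i, i + 1 < m → 3 * lam ≤ 2 * c (i + 1)) (hM : 0 ≤ M)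
    (hG : P.RemainderGain K w X lam C M) {V : ℝ}
    (hV : ∑ i ∈ Finset.range m, P.chain K c cm w X (i + 1) 0 ^ 2 ≤ V * M ^ 2)
    {t : ℝ} (ht : 0 ≤ t) :
    ∑ i ∈ Finset.range m, P.chain K c cm w X (i + 1) t ^ 2
      ≤ (2 * V + 1) * M ^ 2 * Real.exp (-lam * t) ^ 2 := by
  have hcont : Continuous (w 0 1) := continuous_uncurry_left (h.jet.cont 0 (by lia)) 1
  obtain ⟨s, hs, hmax⟩ := exists_weighted_bound lam ht hcont
  set Y := |w 0 1 s| * Real.exp (lam * s) with hY_def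
  have hY : 0 ≤ Y := by positivity
  have hright : ∀ r ∈ Icc 0 t, |w 0 1 r| ≤ (M + Y) * Real.exp (-lam * r) := fun r hr =>
    (hmax r hr).trans (mul_le_mul_of_nonneg_right (le_add_of_nonneg_left hM) (Real.exp_nonneg _))
  have hgain : (C * (M + Y)) ^ 2 / (lam * cm) ≤ (M ^ 2 + Y ^ 2) / 2 := by
    rw [div_le_iff₀ (mul_pos hlam (by linarith)), mul_pow]
    nlinarith [mul_le_mul hC (add_sq_le (a := M) (b := Y)) (sq_nonneg _) (by nlinarith)]
  have hLyapunov : ∀ r ∈ Icc 0 t, ∑ i ∈ Finset.range m, P.chain K c cm w X (i + 1) r ^ 2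
      ≤ (V * M ^ 2 + (M ^ 2 + Y ^ 2) / 2) * Real.exp (-lam * r) ^ 2 := fun r hr =>
    (h.sum_sq_chain_le_of_right hm hq hlam hcm hc hG (le_add_of_nonneg_right hY) hright
      hr).trans (mul_le_mul_of_nonneg_right (add_le_add hV hgain) (sq_nonneg _))
  have habsorb : Y ^ 2 ≤ V * M ^ 2 + (M ^ 2 + Y ^ 2) / 2 := by
    have hfirst : w 0 1 s ^ 2 ≤ ∑ i ∈ Finset.range m, P.chain K c cm w X (i + 1) s ^ 2 := by
      have hchain : P.chain K c cm w X 1 s = w 0 1 s := chain_one hm s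
      rw [← hchain]
      exact Finset.single_le_sum (f := fun i => P.chain K c cm w X (i + 1) s ^ 2)
        (fun _ _ => sq_nonneg _) (Finset.mem_range.2 hm)
    have hle := hfirst.trans (hLyapunov s hs)
    rw [neg_mul, Real.exp_neg, inv_pow, ← div_eq_mul_inv, le_div_iff₀ (by positivity)] at hle
    rwa [← sq_abs (w 0 1 s), ← mul_pow, ← hY_def] at hle
  refine (hLyapunov t ⟨ht, le_rfl⟩).trans (mul_le_mul_of_nonneg_right ?_ (sq_nonneg _))
  linarith

lemma abs_traces_le (h : P.IsTarget K c cm w X) (hq : 0 < P.q) (hlam : 0 < lam)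
    (hlq : lam ≤ P.q) (hM : InitialBound m w X M) (hMS : M ≤ S)
    (hright : ∀ k < m, ∀ t ∈ Icc 0 T, |w (2 * k) 1 t| ≤ S * Real.exp (-lam * t))
    (hderiv : ∀ k < m, ∀ t ∈ Icc 0 T,
      |P.q⁻¹ ^ k * P.topDt K c cm w X (k + 1) t| ≤ P.q * S * Real.exp (-lam * t))
    {t : ℝ} (ht : t ∈ Icc 0 T) {k : ℕ} (hk : k < 2 * m) :
    |w k 0 t| ≤ 2 * S * Real.exp (-lam * t) ∧ |w k 1 t| ≤ 2 * S * Real.exp (-lam * t) := by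
  obtain ⟨k, rfl | rfl⟩ := k.even_or_odd'
  · have hk' : k < m := by lia
    have hS : 0 ≤ S := hM.nonneg.trans hMS
    have hexp : 0 ≤ S * Real.exp (-lam * t) := by positivity
    rw [h.left_even hq hk' ht.1, abs_zero]
    constructor <;> linarith [hright k hk' t ht]
  · have hk' : k < m := by lia
    exact ⟨h.abs_left_deriv_le hq hlam hlq hM hMS hk' (hright k hk') ht,
      h.abs_right_deriv_le hq hlam hlq hM hMS hk' (hright k hk') (hderiv k hk') ht⟩

end IsTarget

end Chain

end Plant

namespace Plant

lemma exists_pos_lt_forall_three_mul_le {mu : ℝ} (hmu : 0 < mu) {c : ℕ → ℝ}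
    (hc : ∀ i, 1 ≤ i → i < m → 0 < c i) :
    ∃ lam : ℝ, 0 < lam ∧ lam < mu ∧ ∀ i, i + 1 < m → 3 * lam ≤ 2 * c (i + 1) := by
  have hgains : ∀ᶠ lam in 𝓝[>] (0 : ℝ), ∀ i ∈ Finset.range (m - 1), lam ≤ 2 / 3 * c (i + 1) :=
    (Finset.eventually_all _).2 fun i hi => by
      have hi' := Finset.mem_range.1 hi
      have hpos := hc (i + 1) (by lia) (by lia)
      filter_upwards [Ioo_mem_nhdsGT (show 0 < 2 / 3 * c (i + 1) by positivity)] with lam h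
        using h.2.le
  have hsmall : ∀ᶠ lam in 𝓝[>] (0 : ℝ), lam ∈ Ioo 0 mu := Ioo_mem_nhdsGT hmu
  obtain ⟨lam, ⟨hlam, hlmu⟩, hle⟩ := (hsmall.and hgains).exists
  exact ⟨lam, hlam, hlmu, fun i hi => by linarith [hle i (Finset.mem_range.2 (by lia))]⟩

section Decay

variable {P : Plant n m} {K : Fin n → ℝ} {c : ℕ → ℝ} {cm lam C : ℝ}

lemma exists_bound_topDt_of_lt (hm : 1 ≤ m) (hq : 0 < P.q) (hlam : 0 < lam)
    (hcm : 3 * lam ≤ cm) (hC : 4 * C ^ 2 ≤ lam * cm)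
    (hc : ∀ i, i + 1 < m → 3 * lam ≤ 2 * c (i + 1)) :
    ∃ D : ℝ, 0 ≤ D ∧ ∀ {w : ℕ → ℝ → ℝ → ℝ} {X : ℝ → Fin n → ℝ} {M : ℝ},
      P.IsTarget K c cm w X → InitialBound m w X M → P.RemainderGain K w X lam C M →
      ∀ k < m, ∀ t, 0 ≤ t → |P.topDt K c cm w X k t| ≤ D * M * Real.exp (-lam * t) := by
  obtain ⟨V, hV, hinitial⟩ := P.exists_sum_sq_chain_zero_le K c cm
  obtain ⟨A, hA, hinverse⟩ := exists_bound_of_yPoly c m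
  refine ⟨A * (2 * V + 1), by positivity, fun {w X M} h hM hG k hk t ht => ?_⟩
  have hM0 := hM.nonneg
  have hsum := h.sum_sq_chain_le hm hq hlam hcm hC hc hM0 hG (hinitial hM) ht
  have hchain : ∀ j < m, |P.chain K c cm w X (j + 1) t|
      ≤ (2 * V + 1) * M * Real.exp (-lam * t) := fun j hj => by
    refine abs_le_of_sq_le_sq ?_ (by positivity)
    refine ((Finset.single_le_sum (f := fun i => P.chain K c cm w X (i + 1) t ^ 2)
      (fun _ _ => sq_nonneg _) (Finset.mem_range.2 hj)).trans hsum).trans ?_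
    rw [mul_pow, mul_pow]
    gcongr
    exact le_self_pow₀ (by linarith) two_ne_zero
  rw [mul_assoc, mul_assoc, ← mul_assoc (2 * V + 1)]
  exact hinverse (fun j => P.topDt K c cm w X j t) _ (by positivity)
    (fun j hj => chain_succ (P := P) (K := K) hj t ▸ hchain j hj) k hk

lemma exists_bound_topDt (hm : 1 ≤ m) (hq : 0 < P.q) (hlam : 0 < lam)
    (hcm : 3 * lam ≤ cm) (hC0 : 0 ≤ C) (hC : 4 * C ^ 2 ≤ lam * cm)
    (hc : ∀ i, i + 1 < m → 3 * lam ≤ 2 * c (i + 1)) :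
    ∃ D : ℝ, 0 ≤ D ∧ ∀ {w : ℕ → ℝ → ℝ → ℝ} {X : ℝ → Fin n → ℝ} {M : ℝ},
      P.IsTarget K c cm w X → InitialBound m w X M → P.RemainderGain K w X lam C M →
      ∀ k ≤ m, ∀ t, 0 ≤ t → |P.topDt K c cm w X k t| ≤ D * M * Real.exp (-lam * t) := by
  obtain ⟨D, hD, hlower⟩ := exists_bound_topDt_of_lt (K := K) hm hq hlam hcm hC hc
  set D' := C * (1 + D) + (∑ i ∈ Finset.range m, |alpha m c i + cm * beta m c i|) * D
  have hD' : 0 ≤ D' :=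
    add_nonneg (by positivity) (mul_nonneg (Finset.sum_nonneg fun _ _ => abs_nonneg _) hD)
  refine ⟨D + D', by positivity, fun {w X M} h hM hG k hk t ht => ?_⟩
  have hM0 := hM.nonneg
  rcases hk.lt_or_eq with hk | rfl
  · refine (hlower h hM hG k hk t ht).trans ?_
    gcongr
    exact le_add_of_nonneg_right hD'
  · refine (hG.abs_topDt_self_le hm hM0 hD (hlower h hM hG) ht).trans ?_
    exact mul_le_mul_of_nonneg_right
      (mul_le_mul_of_nonneg_right (le_add_of_nonneg_left hD) hM0) (Real.exp_nonneg _)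

lemma exists_bound_traces (hm : 1 ≤ m) (hq : 0 < P.q) (hlam : 0 < lam) (hlq : lam ≤ P.q)
    (hcm : 3 * lam ≤ cm) (hC0 : 0 ≤ C) (hC : 4 * C ^ 2 ≤ lam * cm)
    (hc : ∀ i, i + 1 < m → 3 * lam ≤ 2 * c (i + 1)) :
    ∃ R : ℝ, ∀ {w : ℕ → ℝ → ℝ → ℝ} {X : ℝ → Fin n → ℝ} {M : ℝ},
      P.IsTarget K c cm w X → InitialBound m w X M → P.RemainderGain K w X lam C M →
      ∀ t, 0 ≤ t → ∀ k < 2 * m,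
        |w k 0 t| ≤ R * M * Real.exp (-lam * t) ∧ |w k 1 t| ≤ R * M * Real.exp (-lam * t) := by
  obtain ⟨D, hD, htop⟩ := exists_bound_topDt (K := K) hm hq hlam hcm hC0 hC hc
  set Q := ∑ k ∈ Finset.range (m + 1), P.q⁻¹ ^ k
  have hQ : ∀ k ≤ m, P.q⁻¹ ^ k ≤ Q := fun k hk =>
    Finset.single_le_sum (f := fun k => P.q⁻¹ ^ k) (fun _ _ => by positivity)
      (Finset.mem_range.2 (by lia))
  have hQ0 : 0 ≤ Q := zero_le_one.trans (hQ 0 (Nat.zero_le m))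
  refine ⟨2 * (1 + Q * D), fun {w X M} h hM hG t ht k hk => ?_⟩
  have hM0 := hM.nonneg
  have hscaled : ∀ j ≤ m, ∀ i ≤ m, ∀ t, 0 ≤ t →
      |P.q⁻¹ ^ i * P.topDt K c cm w X j t| ≤ (1 + Q * D) * M * Real.exp (-lam * t) :=
    fun j hj i hi t ht => by
      rw [abs_mul, abs_of_nonneg (by positivity)]
      calc P.q⁻¹ ^ i * |P.topDt K c cm w X j t| ≤ Q * (D * M * Real.exp (-lam * t)) :=
            mul_le_mul (hQ i hi) (htop h hM hG j hj t ht) (abs_nonneg _) hQ0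
        _ ≤ (1 + Q * D) * M * Real.exp (-lam * t) := by
            have hexp : 0 ≤ M * Real.exp (-lam * t) := by positivity
            linarith
  rw [mul_assoc 2]
  refine h.abs_traces_le (T := t) hq hlam hlq hM
    (le_mul_of_one_le_left hM0 (le_add_of_nonneg_right (by positivity)))
    (fun k hk t ht => ?_) (fun k hk t ht => ?_) ⟨ht, le_rfl⟩ hk
  · rw [← inv_pow_mul_topDt (K := K) (c := c) (cm := cm) (w := w) (X := X) hq.ne' hk t]
    exact hscaled k hk.le k hk.le t ht.1
  · have hnext := mul_le_mul_of_nonneg_left (hscaled (k + 1) hk (k + 1) hk t ht.1) hq.le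
    rwa [← abs_of_pos hq, ← abs_mul, abs_of_pos hq, pow_succ', mul_assoc,
      mul_inv_cancel_left₀ hq.ne', ← mul_assoc, ← mul_assoc, mul_assoc P.q] at hnext

end Decay

lemma exists_decay (P : Plant n m) (K : Fin n → ℝ) (hm : 1 ≤ m) (hq : 0 < P.q)
    (hK : IsHurwitz (P.AK K)) {c : ℕ → ℝ} (hc : ∀ i, 1 ≤ i → i < m → 0 < c i) :
    ∃ cstar : ℝ, 0 < cstar ∧ ∀ cm : ℝ, cstar < cm → ∃ lam : ℝ, 0 < lam ∧ ∃ R : ℝ,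
      ∀ {w : ℕ → ℝ → ℝ → ℝ} {X : ℝ → Fin n → ℝ} {M : ℝ},
        P.IsTarget K c cm w X → InitialBound m w X M → ∀ t, 0 ≤ t → ∀ k < 2 * m,
          |w k 0 t| ≤ R * M * Real.exp (-lam * t) ∧ |w k 1 t| ≤ R * M * Real.exp (-lam * t) := by
  obtain ⟨mu, hmu, hgain⟩ := P.exists_bound_remainderGain K hm hq hK
  obtain ⟨lam, hlam, hlmu, hclam⟩ := exists_pos_lt_forall_three_mul_le (lt_min hmu hq) hc
  obtain ⟨C, hC, hG⟩ := hgain lam hlam (hlmu.trans_le (min_le_left _ _))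
  refine ⟨3 * lam + 4 * C ^ 2 / lam, by positivity, fun cm hcm => ⟨lam, hlam, ?_⟩⟩
  have hcm_lam : 3 * lam ≤ cm := (le_add_of_nonneg_right (by positivity)).trans hcm.le
  have hcm_gain : 4 * C ^ 2 ≤ lam * cm :=
    (div_le_iff₀' hlam).1 ((le_add_of_nonneg_left (by positivity)).trans hcm.le)
  obtain ⟨R, hR⟩ := exists_bound_traces (P := P) (K := K) hm hq hlam
    (hlmu.trans_le (min_le_right _ _)).le hcm_lam hC hcm_gain hclam
  exact ⟨R, fun h hM => hR h hM (hG h hM)⟩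

lemma wJet_congr_initial (P : Plant n m) (K : Fin n → ℝ) {u v : ℝ → ℝ → ℝ} {X X' : ℝ → Fin n → ℝ}
    (hu : ∀ x ∈ Icc (0 : ℝ) 1, u x 0 = v x 0) (hX : X 0 = X' 0) (k : ℕ) (x : ℝ) :
    P.wJet K (uJet u) (fun t => X (max t 0)) k x 0
      = P.wJet K (uJet v) (fun t => X' (max t 0)) k x 0 := by
  have hjet : ∀ i x, uJet u i x 0 = uJet v i x 0 := fun i x => by
    simp only [uJet, dx, max_self]
    exact iteratedDerivWithin_congr hu (Subtype.prop _)
  simp only [wJet, transJet, hjet, max_self, hX]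

section ClosedLoop

variable {P : Plant n m} {K : Fin n → ℝ} {c : ℕ → ℝ} {cm : ℝ}

lemma IsTarget.exists_initialBound {w : ℕ → ℝ → ℝ → ℝ} {X : ℝ → Fin n → ℝ}
    (h : P.IsTarget K c cm w X) : ∃ M, InitialBound m w X M := by
  have hjet : ∀ i, ∃ M, i < 2 * m → ∀ x ∈ Icc (0 : ℝ) 1, |w i x 0| ≤ M := fun i => by
    by_cases hi : i < 2 * m
    · obtain ⟨M, hM⟩ := isCompact_Icc.exists_bound_of_continuousOn
        (continuous_uncurry_right (h.jet.cont i (by lia)) 0).continuousOn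
      exact ⟨M, fun _ => hM⟩
    · exact ⟨0, fun h => absurd h hi⟩
  choose b hb using hjet
  have hle : ∀ i < 2 * m, |b i| ≤ ∑ i ∈ Finset.range (2 * m), |b i| := fun i hi =>
    Finset.single_le_sum (f := fun i => |b i|) (fun _ _ => abs_nonneg _) (Finset.mem_range.2 hi)
  refine ⟨∑ i ∈ Finset.range (2 * m), |b i| + ‖X 0‖, fun i hi x hx => ?_, ?_⟩
  · linarith [hb i hi x hx, le_abs_self (b i), hle i hi, norm_nonneg (X 0)]
  · exact le_add_of_nonneg_left (Finset.sum_nonneg fun _ _ => abs_nonneg _)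

variable (P K c cm)

lemma exists_initialBound (hm : 1 ≤ m) (hq : 0 < P.q) (u₀ : ℝ → ℝ) (X₀ : Fin n → ℝ) :
    ∃ M, ∀ {u : ℝ → ℝ → ℝ} {X : ℝ → Fin n → ℝ} {Z : ℝ → Fin m → ℝ} {U : ℝ → ℝ},
      P.IsClosedLoopSolution K c cm u X Z U → (∀ x ∈ Icc (0 : ℝ) 1, u x 0 = u₀ x) → X 0 = X₀ →
      InitialBound m (P.wJet K (uJet u) fun t => X (max t 0)) (fun t => X (max t 0)) M := by
  by_cases hex : ∃ v X' Z U, P.IsClosedLoopSolution K c cm v X' Z U ∧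
    (∀ x ∈ Icc (0 : ℝ) 1, v x 0 = u₀ x) ∧ X' 0 = X₀
  · obtain ⟨v, X', Z', U', h', hv, hX'⟩ := hex
    obtain ⟨M, hM⟩ := (h'.isTarget hm hq).exists_initialBound
    refine ⟨M, fun {u X Z U} _ hu hX => ⟨fun i hi x hx => ?_, ?_⟩⟩
    · rw [P.wJet_congr_initial K (fun x hx => (hu x hx).trans (hv x hx).symm) (hX.trans hX'.symm)]
      exact hM.jet i hi x hx
    · have hstate := hM.state
      simp only [max_self, hX, hX'] at hstate ⊢
      exact hstate
  · exact ⟨0, fun {u X Z U} h hu hX => absurd ⟨u, X, Z, U, h, hu, hX⟩ hex⟩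

lemma exists_bound_control (hm : 1 ≤ m) (hq : 0 < P.q) :
    ∃ B : ℝ, ∀ {u : ℝ → ℝ → ℝ} {X : ℝ → Fin n → ℝ} {Z : ℝ → Fin m → ℝ} {U : ℝ → ℝ},
      P.IsClosedLoopSolution K c cm u X Z U → ∀ t, 0 ≤ t → ∀ S,
        (∀ k < 2 * m, |P.wJet K (uJet u) (fun t => X (max t 0)) k 0 t| ≤ S ∧
          |P.wJet K (uJet u) (fun t => X (max t 0)) k 1 t| ≤ S) → |U t| ≤ B * S := by
  obtain ⟨BL, -, hL⟩ := exists_bound_of_mem_jetFunctionals (P.jetL_mem K hm c cm)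
  obtain ⟨BC, -, hC⟩ := exists_bound_of_mem_jetFunctionals (P.jetC_mem K hm)
  refine ⟨BL + BC, fun h t ht S htraces => ?_⟩
  rw [h.control_eq hm hq.ne' ht, add_mul]
  exact (abs_sub _ _).trans (add_le_add (hL _ _ fun k hk => (htraces k hk).2)
    (hC _ _ fun k hk => (htraces k hk).1))

end ClosedLoop

lemma exists_control_decay (P : Plant n m) (K : Fin n → ℝ) (hm : 1 ≤ m) (hq : 0 < P.q)
    (hK : IsHurwitz (P.AK K)) {c : ℕ → ℝ} (hc : ∀ i, 1 ≤ i → i < m → 0 < c i) :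
    ∃ cstar : ℝ, 0 < cstar ∧ ∀ cm : ℝ, cstar < cm → ∃ lam : ℝ, 0 < lam ∧
      ∀ (u₀ : ℝ → ℝ) (X₀ : Fin n → ℝ), ∃ Ups : ℝ, 0 < Ups ∧
        ∀ {u : ℝ → ℝ → ℝ} {X : ℝ → Fin n → ℝ} {Z : ℝ → Fin m → ℝ} {U : ℝ → ℝ},
          P.IsClosedLoopSolution K c cm u X Z U →
          (∀ x ∈ Icc (0 : ℝ) 1, u x 0 = u₀ x) → X 0 = X₀ →
          ∀ t, 0 ≤ t → |U t| ≤ Ups * Real.exp (-lam * t) := by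
  obtain ⟨cstar, hcstar, hdecay⟩ := P.exists_decay K hm hq hK hc
  refine ⟨cstar, hcstar, fun cm hcm => ?_⟩
  obtain ⟨lam, hlam, R, htraces⟩ := hdecay cm hcm
  obtain ⟨B, hcontrol⟩ := P.exists_bound_control K c cm hm hq
  refine ⟨lam, hlam, fun u₀ X₀ => ?_⟩
  obtain ⟨M, hM⟩ := P.exists_initialBound K c cm hm hq u₀ X₀
  refine ⟨|B * (R * M)| + 1, by positivity, fun h hu hX t ht => ?_⟩
  refine (hcontrol h t ht _ (htraces (h.isTarget hm hq) (hM h hu hX) t ht)).trans ?_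
  rw [← mul_assoc]
  gcongr
  exact (le_abs_self _).trans (le_add_of_nonneg_right zero_le_one)

end Plant

end Sandwich

end

theorem mainTheorem4 (n m : ℕ) (hm : 1 ≤ m) (P : Sandwich.Plant n m) (hq : 0 < P.q)
    (K : Fin n → ℝ) (hK : Sandwich.IsHurwitz (P.AK K))
    (c : ℕ → ℝ) (hc : ∀ i, 1 ≤ i → i < m → 0 < c i) :
    ∃ cstar : ℝ, 0 < cstar ∧ ∀ cm : ℝ, cstar < cm →
      ∃ lam : ℝ, 0 < lam ∧
        ∀ (u₀ : ℝ → ℝ) (X₀ : Fin n → ℝ) (Z₀ : Fin m → ℝ),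
          ∃ Ups : ℝ, 0 < Ups ∧
            ∀ (u : ℝ → ℝ → ℝ) (X : ℝ → Fin n → ℝ) (Z : ℝ → Fin m → ℝ) (U : ℝ → ℝ),
              P.IsClosedLoopSolution K c cm u X Z U →
              (∀ x ∈ Set.Icc (0 : ℝ) 1, u x 0 = u₀ x) → X 0 = X₀ → Z 0 = Z₀ →
              ∀ t : ℝ, 0 ≤ t → |U t| ≤ Ups ∧ |U t| ≤ Ups * Real.exp (-lam * t) := by
  obtain ⟨cstar, hcstar, hdecay⟩ := P.exists_control_decay K hm hq hK hc
  refine ⟨cstar, hcstar, fun cm hcm => ?_⟩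
  obtain ⟨lam, hlam, hbound⟩ := hdecay cm hcm
  refine ⟨lam, hlam, fun u₀ X₀ _ => ?_⟩
  obtain ⟨Ups, hUps, hU⟩ := hbound u₀ X₀
  refine ⟨Ups, hUps, fun u X Z U h hu hX _ t ht => ?_⟩
  have hexp := hU h hu hX t ht
  have hexp_le_one : Real.exp (-lam * t) ≤ 1 := Real.exp_le_one_iff.2 (by nlinarith)
  exact ⟨hexp.trans (mul_le_of_le_one_right hUps.le hexp_le_one), hexp⟩
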